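/- Let $M$ be a smooth manifold (Hausdorff, second countable, finite-dimensional, without boundary) and let $E\to M$ be a smooth real vector bundle of rank $n$. For a smooth complex-linear connection $\nabla$ on $E\otimes_{\mathbb R}\mathbb C$ let $\Omega$ be its curvature form matrix with respect to a local frame of $E$ (regarded as a frame of $E\otimes_{\mathbb R}\mathbb C$): if $\nabla e_i=\sum_j e_j\otimes\omega^j_i$, then $\Omega^j_i=d\omega^j_i+\sum_k\omega^j_k\wedge\omega^k_i$. For $f$ holomorphic near $0$ put $$\Sigma_f(E\otimes\mathbb C,\nabla)=\operatorname{tr} f\!\left(\tfrac{\Omega}{2\pi i}\right),\qquad \det\!\left(1+t\,\tfrac{\Omega}{2\pi i}\right)=\sum_k c_k(\nabla)\,t^k,\qquad p_k(E,\nabla)=(-1)^k c_{2k}(\nabla),$$ where $f(\Omega/2\pi i)$ is given by the Taylor series of $f$ at $0$ (a finite sum, since $\Omega$ is nilpotent). Such connections exist; the forms $\Sigma_f(E\otimes\mathbb C,\nabla)$ (for the function $f$ below) and $p_k(E,\nabla)$ are closed and their classes in $H^{2*}_{\mathrm{dR}}(M;\mathbb C)$ do not depend on $\nabla$. Denote the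 classes by $\Sigma_f(E\otimes\mathbb C)$ (the additive class) and $p_k(E)$ (the Pontryagin classes). **Lemma.** Let $g$ be holomorphic near $0$ with $g(0)=0$, with Taylor series $g(z)=\sum_d a_d z^d$ at $0$, and let $f(z)=g(z^2)/2$. Then in $H^{2*}_{\mathrm{dR}}(M;\mathbb C)$ $$\Sigma_f(E\otimes_{\mathbb R}\mathbb C)=\sum_{j=1}^{\lfloor n/2\rfloor} g(y_j),$$ where the Pontryagin classes $p_1(E),\dots,p_{\lfloor n/2\rfloor}(E)$ are the elementary symmetric functions of the indeterminates $y_1,\dots,y_{\lfloor n/2\rfloor}$. That is: if for each $d$ one writes the symmetric polynomial $\sum_j a_d\,y_j^d$ as a polynomial $Q_d(e_1,\dots,e_{\lfloor n/2\rfloor})$ in the elementary symmetric polynomials, then for every $N$ with $4N>\dim M$ $$\Sigma_f(E\otimes_{\mathbb R}\mathbb C)=\sum_{d<N} Q_d\bigl(p_1(E),\dots,p_{\lfloor n/2\rfloor}(E)\bigr).$$ -/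

import Mathlib

open scoped Manifold ContDiff Bundle
open Bundle

noncomputable section

/-! ### Complex-valued exterior forms on a real vector space -/

/-- The algebra `Λ(W* ⊗ ℂ)` of complex-valued (mixed) exterior forms on the real vector space `W`;
the multiplication is the wedge product. -/
abbrev CForm (W : Type*) [AddCommGroup W] [Module ℝ W] [TopologicalSpace W] : Type _ :=
  ExteriorAlgebra ℂ (W →L[ℝ] ℂ)

/-- The subalgebra `Λ^{2*}(W* ⊗ ℂ)` of forms of even degree. -/
abbrev EvenCForm (W : Type*) [AddCommGroup W] [Module ℝ W] [TopologicalSpace W] : Type _ :=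
  CliffordAlgebra.even (0 : QuadraticForm ℂ (W →L[ℝ] ℂ))

section PointwiseAlgebra

variable {W : Type*} [AddCommGroup W] [Module ℝ W] [TopologicalSpace W]

/-- Graded commutation of a covector with an arbitrary form. -/
theorem CForm.ι_mul_comm (α : W →L[ℝ] ℂ) (a : CForm W) :
    ExteriorAlgebra.ι ℂ α * a = CliffordAlgebra.involute a * ExteriorAlgebra.ι ℂ α := by
  induction a using ExteriorAlgebra.induction with
  | algebraMap r => simp [Algebra.commutes]
  | ι β =>
    have h := ExteriorAlgebra.ι_add_mul_swap (R := ℂ) α β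
    have h2 : CliffordAlgebra.involute (ExteriorAlgebra.ι ℂ β : CForm W)
        = - ExteriorAlgebra.ι ℂ β := CliffordAlgebra.involute_ι β
    rw [h2, neg_mul]
    exact eq_neg_of_add_eq_zero_left h
  | mul a b ha hb => rw [map_mul, ← mul_assoc, ha, mul_assoc, hb, mul_assoc]
  | add a b ha hb => rw [map_add, mul_add, add_mul, ha, hb]

theorem EvenCForm.involute_eq (a : EvenCForm W) :
    CliffordAlgebra.involute (a : CForm W) = a :=
  CliffordAlgebra.involute_eq_of_mem_even a.2

/-- Forms of even degree are central. -/
theorem EvenCForm.comm (a : EvenCForm W) (b : CForm W) : b * (a : CForm W) = (a : CForm W) * b := by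
  induction b using ExteriorAlgebra.induction with
  | algebraMap r => exact Algebra.commutes _ _
  | ι β => rw [CForm.ι_mul_comm, EvenCForm.involute_eq]
  | mul b c hb hc => rw [mul_assoc, hc, ← mul_assoc, hb, mul_assoc]
  | add b c hb hc => rw [mul_add, add_mul, hb, hc]

instance EvenCForm.instCommRing : CommRing (EvenCForm W) :=
  { (inferInstance : Ring (EvenCForm W)) with
    mul_comm := fun a b => Subtype.ext (EvenCForm.comm b (a : CForm W)) }

theorem CForm.ι_mul_ι_mem_even (α β : W →L[ℝ] ℂ) :
    ExteriorAlgebra.ι ℂ α * ExteriorAlgebra.ι ℂ β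
      ∈ CliffordAlgebra.even (0 : QuadraticForm ℂ (W →L[ℝ] ℂ)) :=
  CliffordAlgebra.ι_mul_ι_mem_evenOdd_zero _ α β

variable {W' : Type*} [AddCommGroup W'] [Module ℝ W'] [TopologicalSpace W']

/-- Pullback of complex covectors along a linear map. -/
def covectorPullback (L : W →L[ℝ] W') : (W' →L[ℝ] ℂ) →ₗ[ℂ] (W →L[ℝ] ℂ) where
  toFun α := α.comp L
  map_add' _ _ := rfl
  map_smul' _ _ := rfl

/-- Pullback of exterior forms along a linear map. -/
def CForm.pullback (L : W →L[ℝ] W') : CForm W' →ₐ[ℂ] CForm W :=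
  ExteriorAlgebra.map (covectorPullback L)

end PointwiseAlgebra

/-! ### The exterior derivative on a finite-dimensional vector space -/

section Flat

variable (E : Type*) [NormedAddCommGroup E] [NormedSpace ℝ E] [FiniteDimensional ℝ E]

instance complexDual_finite : Module.Finite ℂ (E →L[ℝ] ℂ) :=
  Module.Finite.of_restrictScalars_finite ℝ ℂ (E →L[ℝ] ℂ)

/-- A basis `dx_I = dx_{i₁} ∧ ⋯ ∧ dx_{iₖ}`, `I = {i₁ < ⋯ < iₖ}`, of the constant forms on `E`, where
`dx_1, dx_2, …` is a basis of the space of complex covectors. -/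
def formBasis : Module.Basis (Finset (Fin (Module.finrank ℂ (E →L[ℝ] ℂ)))) ℂ (CForm E) :=
  (Module.finBasis ℂ (E →L[ℝ] ℂ)).ExteriorAlgebra

variable {E}

/-- The exterior derivative at `y` of the form `φ = ∑_I φ_I dx_I` on `E`:
`dφ = ∑_I dφ_I ∧ dx_I`. -/
def flatExtDeriv (φ : E → CForm E) (y : E) : CForm E :=
  ∑ I, ExteriorAlgebra.ι ℂ (fderiv ℝ (fun z => (formBasis E).repr (φ z) I) y) * formBasis E I

end Flat

section FlatLemmas

variable {E : Type*} [NormedAddCommGroup E] [NormedSpace ℝ E] [FiniteDimensional ℝ E]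

theorem flatExtDeriv_sum {κ : Type*} [Fintype κ] (f : κ → E → ℂ) (c : κ → CForm E) (y : E)
    (hf : ∀ k, DifferentiableAt ℝ (f k) y) :
    flatExtDeriv (fun z => ∑ k, f k z • c k) y
      = ∑ k, ExteriorAlgebra.ι ℂ (fderiv ℝ (f k) y) * c k := by
  have h1 : ∀ I, fderiv ℝ (fun z => (formBasis E).repr (∑ k, f k z • c k) I) y
      = ∑ k, (formBasis E).repr (c k) I • fderiv ℝ (f k) y := by
    intro I
    have : (fun z => (formBasis E).repr (∑ k, f k z • c k) I)
        = fun z => ∑ k, f k z * (formBasis E).repr (c k) I := by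
      funext z
      simp [map_sum, Finsupp.finsetSum_apply]
    rw [this, fderiv_fun_sum (fun k _ => (hf k).mul_const _)]
    refine Finset.sum_congr rfl fun k _ => ?_
    rw [fderiv_mul_const (hf k)]
  unfold flatExtDeriv
  simp only [h1]
  simp only [map_sum, map_smul, Finset.sum_mul]
  rw [Finset.sum_comm]
  refine Finset.sum_congr rfl fun k _ => ?_
  conv_rhs => rw [← (formBasis E).sum_repr (c k), Finset.mul_sum]
  refine Finset.sum_congr rfl fun I _ => ?_
  rw [smul_mul_assoc, mul_smul_comm]

theorem flatExtDeriv_congr_fun {φ ψ : E → CForm E} (h : ∀ z, φ z = ψ z) (y : E) :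
    flatExtDeriv φ y = flatExtDeriv ψ y := by
  rw [funext h]

theorem flatExtDeriv_add (φ ψ : E → CForm E) (y : E)
    (hφ : ∀ I, DifferentiableAt ℝ (fun z => (formBasis E).repr (φ z) I) y)
    (hψ : ∀ I, DifferentiableAt ℝ (fun z => (formBasis E).repr (ψ z) I) y) :
    flatExtDeriv (fun z => φ z + ψ z) y = flatExtDeriv φ y + flatExtDeriv ψ y := by
  unfold flatExtDeriv
  rw [← Finset.sum_add_distrib]
  refine Finset.sum_congr rfl fun I _ => ?_
  have : (fun z => (formBasis E).repr (φ z + ψ z) I)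
      = fun z => (formBasis E).repr (φ z) I + (formBasis E).repr (ψ z) I := by
    funext z; simp
  rw [this, fderiv_fun_add (hφ I) (hψ I), map_add, add_mul]

theorem flatExtDeriv_const (c : CForm E) (y : E) : flatExtDeriv (fun _ => c) y = 0 := by
  unfold flatExtDeriv
  simp

theorem flatExtDeriv_mul (φ ψ : E → CForm E) (y : E)
    (hφ : ∀ I, DifferentiableAt ℝ (fun z => (formBasis E).repr (φ z) I) y)
    (hψ : ∀ I, DifferentiableAt ℝ (fun z => (formBasis E).repr (ψ z) I) y) :
    flatExtDeriv (fun z => φ z * ψ z) y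
      = flatExtDeriv φ y * ψ y + CliffordAlgebra.involute (φ y) * flatExtDeriv ψ y := by
  have h0 : ∀ z, φ z * ψ z = ∑ k : _ × _, ((formBasis E).repr (φ z) k.1 *
      (formBasis E).repr (ψ z) k.2) • (formBasis E k.1 * formBasis E k.2) := by
    intro z
    conv_lhs => rw [← (formBasis E).sum_repr (φ z), ← (formBasis E).sum_repr (ψ z)]
    rw [Finset.sum_mul_sum, Fintype.sum_prod_type]
    refine Finset.sum_congr rfl fun I _ => Finset.sum_congr rfl fun J _ => ?_
    rw [smul_mul_smul_comm]
  have h3 := flatExtDeriv_sum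
    (fun (k : Finset (Fin (Module.finrank ℂ (E →L[ℝ] ℂ))) ×
      Finset (Fin (Module.finrank ℂ (E →L[ℝ] ℂ)))) z =>
      (formBasis E).repr (φ z) k.1 * (formBasis E).repr (ψ z) k.2)
    (fun k => formBasis E k.1 * formBasis E k.2) y (fun k => (hφ k.1).fun_mul (hψ k.2))
  rw [flatExtDeriv_congr_fun h0, h3]
  have h1 : flatExtDeriv φ y * ψ y = ∑ k : _ × _, (formBasis E).repr (ψ y) k.2 •
      (ExteriorAlgebra.ι ℂ (fderiv ℝ (fun z => (formBasis E).repr (φ z) k.1) y)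
        * (formBasis E k.1 * formBasis E k.2)) := by
    conv_lhs => rw [← (formBasis E).sum_repr (ψ y)]
    unfold flatExtDeriv
    rw [Finset.sum_mul_sum, Fintype.sum_prod_type]
    refine Finset.sum_congr rfl fun I _ => Finset.sum_congr rfl fun J _ => ?_
    rw [mul_smul_comm, mul_assoc]
  have h2 : CliffordAlgebra.involute (φ y) * flatExtDeriv ψ y
      = ∑ k : _ × _, (formBasis E).repr (φ y) k.1 •
      (ExteriorAlgebra.ι ℂ (fderiv ℝ (fun z => (formBasis E).repr (ψ z) k.2) y)
        * (formBasis E k.1 * formBasis E k.2)) := by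
    unfold flatExtDeriv
    simp only [← CForm.ι_mul_comm, Finset.mul_sum, ← mul_assoc]
    rw [Fintype.sum_prod_type, Finset.sum_comm]
    refine Finset.sum_congr rfl fun J _ => ?_
    conv_lhs => rw [← (formBasis E).sum_repr (φ y)]
    rw [Finset.mul_sum, Finset.sum_mul]
    refine Finset.sum_congr rfl fun I _ => ?_
    rw [mul_smul_comm, smul_mul_assoc]
  rw [h1, h2, ← Finset.sum_add_distrib]
  refine Finset.sum_congr rfl fun k _ => ?_
  rw [fderiv_fun_mul (hφ k.1) (hψ k.2), map_add, map_smul, map_smul, add_mul, smul_mul_assoc,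
    smul_mul_assoc, add_comm]

/-- The exterior derivative of a form of degree one has even degree. -/
theorem flatExtDeriv_ι_mem_even (α : E → (E →L[ℝ] ℂ)) (y : E) :
    flatExtDeriv (fun z => ExteriorAlgebra.ι ℂ (α z)) y
      ∈ CliffordAlgebra.even (0 : QuadraticForm ℂ (E →L[ℝ] ℂ)) := by
  have hb : ∀ i, formBasis E {i} = ExteriorAlgebra.ι ℂ (Module.finBasis ℂ (E →L[ℝ] ℂ) i) := by
    intro i
    rw [formBasis, ExteriorAlgebra.basis_apply_ofCard (n := 1) _ (Finset.card_singleton i)]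
    rw [ExteriorAlgebra.ιMulti_family, ExteriorAlgebra.ιMulti_apply]
    have hmem : ∀ j : Fin 1, Set.powersetCard.ofFinEmbEquiv.symm
        (Set.powersetCard.ofCard (Finset.card_singleton i)) j = i := by
      intro j
      rw [Set.powersetCard.ofFinEmbEquiv_symm_apply]
      exact Finset.mem_singleton.mp (Finset.orderEmbOfFin_mem _ _ j)
    simp [hmem]
  have hι : ∀ β : E →L[ℝ] ℂ, ∀ I, (∀ i, I ≠ {i}) →
      (formBasis E).repr (ExteriorAlgebra.ι ℂ β) I = 0 := by
    intro β I hI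
    rw [← (Module.finBasis ℂ (E →L[ℝ] ℂ)).sum_repr β]
    simp only [map_sum, map_smul, ← hb, Module.Basis.repr_self, Finsupp.finsetSum_apply,
      Finsupp.smul_apply]
    refine Finset.sum_eq_zero fun i _ => ?_
    rw [Finsupp.single_eq_of_ne (hI i), smul_zero]
  unfold flatExtDeriv
  refine Subalgebra.sum_mem _ fun I _ => ?_
  by_cases hI : ∃ i, I = {i}
  · obtain ⟨i, rfl⟩ := hI
    rw [hb]
    exact CForm.ι_mul_ι_mem_even _ _
  · push Not at hI
    simp only [hι _ I hI]
    simp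

end FlatLemmas

/-! ### Differential forms on a manifold -/

section Forms

variable (E : Type*) [NormedAddCommGroup E] [NormedSpace ℝ E]
  (M : Type*) [TopologicalSpace M] [ChartedSpace E M]

/-- Complex-valued mixed differential forms on `M` (without any regularity). -/
abbrev MixedForm : Type _ := ∀ x : M, CForm (TangentSpace 𝓘(ℝ, E) x)

/-- Complex-valued mixed differential forms on `M` of even degree (without any regularity). -/
abbrev EvenForm : Type _ := ∀ x : M, EvenCForm (TangentSpace 𝓘(ℝ, E) x)

variable {E M}

/-- The derivative at `x` of the preferred chart at `x`. -/
def chartDeriv (x : M) : TangentSpace 𝓘(ℝ, E) x →L[ℝ] E :=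
  mfderiv 𝓘(ℝ, E) 𝓘(ℝ, E) (chartAt E x) x

/-- The derivative at `y` of the inverse of the preferred chart at `p`. -/
def chartSymmDeriv (p : M) (y : E) : E →L[ℝ] TangentSpace 𝓘(ℝ, E) ((chartAt E p).symm y) :=
  mfderiv 𝓘(ℝ, E) 𝓘(ℝ, E) (chartAt E p).symm y

/-- The expression of a form in the preferred chart at `p`, i.e. its pullback under the inverse
of the chart. It is meaningful on the target of the chart. -/
def chartRep (θ : MixedForm E M) (p : M) (y : E) : CForm E :=
  CForm.pullback (chartSymmDeriv p y) (θ ((chartAt E p).symm y))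

/-- The underlying mixed form of an even form. -/
def EvenForm.toMixed (θ : EvenForm E M) : MixedForm E M := fun x => (θ x : CForm _)

variable [FiniteDimensional ℝ E]

/-- A form is smooth if its coefficients in the charts are smooth. -/
def IsSmoothForm (θ : MixedForm E M) : Prop :=
  ∀ (p : M) I, ContDiffOn ℝ ∞ (fun y => (formBasis E).repr (chartRep θ p y) I) (chartAt E p).target

/-- The exterior derivative of a form on `M`: at the point `x` it is computed in the preferred
chart at `x`. -/
def extDerivForm (θ : MixedForm E M) : MixedForm E M := fun x =>
  CForm.pullback (chartDeriv x) (flatExtDeriv (chartRep θ x) (chartAt E x x))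

end Forms

section FormLemmas

variable {E : Type*} [NormedAddCommGroup E] [NormedSpace ℝ E]
  {M : Type*} [TopologicalSpace M] [ChartedSpace E M]

theorem CForm.pullback_involute {W W' : Type*} [AddCommGroup W] [Module ℝ W] [TopologicalSpace W]
    [AddCommGroup W'] [Module ℝ W'] [TopologicalSpace W'] (L : W →L[ℝ] W') (a : CForm W') :
    CForm.pullback L (CliffordAlgebra.involute a) = CliffordAlgebra.involute (CForm.pullback L a) := by
  induction a using ExteriorAlgebra.induction with
  | algebraMap r => simp
  | ι β =>
    have h2 : CliffordAlgebra.involute (ExteriorAlgebra.ι ℂ β : CForm W')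
        = - ExteriorAlgebra.ι ℂ β := CliffordAlgebra.involute_ι β
    have h3 : CliffordAlgebra.involute (ExteriorAlgebra.ι ℂ (covectorPullback L β) : CForm W)
        = - ExteriorAlgebra.ι ℂ (covectorPullback L β) := CliffordAlgebra.involute_ι _
    rw [h2, map_neg, CForm.pullback, ExteriorAlgebra.map_apply_ι, h3]
  | mul a b ha hb => simp only [map_mul, ha, hb]
  | add a b ha hb => simp only [map_add, ha, hb]

theorem CForm.pullback_mem_even {W W' : Type*} [AddCommGroup W] [Module ℝ W] [TopologicalSpace W]
    [AddCommGroup W'] [Module ℝ W'] [TopologicalSpace W'] (L : W →L[ℝ] W') (a : CForm W')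
    (ha : a ∈ CliffordAlgebra.even (0 : QuadraticForm ℂ (W' →L[ℝ] ℂ))) :
    CForm.pullback L a ∈ CliffordAlgebra.even (0 : QuadraticForm ℂ (W →L[ℝ] ℂ)) := by
  refine CliffordAlgebra.even_induction (0 : QuadraticForm ℂ (W' →L[ℝ] ℂ))
    (motive := fun a _ => CForm.pullback L a
      ∈ CliffordAlgebra.even (0 : QuadraticForm ℂ (W →L[ℝ] ℂ))) ?_ ?_ ?_ a ha
  · intro r
    exact (AlgHom.commutes (CForm.pullback L) r).symm ▸ Subalgebra.algebraMap_mem _ r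
  · intro x y hx hy h1 h2
    rw [map_add]
    exact Subalgebra.add_mem _ h1 h2
  · intro m₁ m₂ x hx h
    have h4 : CForm.pullback L (ExteriorAlgebra.ι ℂ m₁ * ExteriorAlgebra.ι ℂ m₂ * x)
        = ExteriorAlgebra.ι ℂ (covectorPullback L m₁) * ExteriorAlgebra.ι ℂ (covectorPullback L m₂)
          * CForm.pullback L x := by
      rw [map_mul, map_mul, CForm.pullback, ExteriorAlgebra.map_apply_ι,
        ExteriorAlgebra.map_apply_ι]
    exact h4 ▸ Subalgebra.mul_mem _ (CForm.ι_mul_ι_mem_even _ _) h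

theorem chartRep_add (θ η : MixedForm E M) (p : M) (y : E) :
    chartRep (θ + η) p y = chartRep θ p y + chartRep η p y := map_add _ _ _

theorem chartRep_mul (θ η : MixedForm E M) (p : M) (y : E) :
    chartRep (θ * η) p y = chartRep θ p y * chartRep η p y := map_mul _ _ _

theorem chartRep_algebraMap (c : ℂ) (p : M) (y : E) :
    chartRep (E := E) (algebraMap ℂ (MixedForm E M) c) p y = algebraMap ℂ (CForm E) c :=
  AlgHom.commutes _ _

/-- A form at `x` is recovered from its expression in the preferred chart at `x`. -/
theorem pullback_chartRep [IsManifold 𝓘(ℝ, E) ∞ M] (θ : MixedForm E M) (x : M) :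
    CForm.pullback (chartDeriv x) (chartRep θ x (chartAt E x x)) = θ x := by
  have hmd : (chartAt E x).MDifferentiable 𝓘(ℝ, E) 𝓘(ℝ, E) :=
    mdifferentiable_chart x
  have hcomp := hmd.symm_comp_deriv (mem_chart_source E x)
  have hx : (chartAt E x).symm (chartAt E x x) = x :=
    (chartAt E x).left_inv (mem_chart_source E x)
  let θ' : M → CForm E := θ
  have hθ : θ' ((chartAt E x).symm (chartAt E x x)) = θ' x := congrArg θ' hx
  let A : E →L[ℝ] E := mfderiv 𝓘(ℝ, E) 𝓘(ℝ, E) (chartAt E x) x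
  let B : E →L[ℝ] E := mfderiv 𝓘(ℝ, E) 𝓘(ℝ, E) (chartAt E x).symm (chartAt E x x)
  have hBA : B.comp A = ContinuousLinearMap.id ℝ E := hcomp
  change CForm.pullback A (CForm.pullback B (θ' ((chartAt E x).symm (chartAt E x x)))) = θ' x
  rw [hθ, CForm.pullback, CForm.pullback, ← AlgHom.comp_apply, ExteriorAlgebra.map_comp_map]
  have : (covectorPullback A).comp (covectorPullback B) = LinearMap.id := by
    ext α : 1
    change (α.comp B).comp A = α
    rw [ContinuousLinearMap.comp_assoc, hBA, ContinuousLinearMap.comp_id]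
  rw [this, ExteriorAlgebra.map_id]
  rfl

variable [FiniteDimensional ℝ E]

theorem IsSmoothForm.differentiableAt {θ : MixedForm E M} (h : IsSmoothForm θ) (x : M) (I) :
    DifferentiableAt ℝ (fun y => (formBasis E).repr (chartRep θ x y) I) (chartAt E x x) :=
  ((h x I).contDiffAt ((chartAt E x).open_target.mem_nhds (mem_chart_target E x))).differentiableAt
    (by simp)

theorem IsSmoothForm.add {θ η : MixedForm E M} (hθ : IsSmoothForm θ) (hη : IsSmoothForm η) :
    IsSmoothForm (θ + η) := by
  intro p I
  refine ((hθ p I).add (hη p I)).congr fun y _ => ?_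
  rw [chartRep_add, map_add]
  rfl

theorem IsSmoothForm.mul {θ η : MixedForm E M} (hθ : IsSmoothForm θ) (hη : IsSmoothForm η) :
    IsSmoothForm (θ * η) := by
  intro p K
  have h0 : ∀ a b : CForm E, (formBasis E).repr (a * b) K = ∑ I, ∑ J,
      ((formBasis E).repr a I * (formBasis E).repr b J)
        * (formBasis E).repr (formBasis E I * formBasis E J) K := by
    intro a b
    conv_lhs => rw [← (formBasis E).sum_repr a, ← (formBasis E).sum_repr b]
    simp only [Finset.sum_mul_sum, map_sum, Finsupp.finsetSum_apply, smul_mul_smul_comm, map_smul,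
      Finsupp.smul_apply, smul_eq_mul]
  refine ContDiffOn.congr (f := fun y => ∑ I, ∑ J, ((formBasis E).repr (chartRep θ p y) I
    * (formBasis E).repr (chartRep η p y) J)
        * (formBasis E).repr (formBasis E I * formBasis E J) K) ?_ fun y _ => ?_
  · refine ContDiffOn.sum fun I _ => ContDiffOn.sum fun J _ => ?_
    exact ((hθ p I).mul (hη p J)).mul contDiffOn_const
  · rw [chartRep_mul, h0]

theorem isSmoothForm_algebraMap (c : ℂ) : IsSmoothForm (algebraMap ℂ (MixedForm E M) c) := by
  intro p I
  refine ContDiffOn.congr (f := fun _ => (formBasis E).repr (algebraMap ℂ (CForm E) c) I)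
    contDiffOn_const fun y _ => ?_
  rw [chartRep_algebraMap]

theorem extDerivForm_add {θ η : MixedForm E M} (hθ : IsSmoothForm θ) (hη : IsSmoothForm η) :
    extDerivForm (θ + η) = extDerivForm θ + extDerivForm η := by
  funext x
  have h : chartRep (θ + η) x = fun y => chartRep θ x y + chartRep η x y :=
    funext fun y => chartRep_add θ η x y
  simp only [extDerivForm, Pi.add_apply]
  rw [h, flatExtDeriv_add _ _ _ (hθ.differentiableAt x) (hη.differentiableAt x), map_add]

theorem extDerivForm_algebraMap (c : ℂ) :
    extDerivForm (algebraMap ℂ (MixedForm E M) c) = 0 := by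
  funext x
  have h : chartRep (E := E) (algebraMap ℂ (MixedForm E M) c) x
      = fun _ => algebraMap ℂ (CForm E) c :=
    funext fun y => chartRep_algebraMap c x y
  simp only [extDerivForm]
  rw [h, flatExtDeriv_const, map_zero]
  rfl

/-- The graded Leibniz rule. -/
theorem extDerivForm_mul [IsManifold 𝓘(ℝ, E) ∞ M] {θ η : MixedForm E M}
    (hθ : IsSmoothForm θ) (hη : IsSmoothForm η) (x : M) :
    extDerivForm (θ * η) x
      = extDerivForm θ x * η x + CliffordAlgebra.involute (θ x) * extDerivForm η x := by
  have h : chartRep (θ * η) x = fun y => chartRep θ x y * chartRep η x y :=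
    funext fun y => chartRep_mul θ η x y
  simp only [extDerivForm]
  rw [h, flatExtDeriv_mul _ _ _ (hθ.differentiableAt x) (hη.differentiableAt x), map_add, map_mul,
    map_mul, CForm.pullback_involute, pullback_chartRep, pullback_chartRep]

/-- The exterior derivative of a one-form is even. -/
theorem extDerivForm_ι_mem_even
    (α : ∀ x : M, TangentSpace 𝓘(ℝ, E) x →L[ℝ] ℂ) (x : M) :
    extDerivForm (fun y => ExteriorAlgebra.ι ℂ (α y)) x
      ∈ CliffordAlgebra.even (0 : QuadraticForm ℂ (TangentSpace 𝓘(ℝ, E) x →L[ℝ] ℂ)) := by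
  have h : chartRep (E := E) (fun y => ExteriorAlgebra.ι ℂ (α y)) x = fun y =>
      ExteriorAlgebra.ι ℂ (covectorPullback (chartSymmDeriv x y) (α ((chartAt E x).symm y))) :=
    funext fun y => ExteriorAlgebra.map_apply_ι _ _
  simp only [extDerivForm]
  rw [h]
  exact CForm.pullback_mem_even _ _ (flatExtDeriv_ι_mem_even _ _)

end FormLemmas

/-! ### De Rham cohomology in even degrees -/

section DeRham

variable (E : Type*) [NormedAddCommGroup E] [NormedSpace ℝ E] [FiniteDimensional ℝ E]
  (M : Type*) [TopologicalSpace M] [ChartedSpace E M] [IsManifold 𝓘(ℝ, E) ∞ M]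

/-- The algebra of smooth closed complex-valued forms of even degree. -/
def closedEvenForms : Subalgebra ℂ (EvenForm E M) where
  carrier := {θ | IsSmoothForm θ.toMixed ∧ extDerivForm θ.toMixed = 0}
  mul_mem' := by
    rintro θ η ⟨hθ, dθ⟩ ⟨hη, dη⟩
    refine ⟨hθ.mul hη, funext fun x => ?_⟩
    have h := extDerivForm_mul hθ hη x
    rw [dθ, dη] at h
    simpa using! h
  add_mem' := by
    rintro θ η ⟨hθ, dθ⟩ ⟨hη, dη⟩
    refine ⟨hθ.add hη, ?_⟩
    have h := extDerivForm_add hθ hη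
    rw [dθ, dη, add_zero] at h
    exact h
  algebraMap_mem' c := ⟨isSmoothForm_algebraMap c, extDerivForm_algebraMap c⟩

/-- The ideal of exact forms. -/
def exactEvenForms : Ideal (closedEvenForms E M) where
  carrier := {θ | ∃ η : MixedForm E M, IsSmoothForm η ∧ extDerivForm η = θ.1.toMixed}
  add_mem' := by
    rintro θ₁ θ₂ ⟨η₁, h₁, d₁⟩ ⟨η₂, h₂, d₂⟩
    refine ⟨η₁ + η₂, h₁.add h₂, ?_⟩
    rw [extDerivForm_add h₁ h₂, d₁, d₂]
    rfl
  zero_mem' := by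
    refine ⟨algebraMap ℂ (MixedForm E M) 0, isSmoothForm_algebraMap 0, ?_⟩
    rw [extDerivForm_algebraMap]
    rfl
  smul_mem' := by
    rintro c θ ⟨η, hη, dη⟩
    refine ⟨c.1.toMixed * η, c.2.1.mul hη, funext fun x => ?_⟩
    have h := extDerivForm_mul c.2.1 hη x
    rw [c.2.2, dη] at h
    have h2 : CliffordAlgebra.involute (c.1.toMixed x) = c.1.toMixed x :=
      EvenCForm.involute_eq (c.1 x)
    rw [h2] at h
    simpa using! h

/-- The commutative ring `H^{2*}_dR(M; ℂ)`: smooth closed forms of even degree modulo exact forms,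
with the product induced by the wedge product. -/
abbrev EvenDeRham : Type _ := closedEvenForms E M ⧸ exactEvenForms E M

variable {E M}

open Classical in
/-- The de Rham class of a smooth closed form of even degree (zero for all other forms). -/
def deRhamClass (θ : EvenForm E M) : EvenDeRham E M :=
  if h : θ ∈ closedEvenForms E M then Ideal.Quotient.mk (exactEvenForms E M) ⟨θ, h⟩ else 0

end DeRham

/-! ### Connections on the complexification of a real vector bundle -/

section Connections

variable (E : Type*) [NormedAddCommGroup E] [NormedSpace ℝ E] [FiniteDimensional ℝ E]
  {M : Type*} [TopologicalSpace M] [ChartedSpace E M] [IsManifold 𝓘(ℝ, E) ∞ M]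
  (F : Type*) [NormedAddCommGroup F] [NormedSpace ℝ F] [FiniteDimensional ℝ F]
  (V : M → Type*) [TopologicalSpace (TotalSpace F V)]
  [∀ x, AddCommGroup (V x)] [∀ x, Module ℝ (V x)] [∀ x, TopologicalSpace (V x)]
  [∀ x, IsTopologicalAddGroup (V x)] [∀ x, ContinuousSMul ℝ (V x)]
  [FiberBundle F V] [VectorBundle ℝ F V]

/-- A smooth connection on the complex vector bundle `V ⊗ ℂ`. The bundle `V ⊗ ℂ` is realized as
`V ⊕ V`, the pair `(u, v)` standing for `u + i v`, so that `i (u, v) = (-v, u)`; the connection is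
required to be complex linear. -/
structure ComplexifiedConnection extends
    CovariantDerivative 𝓘(ℝ, E) (F × F) (V ×ᵇ V) where
  smooth : toCovariantDerivative.ContMDiffCovariantDerivative ∞
  map_I (σ : ∀ x, (V ×ᵇ V) x) (x : M)
    (hσ : MDifferentiableAt 𝓘(ℝ, E) (𝓘(ℝ, E).prod 𝓘(ℝ, F × F))
      (fun y => (⟨y, σ y⟩ : TotalSpace (F × F) (V ×ᵇ V))) x) (v : TangentSpace 𝓘(ℝ, E) x) :
    toFun (fun y => (-(σ y).2, (σ y).1)) x v = (-(toFun σ x v).2, (toFun σ x v).1)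

variable {E F V}

namespace ComplexifiedConnection

/-- The local frame of `V ⊗ ℂ` given by the frame `e_i` of `V` over the domain of the preferred
trivialization at `p` (extended by zero). -/
def frame (p : M) (i : Fin (Module.finrank ℝ F)) : ∀ x, (V ×ᵇ V) x :=
  fun x => ((trivializationAt F V p).symmL ℝ x (Module.finBasis ℝ F i), 0)

/-- The `j`-th coordinate in the frame `e_i` of `V` given by the preferred trivialization at `p`. -/
def frameCoord (p : M) (j : Fin (Module.finrank ℝ F)) (x : M) : V x →L[ℝ] ℝ :=
  ((Module.finBasis ℝ F).coord j).toContinuousLinearMap ∘L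
    (trivializationAt F V p).continuousLinearMapAt ℝ x

/-- The matrix `(ω^j_i)` of connection forms, `∇ e_i = ∑_j e_j ⊗ ω^j_i`, in the frame `e_i` given by
the preferred trivialization at `p`; it is meaningful on the domain of this trivialization. -/
def connectionMatrix (cov : ComplexifiedConnection E F V) (p x : M) :
    Matrix (Fin (Module.finrank ℝ F)) (Fin (Module.finrank ℝ F))
      (TangentSpace 𝓘(ℝ, E) x →L[ℝ] ℂ) :=
  Matrix.of fun j i =>
    Complex.ofRealCLM ∘L frameCoord p j x ∘L
        (ContinuousLinearMap.fst ℝ (V x) (V x)) ∘L cov.toFun (frame p i) x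
      + Complex.I • (Complex.ofRealCLM ∘L frameCoord p j x ∘L
        (ContinuousLinearMap.snd ℝ (V x) (V x)) ∘L cov.toFun (frame p i) x)

/-- The matrix of curvature forms `Ω^j_i = dω^j_i + ∑_k ω^j_k ∧ ω^k_i` in the frame given by the
preferred trivialization at `p`; it is meaningful on the domain of this trivialization. -/
def curvatureMatrix (cov : ComplexifiedConnection E F V) (p x : M) :
    Matrix (Fin (Module.finrank ℝ F)) (Fin (Module.finrank ℝ F))
      (EvenCForm (TangentSpace 𝓘(ℝ, E) x)) :=
  Matrix.of fun j i =>
    ⟨extDerivForm (fun y => ExteriorAlgebra.ι ℂ (cov.connectionMatrix p y j i)) x,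
        extDerivForm_ι_mem_even _ x⟩
      + ∑ k, ⟨ExteriorAlgebra.ι ℂ (cov.connectionMatrix p x j k)
          * ExteriorAlgebra.ι ℂ (cov.connectionMatrix p x k i), CForm.ι_mul_ι_mem_even _ _⟩

/-- The matrix `Ω / 2πi` at the point `x`, with respect to the frame given by the preferred
trivialization at `x`. -/
def normalizedCurvature (cov : ComplexifiedConnection E F V) (x : M) :
    Matrix (Fin (Module.finrank ℝ F)) (Fin (Module.finrank ℝ F))
      (EvenCForm (TangentSpace 𝓘(ℝ, E) x)) :=
  (2 * (Real.pi : ℂ) * Complex.I)⁻¹ • cov.curvatureMatrix x x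

end ComplexifiedConnection

end Connections

/-! ### Characteristic forms and classes -/

/-- The coefficient `aₖ` in the Taylor series `f(z) = ∑ aₖ zᵏ` at `0`. -/
def taylorCoeff (f : ℂ → ℂ) (k : ℕ) : ℂ := iteratedDeriv k f 0 / (k.factorial : ℂ)

/-- The value `f(X) = ∑ aₖ Xᵏ` of the Taylor series of `f` at `0` on a nilpotent element `X`;
all omitted terms are zero. -/
def nilpotentEval {A : Type*} [Ring A] [Algebra ℂ A] (f : ℂ → ℂ) (X : A) : A :=
  ∑ k ∈ Finset.range (nilpotencyClass X), taylorCoeff f k • X ^ k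

section CharacteristicClasses

variable {E : Type*} [NormedAddCommGroup E] [NormedSpace ℝ E] [FiniteDimensional ℝ E]
  {M : Type*} [TopologicalSpace M] [ChartedSpace E M] [IsManifold 𝓘(ℝ, E) ∞ M]
  {F : Type*} [NormedAddCommGroup F] [NormedSpace ℝ F] [FiniteDimensional ℝ F]
  {V : M → Type*} [TopologicalSpace (TotalSpace F V)]
  [∀ x, AddCommGroup (V x)] [∀ x, Module ℝ (V x)] [∀ x, TopologicalSpace (V x)]
  [∀ x, IsTopologicalAddGroup (V x)] [∀ x, ContinuousSMul ℝ (V x)]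
  [FiberBundle F V] [VectorBundle ℝ F V]

/-- The form `Σ_f(V ⊗ ℂ, ∇) = tr f(Ω / 2πi)`. -/
def additiveForm (f : ℂ → ℂ) (cov : ComplexifiedConnection E F V) : EvenForm E M :=
  fun x => (nilpotentEval f (cov.normalizedCurvature x)).trace

/-- The `k`-th Chern form of `V ⊗ ℂ`, the coefficient of `tᵏ` in `det (1 + t Ω / 2πi)`. -/
def chernForm (k : ℕ) (cov : ComplexifiedConnection E F V) : EvenForm E M :=
  fun x => (Matrix.det (1 + (Polynomial.X : Polynomial (EvenCForm (TangentSpace 𝓘(ℝ, E) x))) •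
    (cov.normalizedCurvature x).map Polynomial.C)).coeff k

/-- The `k`-th Pontryagin form `p_k = (-1)ᵏ c_{2k}`. -/
def pontryaginForm (k : ℕ) (cov : ComplexifiedConnection E F V) : EvenForm E M :=
  (-1) ^ k * chernForm (2 * k) cov

variable (E F V)

open Classical in
/-- The additive class `Σ_f(V ⊗ ℂ)`, computed from some connection on `V ⊗ ℂ`. -/
def additiveClass (f : ℂ → ℂ) : EvenDeRham E M :=
  if h : Nonempty (ComplexifiedConnection E F V) then deRhamClass (additiveForm f h.some) else 0

open Classical in
/-- The `k`-th Pontryagin class of `V`, computed from some connection on `V ⊗ ℂ`. -/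
def pontryaginClass (k : ℕ) : EvenDeRham E M :=
  if h : Nonempty (ComplexifiedConnection E F V) then deRhamClass (pontryaginForm k h.some) else 0

end CharacteristicClasses

/-! ### Symmetric functions in indeterminates with prescribed elementary symmetric functions -/

/-- The polynomial `∑_{j=1}^m ∑_{d<N} a_d y_j^d`, which is `∑_{j=1}^m g(y_j)` truncated at degree
`N` in the indeterminates `y_1, …, y_m`. -/
def truncatedSum (g : ℂ → ℂ) (m N : ℕ) : MvPolynomial.symmetricSubalgebra (Fin m) ℂ :=
  ⟨∑ j, ∑ d ∈ Finset.range N, MvPolynomial.C (taylorCoeff g d) * MvPolynomial.X j ^ d, by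
    intro σ
    simp only [map_sum, map_mul, map_pow, MvPolynomial.rename_C, MvPolynomial.rename_X]
    exact Equiv.sum_comp σ (fun j : Fin m => ∑ d ∈ Finset.range N,
      MvPolynomial.C (taylorCoeff g d) * (MvPolynomial.X j : MvPolynomial (Fin m) ℂ) ^ d)⟩

/-- The value in `A` of a symmetric polynomial in indeterminates `y_1, …, y_m` whose elementary
symmetric functions are `p_1, …, p_m ∈ A`: the polynomial is written as a polynomial in the
elementary symmetric functions, and the `k`-th of these is replaced by `p_k`. -/
def symmetricEval {A : Type*} [CommRing A] [Algebra ℂ A] {m : ℕ} (p : Fin m → A) :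
    MvPolynomial.symmetricSubalgebra (Fin m) ℂ →ₐ[ℂ] A :=
  (MvPolynomial.aeval p).comp
    (MvPolynomial.esymmAlgEquiv (Fin m) ℂ (Fintype.card_fin m)).symm.toAlgHom

end

/-!
The additive class of `V ⊗ ℂ` is a polynomial in the classes of the forms `tr (Ω / 2πi)ᵏ`, and so
are the Pontryagin classes. The theorem is a comparison of these two descriptions by Newton's
identities; what makes it work for real bundles is that the classes with odd `k` vanish.

*The trace classes.* By the Bianchi identity `tr Ωᵏ` is closed
(`ConnectionForms.traceForm_mem_closedEvenForms`). For two connections `A` and `A + α` the curvature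
of `A + t α` is a quadratic polynomial in `t`, and the derivative of `tr Ω_tᵏ⁺¹` is the exterior
derivative of `(k + 1) tr (α Ω_tᵏ)`. The transgression form is the integral of this over `[0, 1]`.
As the integrand is a polynomial in `t`, the integral is replaced by a quadrature formula, exact for
the degree at hand, so that no integral of forms occurs (`sum_quadrature_trace_pow`,
`flatExtDeriv_transgression`, `ConnectionForms.exists_extDerivForm_eq_traceForm_sub`). The
computations are done for matrices of forms on a vector space, in a chart and a local frame. They
are carried over to the manifold by the gauge law for the connection forms, on account of which
traces do not depend on the frame.

*Vanishing of the odd trace classes.* A metric on `V`, built from a partition of unity, identifies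
`V` with its dual. The dual of a connection thus becomes a connection on `V ⊗ ℂ`
(`ConnectionForms.dual`) with a curvature conjugate to `-Ωᵀ`, whence `tr Ωᵏ` and `(-1)ᵏ tr Ωᵏ` have
the same class (`ConnectionForms.traceForm_dual`, `ConnectionForms.traceClass_odd`).

*Newton's identities.* The Chern forms, which are the coefficients of `det (1 + t Ω / 2πi)`, and the
forms `tr (Ω / 2πi)ᵏ` satisfy Newton's identities (`succ_mul_detCoeff`). Therefore the Chern forms
are closed and their classes do not depend on the connection. As the odd trace classes vanish, the
identities of even index say that the power sums of indeterminates `y_j` with elementary symmetric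
functions `(-1)ᵏ c_{2k}` are half of the classes of `tr (Ω / 2πi)²ᵈ`
(`two_mul_symmetricEval_psum`); the factor is that in `f z = g (z ^ 2) / 2`. The sum over `d` can be
truncated because the curvature is nilpotent (`flatCurv_pow_eq_zero`).

*Existence of connections.* The trivializations of `V` give flat complex linear connections over
their domains, which are glued by a partition of unity (`nonempty_complexifiedConnection`).
-/

noncomputable section

set_option linter.unusedSectionVars false

/-! ### Newton's identities for the coefficients of `det (1 + t M)` -/

section NewtonMatrix

open Polynomial

variable {n : Type*} [Fintype n] [DecidableEq n] {R : Type*} [CommRing R]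

theorem Matrix.derivative_det (N : Matrix n n R[X]) :
    derivative N.det = (N.adjugate * N.map derivative).trace := by
  have h1 : derivative N.det
      = ∑ i, (N.updateCol i (fun j => derivative (N j i))).det := by
    simp only [Matrix.det_apply, derivative_sum]
    rw [Finset.sum_comm]
    refine Finset.sum_congr rfl fun σ _ => ?_
    rw [← Finset.smul_sum, Units.smul_def, Units.smul_def, derivative_smul, derivative_prod_finset]
    congr 1
    refine Finset.sum_congr rfl fun i _ => ?_
    rw [← Finset.mul_prod_erase _ _ (Finset.mem_univ i)]
    rw [Matrix.updateCol_self, mul_comm]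
    congr 1
    refine Finset.prod_congr rfl fun j hj => ?_
    rw [Matrix.updateCol_ne (Finset.ne_of_mem_erase hj)]
  rw [h1, Matrix.trace]
  refine Finset.sum_congr rfl fun i _ => ?_
  rw [← Matrix.cramer_apply, Matrix.cramer_eq_adjugate_mulVec]
  simp [Matrix.mul_apply, Matrix.mulVec, dotProduct]

/-- The coefficient of `t ^ k` in `det (1 + t M)`. -/
def detCoeff (M : Matrix n n R) (k : ℕ) : R :=
  (Matrix.det (1 + (X : R[X]) • M.map C)).coeff k

theorem detCoeff_zero (M : Matrix n n R) : detCoeff M 0 = 1 := by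
  simpa [detCoeff, add_comm] using coeff_det_X_add_C_zero M (1 : Matrix n n R)

theorem detCoeff_eq_zero (M : Matrix n n R) {k : ℕ} (hk : Fintype.card n < k) :
    detCoeff M k = 0 := by
  refine coeff_eq_zero_of_natDegree_lt (lt_of_le_of_lt ?_ hk)
  have := natDegree_det_X_add_C_le M (1 : Matrix n n R)
  simpa [add_comm] using this

/-- **Newton's identities** for the coefficients of `det (1 + t M)` and the traces of the powers
of `M`. They are obtained by comparing coefficients in `(1 + t M) adj (1 + t M) = det (1 + t M)`
and in Jacobi's formula for the derivative of `det (1 + t M)`. -/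
theorem succ_mul_detCoeff (M : Matrix n n R) (k : ℕ) :
    ((k + 1 : ℕ) : R) * detCoeff M (k + 1)
      = ∑ i ∈ Finset.range (k + 1), (-1) ^ i * detCoeff M (k - i) * (M ^ (i + 1)).trace := by
  set N : Matrix n n R[X] := 1 + (X : R[X]) • M.map C with hN
  let B : ℕ → Matrix n n R := fun k => N.adjugate.map fun p : R[X] => p.coeff k
  have hmul : N.adjugate + (X : R[X]) • (N.adjugate * M.map C) = N.det • (1 : Matrix n n R[X]) := by
    have h := Matrix.adjugate_mul N
    nth_rewrite 2 [hN] at h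
    rw [← h, mul_add, mul_one, Matrix.mul_smul]
  have hB0 : B 0 = detCoeff M 0 • (1 : Matrix n n R) := by
    ext i j
    have := congrArg (fun A : Matrix n n R[X] => (A i j).coeff 0) hmul
    simp only [Matrix.add_apply, Matrix.smul_apply, smul_eq_mul, coeff_add, mul_coeff_zero,
      coeff_X_zero, zero_mul, add_zero] at this
    simp only [B, Matrix.map_apply, this, Matrix.smul_apply, smul_eq_mul, detCoeff, ← hN]
    by_cases h : i = j <;> simp [h, Matrix.one_apply]
  have hBs : ∀ k, B (k + 1) = detCoeff M (k + 1) • (1 : Matrix n n R) - B k * M := by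
    intro k
    rw [eq_sub_iff_add_eq]
    ext i j
    have := congrArg (fun A : Matrix n n R[X] => (A i j).coeff (k + 1)) hmul
    simp only [Matrix.add_apply, Matrix.smul_apply, smul_eq_mul, coeff_add, coeff_X_mul,
      Matrix.mul_apply, Matrix.map_apply, finsetSum_coeff, coeff_mul_C] at this
    simp only [B, Matrix.map_apply, Matrix.add_apply, this, Matrix.smul_apply, smul_eq_mul,
      detCoeff, ← hN, Matrix.mul_apply]
    by_cases h : i = j <;> simp [h, Matrix.one_apply]
  have hB : ∀ k, B k = ∑ i ∈ Finset.range (k + 1), ((-1) ^ i * detCoeff M (k - i)) • M ^ i := by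
    intro k
    induction k with
    | zero => simp [hB0]
    | succ k ih =>
      rw [hBs, ih, Finset.sum_mul, Finset.sum_range_succ' _ (k + 1)]
      simp only [pow_zero, one_mul, Nat.sub_zero, Nat.add_sub_add_right]
      rw [sub_eq_neg_add, ← Finset.sum_neg_distrib]
      congr 1
      refine Finset.sum_congr rfl fun i _ => ?_
      rw [smul_mul_assoc, ← pow_succ, ← neg_smul]
      congr 1
      ring
  have hd := congrArg (fun p : R[X] => p.coeff k) (Matrix.derivative_det N)
  have hN' : N.map derivative = M.map C := by
    ext1 i j
    have h1 : derivative ((1 : Matrix n n R[X]) i j) = 0 := by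
      by_cases h : i = j <;> simp [h, Matrix.one_apply]
    simp [hN, h1]
  have hT : ((N.adjugate * M.map C).trace).coeff k = (B k * M).trace := by
    simp only [Matrix.trace, Matrix.diag_apply, Matrix.mul_apply, finsetSum_coeff, Matrix.map_apply,
      coeff_mul_C, B]
  simp only [coeff_derivative, hN', hT] at hd
  rw [detCoeff, ← hN, mul_comm]
  push_cast
  rw [hd, hB, Finset.sum_mul, Matrix.trace_sum]
  refine Finset.sum_congr rfl fun i _ => ?_
  rw [smul_mul_assoc, ← pow_succ, Matrix.trace_smul, smul_eq_mul]

end NewtonMatrix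

/-! ### Traces of powers along a quadratic path of matrices -/

section Quadrature

/-- Weights of a quadrature formula with nodes `0, …, D` that is exact for polynomials of degree
at most `D` over `[0, 1]`. -/
theorem exists_quadrature_weights (D : ℕ) :
    ∃ w : ℕ → ℂ, ∀ j ≤ D, ∑ i ∈ Finset.range (D + 1), w i * (i : ℂ) ^ j = 1 / (j + 1) := by
  let V : Matrix (Fin (D + 1)) (Fin (D + 1)) ℂ := Matrix.vandermonde fun i => ((i : ℕ) : ℂ)
  have hV : IsUnit V.det := by
    rw [isUnit_iff_ne_zero, Matrix.det_vandermonde_ne_zero_iff]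
    intro i j h
    exact Fin.ext (Nat.cast_injective h)
  let u : Fin (D + 1) → ℂ := Matrix.vecMul (fun j : Fin (D + 1) => 1 / (((j : ℕ) : ℂ) + 1)) V⁻¹
  have hu : Matrix.vecMul u V = fun j : Fin (D + 1) => 1 / (((j : ℕ) : ℂ) + 1) := by
    simp only [u, Matrix.vecMul_vecMul, Matrix.nonsing_inv_mul V hV, Matrix.vecMul_one]
  refine ⟨fun i => if h : i < D + 1 then u ⟨i, h⟩ else 0, fun j hj => ?_⟩
  have := congrFun hu ⟨j, Nat.lt_succ_of_le hj⟩
  simp only [Matrix.vecMul, dotProduct, V, Matrix.vandermonde_apply] at this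
  rw [Finset.sum_range, ← this]
  refine Finset.sum_congr rfl fun i _ => ?_
  simp only [dif_pos i.2, Fin.eta]

open Polynomial

variable {R : Type*} [CommRing R] [Algebra ℂ R]

/-- The fundamental theorem of calculus on `[0, 1]` for polynomials with coefficients in a complex
algebra, the integral being a quadrature sum. -/
theorem sum_quadrature_derivative {D : ℕ} {w : ℕ → ℂ}
    (hw : ∀ j ≤ D, ∑ i ∈ Finset.range (D + 1), w i * (i : ℂ) ^ j = 1 / (j + 1))
    (Q : R[X]) (hQ : Q.natDegree ≤ D + 1) :
    ∑ i ∈ Finset.range (D + 1), w i • (derivative Q).eval (i : R) = Q.eval 1 - Q.eval 0 := by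
  have h1 : ∀ x : R, (derivative Q).eval x
      = ∑ j ∈ Finset.range (D + 1), Q.coeff (j + 1) * ((j : R) + 1) * x ^ j := by
    intro x
    rw [eval_eq_sum_range' (n := D + 1)]
    · simp [coeff_derivative]
    · refine lt_of_le_of_lt (natDegree_derivative_le Q) (by omega)
  have h2 : Q.eval 1 - Q.eval 0 = ∑ j ∈ Finset.range (D + 1), Q.coeff (j + 1) := by
    rw [eval_eq_sum_range' (n := D + 2) (by omega), ← coeff_zero_eq_eval_zero,
      Finset.sum_range_succ']
    simp
  simp only [h1, h2, Finset.smul_sum]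
  rw [Finset.sum_comm]
  refine Finset.sum_congr rfl fun j hj => ?_
  have hj' : j ≤ D := Nat.lt_succ_iff.mp (Finset.mem_range.mp hj)
  have h3 : ∀ i : ℕ, w i • (Q.coeff (j + 1) * ((j : R) + 1) * (i : R) ^ j)
      = (w i * (i : ℂ) ^ j) • (Q.coeff (j + 1) * ((j : R) + 1)) := by
    intro i
    simp only [Algebra.smul_def, map_mul, map_pow, map_natCast]
    ring
  simp only [h3, ← Finset.sum_smul, hw j hj']
  have h4 : ((j : R) + 1) = algebraMap ℂ R ((j : ℂ) + 1) := by simp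
  rw [h4, mul_comm, ← Algebra.smul_def, smul_smul, one_div, inv_mul_cancel₀, one_smul]
  exact Nat.cast_add_one_ne_zero j

variable {n : Type*} [Fintype n] [DecidableEq n]

theorem Matrix.map_derivative_mul {R : Type*} [CommRing R] {n : Type*} [Fintype n]
    (A B : Matrix n n R[X]) :
    (A * B).map derivative = A.map derivative * B + A * B.map derivative := by
  ext1 i j
  simp [Matrix.mul_apply, derivative_mul, Finset.sum_add_distrib]

theorem derivative_trace_pow {R : Type*} [CommRing R] (N : Matrix n n R[X]) (k : ℕ) :
    derivative (N ^ (k + 1)).trace = ((k + 1 : ℕ) : R[X]) * (N.map derivative * N ^ k).trace := by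
  have h1 : ∀ Y : Matrix n n R[X], derivative Y.trace = (Y.map derivative).trace := by
    intro Y
    simp [Matrix.trace]
  have h2 : ∀ (k : ℕ), ∀ j, ((N ^ k).map derivative * N ^ (j + 1)).trace
      = (k : R[X]) * (N.map derivative * N ^ (k + j)).trace := by
    intro k
    induction k with
    | zero =>
      intro j
      have : (1 : Matrix n n R[X]).map derivative = 0 := by
        ext1 i j
        by_cases h : i = j <;> simp [h]
      simp [this]
    | succ k ih =>
      intro j
      have e1 : k + (j + 1) = k + 1 + j := by ring
      have e2 : j + 1 + k = k + 1 + j := by ring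
      rw [pow_succ, Matrix.map_derivative_mul, add_mul, Matrix.trace_add, mul_assoc, ← pow_succ',
        ih, mul_assoc, Matrix.trace_mul_comm (N ^ k), mul_assoc, ← pow_add, e1, e2]
      push_cast
      ring
  rw [h1]
  cases k with
  | zero => simp
  | succ k =>
    rw [pow_succ, Matrix.map_derivative_mul, Matrix.trace_add]
    have := h2 (k + 1) 0
    rw [zero_add, pow_one] at this
    rw [this, Matrix.trace_mul_comm (N ^ (k + 1))]
    push_cast
    ring_nf

/-- The difference of the traces of the powers of `N + B + A` and `N`, as an integral over the
segment `t ↦ N + t B + t² A`, the integral being expressed by a quadrature formula. -/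
theorem sum_quadrature_trace_pow (k : ℕ) {w : ℕ → ℂ}
    (hw : ∀ j ≤ 2 * k + 1,
      ∑ i ∈ Finset.range (2 * k + 1 + 1), w i * (i : ℂ) ^ j = 1 / (j + 1))
    (N B A : Matrix n n R) :
    ∑ i ∈ Finset.range (2 * k + 1 + 1), w i •
        (((k + 1 : ℕ) : ℂ) • ((B + (2 * (i : ℂ)) • A) *
          (N + (i : ℂ) • B + ((i : ℂ) ^ 2) • A) ^ k).trace)
      = ((N + B + A) ^ (k + 1)).trace - (N ^ (k + 1)).trace := by
  let P : Matrix n n R[X] := N.map C + (X : R[X]) • B.map C + (X ^ 2 : R[X]) • A.map C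
  have hev : ∀ (x : R) (j : ℕ), (P ^ j).map (Polynomial.eval x) = (N + x • B + x ^ 2 • A) ^ j := by
    intro x j
    have h0 : P.map (Polynomial.eval x) = N + x • B + x ^ 2 • A := by
      ext i j
      simp [P]
      ring
    rw [← h0, ← Polynomial.coe_evalRingHom]
    exact Matrix.map_pow P (Polynomial.evalRingHom x) j
  have hP' : P.map derivative = B.map C + (2 * X : R[X]) • A.map C := by
    ext1 i j
    simp [P]
    ring
  have htr : ∀ (x : R) (Y : Matrix n n R[X]),
      Y.trace.eval x = (Y.map (Polynomial.eval x)).trace := by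
    intro x Y
    simp [Matrix.trace, eval_finsetSum]
  have hdeg : ∀ j i i', ((P ^ j) i i').natDegree ≤ 2 * j := by
    intro j
    induction j with
    | zero =>
      intro i i'
      by_cases h : i = i' <;> simp [h]
    | succ j ih =>
      intro i i'
      rw [pow_succ, Matrix.mul_apply]
      refine natDegree_sum_le_of_forall_le _ _ fun l _ => ?_
      refine natDegree_mul_le.trans ?_
      have : (P l i').natDegree ≤ 2 := by
        simp only [P, Matrix.add_apply, Matrix.smul_apply, Matrix.map_apply, smul_eq_mul]
        compute_degree
      have := ih i l
      omega
  have key := sum_quadrature_derivative hw ((P ^ (k + 1)).trace) (by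
    refine natDegree_sum_le_of_forall_le _ _ fun l _ => ?_
    exact (hdeg _ _ _).trans (by omega))
  rw [htr, htr, hev, hev] at key
  have hz : N + (0 : R) • B + (0 : R) ^ 2 • A = N := by simp
  have ho : N + (1 : R) • B + (1 : R) ^ 2 • A = N + B + A := by simp
  rw [hz, ho] at key
  rw [← key]
  refine Finset.sum_congr rfl fun i _ => ?_
  congr 1
  rw [derivative_trace_pow, eval_mul, eval_natCast, htr, hP']
  have h5 : ((B.map C + (2 * X : R[X]) • A.map C) * P ^ k).map (Polynomial.eval (i : R))
      = (B + (2 * (i : R)) • A) * (N + (i : R) • B + (i : R) ^ 2 • A) ^ k := by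
    rw [← hev, ← Polynomial.coe_evalRingHom, Matrix.map_mul]
    congr 1
    ext i j
    simp
  have h6 : ∀ (z : ℂ) (Y : Matrix n n R), z • Y = (algebraMap ℂ R z) • Y := by
    intro z Y
    ext i j
    simp [Algebra.smul_def]
  have h7 : algebraMap ℂ R 2 = 2 := map_ofNat _ 2
  rw [h5, h6, h6, h6, Algebra.smul_def]
  simp [h7]

end Quadrature

/-! ### Symmetric polynomials and Newton's identities -/

section SymmetricFunctions

open MvPolynomial Finset

/-- The power sum `y_1 ^ d + ⋯ + y_m ^ d` as an element of the algebra of symmetric polynomials. -/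
def symmetricPsum (m d : ℕ) : symmetricSubalgebra (Fin m) ℂ :=
  ⟨psum (Fin m) ℂ d, psum_isSymmetric (Fin m) ℂ d⟩

/-- The elementary symmetric polynomial as an element of the algebra of symmetric polynomials. -/
def symmetricEsymm (m k : ℕ) : symmetricSubalgebra (Fin m) ℂ :=
  ⟨esymm (Fin m) ℂ k, esymm_isSymmetric (Fin m) ℂ k⟩

theorem truncatedSum_eq (g : ℂ → ℂ) (m N : ℕ) :
    truncatedSum g m N = ∑ d ∈ range N, taylorCoeff g d • symmetricPsum m d := by
  apply Subtype.ext
  simp only [truncatedSum, symmetricPsum, AddSubmonoidClass.coe_finsetSum, SetLike.val_smul, psum]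
  rw [sum_comm]
  refine sum_congr rfl fun d _ => ?_
  rw [smul_eq_C_mul, mul_sum]

variable {A : Type*} [CommRing A] [Algebra ℂ A]

theorem symmetricEval_esymm {m : ℕ} (p : Fin m → A) (i : Fin m) :
    symmetricEval p (symmetricEsymm m (i + 1)) = p i := by
  have h : (esymmAlgEquiv (Fin m) ℂ (Fintype.card_fin m)).symm (symmetricEsymm m (i + 1)) = X i :=
    esymmAlgEquiv_symm_apply (σ := Fin m) (R := ℂ) (hn := Fintype.card_fin m) i
  exact (congrArg (aeval p) h).trans (aeval_X p i)

theorem symmetricEsymm_eq_zero {m k : ℕ} (h : m < k) : symmetricEsymm m k = 0 := by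
  apply Subtype.ext
  simp only [symmetricEsymm, esymm, ZeroMemClass.coe_zero]
  rw [powersetCard_eq_empty.mpr (by simpa using h), sum_empty]

theorem symmetricEsymm_zero (m : ℕ) : symmetricEsymm m 0 = 1 :=
  Subtype.ext (by simp [symmetricEsymm])

theorem succ_mul_symmetricEsymm (m k : ℕ) :
    ((k + 1 : ℕ) : symmetricSubalgebra (Fin m) ℂ) * symmetricEsymm m (k + 1)
      = ∑ i ∈ range (k + 1),
        (-1) ^ i * symmetricEsymm m (k - i) * symmetricPsum m (i + 1) := by
  apply Subtype.ext
  have h := mul_esymm_eq_sum (Fin m) ℂ (k + 1)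
  have h2 : (antidiagonal (k + 1)).filter (fun a => a.1 < k + 1)
      = (range (k + 1)).map ⟨fun i => (k - i, i + 1), fun i j h => by simp at h; omega⟩ := by
    ext ⟨a, b⟩
    simp only [mem_filter, HasAntidiagonal.mem_antidiagonal, mem_map, mem_range]
    constructor
    · rintro ⟨h1, h2⟩
      exact ⟨b - 1, by omega, Prod.ext (by change k - (b - 1) = a; omega)
        (by change b - 1 + 1 = b; omega)⟩
    · rintro ⟨i, h1, h2⟩
      have h3 : k - i = a := congrArg Prod.fst h2
      have h4 : i + 1 = b := congrArg Prod.snd h2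
      omega
  rw [h2, sum_map, mul_sum] at h
  simp only [MulMemClass.coe_mul, AddSubmonoidClass.coe_finsetSum, symmetricEsymm, symmetricPsum]
  refine Eq.trans (by simp) (h.trans (sum_congr rfl fun i hi => ?_))
  have hi' : i ≤ k := by simpa [Nat.lt_succ_iff] using hi
  have h3 : ((-1 : MvPolynomial (Fin m) ℂ)) ^ (k + 1 + 1) * (-1) ^ (k - i) = (-1) ^ i := by
    rw [← pow_add, show k + 1 + 1 + (k - i) = i + 2 * (k - i + 1) by omega, pow_add, pow_mul]
    simp
  change (-1) ^ (k + 1 + 1) * ((-1) ^ (k - i) * esymm (Fin m) ℂ (k - i)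
    * psum (Fin m) ℂ (i + 1)) = _
  rw [← mul_assoc, ← mul_assoc, h3]
  simp

/-- Newton's identities determine the elements with odd index from the power sums. -/
theorem odd_eq_zero_of_newton {c T : ℕ → A}
    (hN : ∀ k, ((k + 1 : ℕ) : A) * c (k + 1)
      = ∑ i ∈ range (k + 1), (-1) ^ i * c (k - i) * T (i + 1))
    (hT : ∀ k, Odd k → T k = 0) : ∀ k, Odd k → c k = 0 := by
  intro k
  induction k using Nat.strong_induction_on with
  | _ k ih =>
    rintro hk
    obtain ⟨l, rfl⟩ : ∃ l, k = l + 1 := ⟨k - 1, by have := hk.pos; omega⟩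
    have h0 : ((l + 1 : ℕ) : A) * c (l + 1) = 0 := by
      rw [hN l]
      refine sum_eq_zero fun i hi => ?_
      rcases Nat.even_or_odd (i + 1) with h | h
      · have hi' : i ≤ l := by simpa [Nat.lt_succ_iff] using hi
        rw [ih (l - i) (by omega), mul_zero, zero_mul]
        rw [show l - i = l + 1 - (i + 1) by omega]
        exact Nat.Odd.sub_even (by omega) hk h
      · rw [hT _ h, mul_zero]
    have h1 : IsUnit ((l + 1 : ℕ) : A) := by
      have := (isUnit_iff_ne_zero.mpr (Nat.cast_ne_zero.mpr (Nat.succ_ne_zero l) :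
        ((l + 1 : ℕ) : ℂ) ≠ 0)).map (algebraMap ℂ A)
      simpa using this
    exact (h1.mul_right_eq_zero).mp h0

/-- If `c` and `T` behave like the elementary symmetric functions and the power sums of `n` roots
that are symmetric under `x ↦ -x`, then the even power sums are twice the power sums in the
indeterminates whose elementary symmetric functions are `(-1) ^ k * c (2 * k)`. -/
theorem two_mul_symmetricEval_psum (n : ℕ) {c T : ℕ → A} (hc0 : c 0 = 1)
    (hcn : ∀ k, n < k → c k = 0)
    (hN : ∀ k, ((k + 1 : ℕ) : A) * c (k + 1)
      = ∑ i ∈ range (k + 1), (-1) ^ i * c (k - i) * T (i + 1))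
    (hT : ∀ k, Odd k → T k = 0) (d : ℕ) :
    2 * symmetricEval (fun k : Fin (n / 2) => (-1) ^ ((k : ℕ) + 1) * c (2 * ((k : ℕ) + 1)))
      (symmetricPsum (n / 2) (d + 1)) = T (2 * (d + 1)) := by
  set φ := symmetricEval (fun k : Fin (n / 2) => (-1) ^ ((k : ℕ) + 1) * c (2 * ((k : ℕ) + 1)))
  have hodd := odd_eq_zero_of_newton hN hT
  have hφ : ∀ k, φ (symmetricEsymm (n / 2) k) = (-1) ^ k * c (2 * k) := by
    intro k
    rcases k with _ | k
    · simp [symmetricEsymm_zero, hc0]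
    · by_cases h : k < n / 2
      · exact symmetricEval_esymm _ (⟨k, h⟩ : Fin (n / 2))
      · rw [symmetricEsymm_eq_zero (by omega), map_zero, hcn _ (by omega), mul_zero]
  induction d using Nat.strong_induction_on with
  | _ d ih =>
    have h1 := congrArg φ (succ_mul_symmetricEsymm (n / 2) d)
    simp only [map_mul, map_natCast, map_sum, map_pow, map_neg, map_one, hφ] at h1
    have h2 := hN (2 * d + 1)
    -- only the terms with odd `i` survive
    have h3 : ∑ i ∈ range (2 * d + 1 + 1), (-1) ^ i * c (2 * d + 1 - i) * T (i + 1)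
        = ∑ i ∈ range (d + 1), -(c (2 * (d - i)) * T (2 * (i + 1))) := by
      have : ∀ N, ∀ u : ℕ → A, (∀ i, Even i → u i = 0) →
          ∑ i ∈ range (2 * N), u i = ∑ i ∈ range N, u (2 * i + 1) := by
        intro N u hu
        induction N with
        | zero => simp
        | succ N ihN =>
          rw [show 2 * (N + 1) = 2 * N + 1 + 1 by ring, sum_range_succ, sum_range_succ, ihN,
            hu (2 * N) (even_two_mul N), add_zero, sum_range_succ]
      rw [show 2 * d + 1 + 1 = 2 * (d + 1) by ring, this]
      · refine sum_congr rfl fun i hi => ?_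
        have hi' : i ≤ d := by simpa [Nat.lt_succ_iff] using hi
        rw [show 2 * d + 1 - (2 * i + 1) = 2 * (d - i) by omega,
          show 2 * i + 1 + 1 = 2 * (i + 1) by ring, pow_succ, pow_mul]
        simp
      · intro i hi
        rw [hT _ hi.add_one, mul_zero]
    rw [h3, sum_range_succ] at h2
    rw [sum_range_succ] at h1
    simp only [Nat.sub_self, mul_zero, hc0, pow_zero, mul_one] at h1 h2
    -- the lower terms agree by induction
    have h4 : ∑ i ∈ range d, -(c (2 * (d - i)) * T (2 * (i + 1)))
        = -2 * (-1) ^ d * ∑ i ∈ range d, (-1) ^ i * ((-1) ^ (d - i) * c (2 * (d - i)))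
          * φ (symmetricPsum (n / 2) (i + 1)) := by
      rw [mul_sum]
      refine sum_congr rfl fun i hi => ?_
      have hi' : i < d := mem_range.mp hi
      rw [← ih i hi']
      have : ((-1 : A)) ^ d * ((-1) ^ i * (-1) ^ (d - i)) = 1 := by
        rw [← pow_add, Nat.add_sub_cancel' hi'.le, ← mul_pow]
        simp
      linear_combination (2 * c (2 * (d - i)) * φ (symmetricPsum (n / 2) (i + 1))) * this
    rw [h4] at h2
    have h5 : ((-1 : A)) ^ d * (-1) ^ d = 1 := by rw [← mul_pow]; simp
    rw [show 2 * d + 1 + 1 = 2 * (d + 1) by ring] at h2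
    push_cast at h1 h2
    rw [pow_succ] at h1
    linear_combination -h2 - 2 * (-1) ^ d * h1
      + (2 * φ (symmetricPsum (n / 2) (d + 1)) + 2 * ((d : A) + 1) * c (2 * (d + 1))) * (-h5)

end SymmetricFunctions

/-! ### Taylor coefficients -/

section Taylor

open Topology

theorem taylorCoeff_eq_of_hasFPowerSeriesAt {h : ℂ → ℂ} {a : ℕ → ℂ}
    (ha : HasFPowerSeriesAt h (FormalMultilinearSeries.ofScalars ℂ a) 0) (k : ℕ) :
    taylorCoeff h k = a k := by
  have h1 : AnalyticAt ℂ h 0 := ⟨_, ha⟩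
  have h2 := h1.hasFPowerSeriesAt
  have h3 := ha.eq_formalMultilinearSeries h2
  have h4 := congrArg (fun p => p.coeff k) h3
  simpa [taylorCoeff, eq_comm] using h4

theorem taylorCoeff_comp_sq {g f : ℂ → ℂ} (hg : AnalyticAt ℂ g 0)
    (hf : ∀ z, f z = g (z ^ 2) / 2) (d : ℕ) :
    taylorCoeff f (2 * d) = taylorCoeff g d / 2 := by
  have hsum : ∀ᶠ z in 𝓝 (0 : ℂ), HasSum (fun k => z ^ k • taylorCoeff g k) (g z) := by
    have := hasFPowerSeriesAt_iff.mp hg.hasFPowerSeriesAt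
    simpa [taylorCoeff] using this
  have hsq : Filter.Tendsto (fun z : ℂ => z ^ 2) (𝓝 0) (𝓝 0) := by
    have : Continuous fun z : ℂ => z ^ 2 := by fun_prop
    simpa using this.tendsto 0
  let b : ℕ → ℂ := fun k => if Even k then taylorCoeff g (k / 2) / 2 else 0
  have hb : HasFPowerSeriesAt f (FormalMultilinearSeries.ofScalars ℂ b) 0 := by
    rw [hasFPowerSeriesAt_iff]
    filter_upwards [hsq.eventually hsum] with z hz
    have h1 : HasSum (fun k => (z ^ 2) ^ k • (taylorCoeff g k / 2)) (f z) := by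
      rw [hf]
      refine (hz.div_const 2).congr_fun fun k => ?_
      simp only [smul_eq_mul]
      ring
    have hinj : Function.Injective fun k : ℕ => 2 * k := fun i j h => by
      simpa using h
    rw [zero_add, ← hinj.hasSum_iff]
    · refine h1.congr_fun fun k => ?_
      simp [b, pow_mul]
    · intro k hk
      have : ¬ Even k := fun h => hk (by
        obtain ⟨l, rfl⟩ := h
        exact ⟨l, by ring⟩)
      simp [b, this]
  rw [taylorCoeff_eq_of_hasFPowerSeriesAt hb]
  simp [b]

end Taylor

/-! ### Exterior calculus on a vector space -/

section FlatCalculus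

open Topology

variable {E : Type*} [NormedAddCommGroup E] [NormedSpace ℝ E] [FiniteDimensional ℝ E]

/-- A form on `E` is of class `C^n` at a point if its coefficients are. -/
def FormContDiffAt (n : ℕ∞ω) (φ : E → CForm E) (y : E) : Prop :=
  ∀ I, ContDiffAt ℝ n (fun z => (formBasis E).repr (φ z) I) y

namespace FormContDiffAt

variable {n : ℕ∞ω} {φ ψ : E → CForm E} {y : E}

theorem differentiableAt (h : FormContDiffAt ∞ φ y) (I) :
    DifferentiableAt ℝ (fun z => (formBasis E).repr (φ z) I) y :=
  (h I).differentiableAt (by simp)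

theorem congr (h : FormContDiffAt n φ y) (he : ψ =ᶠ[𝓝 y] φ) : FormContDiffAt n ψ y := fun I =>
  (h I).congr_of_eventuallyEq (he.mono fun z hz => by simp only [hz])

theorem const (c : CForm E) : FormContDiffAt n (fun _ => c) y := fun _ => contDiffAt_const

theorem add (hφ : FormContDiffAt n φ y) (hψ : FormContDiffAt n ψ y) :
    FormContDiffAt n (fun z => φ z + ψ z) y := fun I =>
  ((hφ I).add (hψ I)).congr_of_eventuallyEq (Filter.Eventually.of_forall fun z => by simp)

theorem sum {κ : Type*} {s : Finset κ} {f : κ → E → CForm E}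
    (h : ∀ k ∈ s, FormContDiffAt n (f k) y) : FormContDiffAt n (fun z => ∑ k ∈ s, f k z) y :=
  fun I => (ContDiffAt.sum fun k hk => h k hk I).congr_of_eventuallyEq
    (Filter.Eventually.of_forall fun z => by simp [Finsupp.finsetSum_apply])

theorem fun_smul {f : E → ℂ} (hf : ContDiffAt ℝ n f y) (hφ : FormContDiffAt n φ y) :
    FormContDiffAt n (fun z => f z • φ z) y := fun I =>
  (hf.mul (hφ I)).congr_of_eventuallyEq (Filter.Eventually.of_forall fun z => by simp)

theorem const_smul (c : ℂ) (hφ : FormContDiffAt n φ y) :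
    FormContDiffAt n (fun z => c • φ z) y := fun_smul contDiffAt_const hφ

theorem mul (hφ : FormContDiffAt n φ y) (hψ : FormContDiffAt n ψ y) :
    FormContDiffAt n (fun z => φ z * ψ z) y := by
  have h : ∀ z, φ z * ψ z = ∑ I, ∑ J, ((formBasis E).repr (φ z) I * (formBasis E).repr (ψ z) J)
      • (formBasis E I * formBasis E J) := by
    intro z
    conv_lhs => rw [← (formBasis E).sum_repr (φ z), ← (formBasis E).sum_repr (ψ z)]
    simp only [Finset.sum_mul_sum, smul_mul_smul_comm]
  refine congr ?_ (Filter.Eventually.of_forall h)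
  exact sum fun I _ => sum fun J _ => fun_smul ((hφ I).mul (hψ J)) (const _)

theorem algebraMap {f : E → ℂ} (hf : ContDiffAt ℝ n f y) :
    FormContDiffAt n (fun z => algebraMap ℂ (CForm E) (f z)) y := by
  simp only [Algebra.algebraMap_eq_smul_one]
  exact fun_smul hf (const _)

end FormContDiffAt

/-- The complexified coordinate covectors of a basis of `E`. -/
def coordCovector (k : Fin (Module.finrank ℝ E)) : E →L[ℝ] ℂ :=
  Complex.ofRealCLM ∘L ((Module.finBasis ℝ E).coord k).toContinuousLinearMap

/-- Pullbacks of covectors along a linear map `L` are combinations of those of the coordinate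
covectors. -/
theorem covector_eq_sum {W : Type*} [AddCommGroup W] [Module ℝ W] [TopologicalSpace W]
    (α : E →L[ℝ] ℂ) (L : W →L[ℝ] E) :
    α ∘L L = ∑ k, α (Module.finBasis ℝ E k) • (coordCovector k ∘L L) := by
  ext v
  have h : α (L v) = α (∑ k, (Module.finBasis ℝ E).repr (L v) k • Module.finBasis ℝ E k) := by
    rw [(Module.finBasis ℝ E).sum_repr]
  simp only [ContinuousLinearMap.comp_apply, h, map_sum, map_smul]
  rw [sum_apply]
  refine Finset.sum_congr rfl fun k _ => ?_
  simp [coordCovector, mul_comm]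

theorem covector_eq_sum' (α : E →L[ℝ] ℂ) :
    α = ∑ k, α (Module.finBasis ℝ E k) • coordCovector k := by
  simpa using! covector_eq_sum α (ContinuousLinearMap.id ℝ E)

theorem contDiffAt_covector_apply {E : Type*} [NormedAddCommGroup E] [NormedSpace ℝ E]
    {n : ℕ∞ω} {A : E → (E →L[ℝ] ℂ)} {y : E} (hA : ContDiffAt ℝ n A y) (v : E) :
    ContDiffAt ℝ n (fun z => A z v) y :=
  hA.clm_apply contDiffAt_const

theorem FormContDiffAt.ι {n : ℕ∞ω} {A : E → (E →L[ℝ] ℂ)} {y : E} (hA : ContDiffAt ℝ n A y) :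
    FormContDiffAt n (fun z => ExteriorAlgebra.ι ℂ (A z)) y := by
  have h : ∀ z, (ExteriorAlgebra.ι ℂ (A z) : CForm E)
      = ∑ k, A z (Module.finBasis ℝ E k) • ExteriorAlgebra.ι ℂ (coordCovector k) := by
    intro z
    conv_lhs => rw [covector_eq_sum' (A z)]
    simp only [map_sum, map_smul]
  refine FormContDiffAt.congr ?_ (Filter.Eventually.of_forall h)
  exact FormContDiffAt.sum fun k _ =>
    FormContDiffAt.fun_smul (contDiffAt_covector_apply hA _) (FormContDiffAt.const _)

variable {φ ψ : E → CForm E} {y : E}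

theorem FormContDiffAt.flatExtDeriv (h : FormContDiffAt ∞ φ y) :
    FormContDiffAt ∞ (flatExtDeriv φ) y := by
  refine FormContDiffAt.sum fun I _ => FormContDiffAt.mul ?_ (FormContDiffAt.const _)
  exact FormContDiffAt.ι ((h I).fderiv_right (by simp))

theorem flatExtDeriv_congr (h : φ =ᶠ[𝓝 y] ψ) : flatExtDeriv φ y = flatExtDeriv ψ y := by
  unfold flatExtDeriv
  refine Finset.sum_congr rfl fun I _ => ?_
  have : (fun z => (formBasis E).repr (φ z) I) =ᶠ[𝓝 y] fun z => (formBasis E).repr (ψ z) I :=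
    h.mono fun z hz => by simp only [hz]
  rw [this.fderiv_eq]

theorem flatExtDeriv_algebraMap {f : E → ℂ} (hf : DifferentiableAt ℝ f y) :
    flatExtDeriv (fun z => algebraMap ℂ (CForm E) (f z)) y
      = ExteriorAlgebra.ι ℂ (fderiv ℝ f y) := by
  have := flatExtDeriv_sum (fun (_ : Unit) => f) (fun _ => (1 : CForm E)) y fun _ => hf
  simpa [Algebra.algebraMap_eq_smul_one] using this

theorem flatExtDeriv_finsum {κ : Type*} (s : Finset κ) {f : κ → E → CForm E}
    (h : ∀ k ∈ s, FormContDiffAt ∞ (f k) y) :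
    flatExtDeriv (fun z => ∑ k ∈ s, f k z) y = ∑ k ∈ s, flatExtDeriv (f k) y := by
  classical
  induction s using Finset.induction_on with
  | empty => simpa using flatExtDeriv_const 0 y
  | insert k s hk ih =>
    simp only [Finset.sum_insert hk]
    rw [flatExtDeriv_add _ _ _ (h k (by simp)).differentiableAt
      (FormContDiffAt.sum fun l hl => h l (by simp [hl])).differentiableAt,
      ih fun l hl => h l (by simp [hl])]

theorem flatExtDeriv_const_mul (c : CForm E) (hφ : FormContDiffAt ∞ φ y) :
    flatExtDeriv (fun z => c * φ z) y = CliffordAlgebra.involute c * flatExtDeriv φ y := by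
  rw [flatExtDeriv_mul _ _ _ (FormContDiffAt.const c).differentiableAt hφ.differentiableAt,
    flatExtDeriv_const, zero_mul, zero_add]

theorem flatExtDeriv_const_smul (c : ℂ) (hφ : FormContDiffAt ∞ φ y) :
    flatExtDeriv (fun z => c • φ z) y = c • flatExtDeriv φ y := by
  have := flatExtDeriv_const_mul (algebraMap ℂ (CForm E) c) hφ
  simpa [← Algebra.smul_def] using this

theorem flatExtDeriv_neg (hφ : FormContDiffAt ∞ φ y) :
    flatExtDeriv (fun z => -φ z) y = -flatExtDeriv φ y := by
  simpa using flatExtDeriv_const_smul (-1) hφ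

theorem flatExtDeriv_mul_const (c : CForm E) (hφ : FormContDiffAt ∞ φ y) :
    flatExtDeriv (fun z => φ z * c) y = flatExtDeriv φ y * c := by
  rw [flatExtDeriv_mul _ _ _ hφ.differentiableAt (FormContDiffAt.const c).differentiableAt,
    flatExtDeriv_const, mul_zero, add_zero]

theorem involute_ι {W : Type*} [AddCommGroup W] [Module ℝ W] [TopologicalSpace W]
    (α : W →L[ℝ] ℂ) : CliffordAlgebra.involute (ExteriorAlgebra.ι ℂ α : CForm W)
      = -ExteriorAlgebra.ι ℂ α := CliffordAlgebra.involute_ι α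

/-- The exterior derivative of an exact one-form vanishes, by the symmetry of the second
derivative. -/
theorem flatExtDeriv_ι_fderiv {h : E → ℂ} (hh : ContDiffAt ℝ ∞ h y) :
    flatExtDeriv (fun z => ExteriorAlgebra.ι ℂ (fderiv ℝ h z)) y = 0 := by
  let e := Module.finBasis ℝ E
  let θ : Fin (Module.finrank ℝ E) → CForm E := fun k => ExteriorAlgebra.ι ℂ (coordCovector k)
  have hdd : ContDiffAt ℝ ∞ (fderiv ℝ h) y := hh.fderiv_right (by simp)
  have h1 : ∀ z, (ExteriorAlgebra.ι ℂ (fderiv ℝ h z) : CForm E)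
      = ∑ k, fderiv ℝ h z (e k) • θ k := by
    intro z
    conv_lhs => rw [covector_eq_sum' (fderiv ℝ h z)]
    simp only [map_sum, map_smul, θ, e]
  have hd : DifferentiableAt ℝ (fderiv ℝ h) y := hdd.differentiableAt (by simp)
  rw [flatExtDeriv_congr_fun h1, flatExtDeriv_sum _ _ _ fun k => hd.clm_apply
    (differentiableAt_const (e k))]
  have h2 : ∀ k, fderiv ℝ (fun z => fderiv ℝ h z (e k)) y
      = ∑ l, fderiv ℝ (fderiv ℝ h) y (e l) (e k) • coordCovector l := by
    intro k
    rw [fderiv_clm_apply hd (differentiableAt_const (e k))]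
    refine (covector_eq_sum' _).trans ?_
    simp [e]
  have h2_le : minSmoothness ℝ 2 ≤ (∞ : ℕ∞ω) := by
    rw [minSmoothness_of_isRCLikeNormedField]
    exact WithTop.coe_le_coe.mpr (le_top : (2 : ℕ∞) ≤ ⊤)
  have hsymm : ∀ v w, fderiv ℝ (fderiv ℝ h) y v w = fderiv ℝ (fderiv ℝ h) y w v :=
    (hh.isSymmSndFDerivAt h2_le).eq
  set S := ∑ k, (ExteriorAlgebra.ι ℂ (fderiv ℝ (fun z => fderiv ℝ h z (e k)) y) : CForm E) * θ k
  have hS : S = ∑ k, ∑ l, fderiv ℝ (fderiv ℝ h) y (e l) (e k) • (θ l * θ k) := by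
    refine Finset.sum_congr rfl fun k _ => ?_
    rw [h2]
    simp only [map_sum, map_smul, Finset.sum_mul, smul_mul_assoc, θ]
  have hS' : S = -S := by
    calc S = ∑ k, ∑ l, fderiv ℝ (fderiv ℝ h) y (e k) (e l) • (θ k * θ l) := by
          rw [hS, Finset.sum_comm]
      _ = -∑ k, ∑ l, fderiv ℝ (fderiv ℝ h) y (e l) (e k) • (θ l * θ k) := by
          simp only [← Finset.sum_neg_distrib]
          refine Finset.sum_congr rfl fun k _ => Finset.sum_congr rfl fun l _ => ?_
          rw [hsymm, ← smul_neg]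
          congr 1
          exact eq_neg_of_add_eq_zero_left (ExteriorAlgebra.ι_add_mul_swap _ _)
      _ = -S := by rw [hS]
  have h4 : (2 : ℂ) • S = 0 := by
    rw [two_smul]
    nth_rewrite 1 [hS']
    simp
  exact (smul_eq_zero.mp h4).resolve_left two_ne_zero

theorem flatExtDeriv_flatExtDeriv (h : FormContDiffAt ∞ φ y) :
    flatExtDeriv (flatExtDeriv φ) y = 0 := by
  have h0 : ∀ I, FormContDiffAt ∞ (fun z => ExteriorAlgebra.ι ℂ
      (fderiv ℝ (fun z => (formBasis E).repr (φ z) I) z)) y := fun I =>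
    FormContDiffAt.ι ((h I).fderiv_right (by simp))
  unfold flatExtDeriv
  refine (flatExtDeriv_finsum Finset.univ fun I _ => (h0 I).mul (FormContDiffAt.const _)).trans ?_
  refine Finset.sum_eq_zero fun I _ => ?_
  rw [flatExtDeriv_mul_const _ (h0 I), flatExtDeriv_ι_fderiv (h I), zero_mul]

/-- The exterior derivative of one-forms commutes with pullbacks. -/
theorem flatExtDeriv_ι_comp {A : E → (E →L[ℝ] ℂ)} {τ : E → E} (hτ : ContDiffAt ℝ ∞ τ y)
    (hA : ContDiffAt ℝ ∞ A (τ y)) :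
    flatExtDeriv (fun z => ExteriorAlgebra.ι ℂ (A (τ z) ∘L fderiv ℝ τ z)) y
      = CForm.pullback (fderiv ℝ τ y)
          (flatExtDeriv (fun z => ExteriorAlgebra.ι ℂ (A z)) (τ y)) := by
  let e := Module.finBasis ℝ E
  let a : Fin (Module.finrank ℝ E) → E → ℂ := fun k z => A z (e k)
  let h : Fin (Module.finrank ℝ E) → E → ℂ := fun k z => coordCovector k (τ z)
  have ha : ∀ k, ContDiffAt ℝ ∞ (a k) (τ y) := fun k => contDiffAt_covector_apply hA _
  have haτ : ∀ k, ContDiffAt ℝ ∞ (fun z => a k (τ z)) y := fun k => (ha k).comp y hτ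
  have hh : ∀ k, ContDiffAt ℝ ∞ (h k) y := fun k =>
    (coordCovector k).contDiff.contDiffAt.comp y hτ
  have hτd : ∀ᶠ z in 𝓝 y, DifferentiableAt ℝ τ z := by
    have := (hτ.of_le (m := 1) (by simp)).eventually (by simp)
    exact this.mono fun z hz => hz.differentiableAt (by simp)
  have h1 : (fun z => (ExteriorAlgebra.ι ℂ (A (τ z) ∘L fderiv ℝ τ z) : CForm E)) =ᶠ[𝓝 y]
      fun z => ∑ k,
        algebraMap ℂ (CForm E) (a k (τ z)) * ExteriorAlgebra.ι ℂ (fderiv ℝ (h k) z) := by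
    filter_upwards [hτd] with z hz
    rw [covector_eq_sum]
    simp only [map_sum, map_smul]
    refine Finset.sum_congr rfl fun k _ => ?_
    have : fderiv ℝ (h k) z = coordCovector k ∘L fderiv ℝ τ z :=
      ((coordCovector k).hasFDerivAt.comp z hz.hasFDerivAt).fderiv
    rw [this, Algebra.smul_def]
  have hι : ∀ k, FormContDiffAt ∞ (fun z => ExteriorAlgebra.ι ℂ (fderiv ℝ (h k) z)) y := fun k =>
    FormContDiffAt.ι ((hh k).fderiv_right (by simp))
  have h2 : ∀ z, (ExteriorAlgebra.ι ℂ (A z) : CForm E)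
      = ∑ k, a k z • ExteriorAlgebra.ι ℂ (coordCovector k) := by
    intro z
    conv_lhs => rw [covector_eq_sum' (A z)]
    simp only [map_sum, map_smul, a, e]
  rw [flatExtDeriv_congr h1, flatExtDeriv_finsum _ fun k _ =>
    (FormContDiffAt.algebraMap (haτ k)).mul (hι k), flatExtDeriv_congr_fun h2,
    flatExtDeriv_sum _ _ _ fun k => (ha k).differentiableAt (by simp), map_sum]
  refine Finset.sum_congr rfl fun k _ => ?_
  rw [flatExtDeriv_mul _ _ _ (FormContDiffAt.algebraMap (haτ k)).differentiableAt
    (hι k).differentiableAt, flatExtDeriv_ι_fderiv (hh k), mul_zero, add_zero,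
    flatExtDeriv_algebraMap ((haτ k).differentiableAt (by simp)), map_mul]
  have hτy : DifferentiableAt ℝ τ y := hτ.differentiableAt (by simp)
  have h3 : fderiv ℝ (h k) y = coordCovector k ∘L fderiv ℝ τ y :=
    ((coordCovector k).hasFDerivAt.comp y hτy.hasFDerivAt).fderiv
  have h4 : fderiv ℝ (fun z => a k (τ z)) y = fderiv ℝ (a k) (τ y) ∘L fderiv ℝ τ y :=
    ((((ha k).differentiableAt (by simp)).hasFDerivAt).comp y hτy.hasFDerivAt).fderiv
  rw [h3, h4]
  simp only [CForm.pullback, ExteriorAlgebra.map_apply_ι]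
  rfl

end FlatCalculus

/-! ### Matrices of forms and their traces -/

section GradedTrace

variable {W : Type*} [AddCommGroup W] [Module ℝ W] [TopologicalSpace W]
  {n : Type*} [Fintype n]

/-- The matrix of forms of degree one with given covectors as entries. -/
def ιMatrix (A : Matrix n n (W →L[ℝ] ℂ)) : Matrix n n (CForm W) := A.map (ExteriorAlgebra.ι ℂ)

/-- The matrix of constants, viewed as forms of degree zero. -/
def constMatrix (g : Matrix n n ℂ) : Matrix n n (CForm W) := g.map (algebraMap ℂ (CForm W))

/-- All entries of the matrix of forms have even degree. -/
def IsEvenMatrix (Φ : Matrix n n (CForm W)) : Prop :=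
  ∀ i j, Φ i j ∈ CliffordAlgebra.even (0 : QuadraticForm ℂ (W →L[ℝ] ℂ))

theorem Matrix.trace_mul_comm_of_commute {R : Type*} [Semiring R] (A B : Matrix n n R)
    (h : ∀ i j k l, Commute (A i j) (B k l)) : (A * B).trace = (B * A).trace := by
  simp only [Matrix.trace, Matrix.diag_apply, Matrix.mul_apply]
  rw [Finset.sum_comm]
  exact Finset.sum_congr rfl fun i _ => Finset.sum_congr rfl fun j _ => h _ _ _ _

theorem IsEvenMatrix.trace_mul_comm {Φ : Matrix n n (CForm W)} (h : IsEvenMatrix Φ)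
    (Ψ : Matrix n n (CForm W)) : (Φ * Ψ).trace = (Ψ * Φ).trace :=
  Matrix.trace_mul_comm_of_commute _ _ fun i j _ _ => (EvenCForm.comm ⟨_, h i j⟩ _).symm

theorem trace_constMatrix_mul_comm (g : Matrix n n ℂ) (Ψ : Matrix n n (CForm W)) :
    (constMatrix g * Ψ).trace = (Ψ * constMatrix g).trace :=
  Matrix.trace_mul_comm_of_commute _ _ fun i j k l => Algebra.commutes (g i j) (Ψ k l)

/-- Matrices of odd degree anticommute under the trace. -/
theorem trace_mul_ιMatrix {Φ : Matrix n n (CForm W)} (h : Φ.map CliffordAlgebra.involute = -Φ)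
    (A : Matrix n n (W →L[ℝ] ℂ)) : (Φ * ιMatrix A).trace = -(ιMatrix A * Φ).trace := by
  have h' : ∀ i j, CliffordAlgebra.involute (Φ i j) = -Φ i j := fun i j =>
    congrFun (congrFun h i) j
  simp only [Matrix.trace, Matrix.diag_apply, Matrix.mul_apply]
  rw [Finset.sum_comm, ← Finset.sum_neg_distrib]
  refine Finset.sum_congr rfl fun i _ => ?_
  rw [← Finset.sum_neg_distrib]
  refine Finset.sum_congr rfl fun j _ => ?_
  simp only [ιMatrix, Matrix.map_apply]
  rw [CForm.ι_mul_comm, h', neg_mul, neg_neg]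

theorem IsEvenMatrix.involute {Φ : Matrix n n (CForm W)} (h : IsEvenMatrix Φ) :
    Φ.map CliffordAlgebra.involute = Φ :=
  Matrix.ext fun i j => EvenCForm.involute_eq ⟨_, h i j⟩

theorem involute_ιMatrix (A : Matrix n n (W →L[ℝ] ℂ)) :
    (ιMatrix A).map CliffordAlgebra.involute = -ιMatrix A :=
  Matrix.ext fun i j => involute_ι (A i j)

theorem involute_constMatrix (g : Matrix n n ℂ) :
    (constMatrix (W := W) g).map CliffordAlgebra.involute = constMatrix g :=
  Matrix.ext fun _ _ => AlgHom.commutes _ _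

theorem involute_mul (Φ Ψ : Matrix n n (CForm W)) :
    (Φ * Ψ).map CliffordAlgebra.involute
      = Φ.map CliffordAlgebra.involute * Ψ.map CliffordAlgebra.involute :=
  Matrix.map_mul (f := (CliffordAlgebra.involute : CForm W →ₐ[ℂ] CForm W).toRingHom)

namespace IsEvenMatrix

variable {Φ Ψ : Matrix n n (CForm W)}

theorem add (hΦ : IsEvenMatrix Φ) (hΨ : IsEvenMatrix Ψ) : IsEvenMatrix (Φ + Ψ) :=
  fun i j => Subalgebra.add_mem _ (hΦ i j) (hΨ i j)

theorem mul (hΦ : IsEvenMatrix Φ) (hΨ : IsEvenMatrix Ψ) : IsEvenMatrix (Φ * Ψ) :=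
  fun i j => Subalgebra.sum_mem _ fun k _ => Subalgebra.mul_mem _ (hΦ i k) (hΨ k j)

theorem pow [DecidableEq n] (hΦ : IsEvenMatrix Φ) (k : ℕ) : IsEvenMatrix (Φ ^ k) := by
  induction k with
  | zero =>
    intro i j
    by_cases h : i = j
    · simp [h]
    · simp [h]
  | succ k ih => rw [pow_succ]; exact ih.mul hΦ

theorem ιMatrix_mul_ιMatrix (A B : Matrix n n (W →L[ℝ] ℂ)) :
    IsEvenMatrix (ιMatrix A * ιMatrix B) :=
  fun i j => Subalgebra.sum_mem _ fun k _ => CForm.ι_mul_ι_mem_even (A i k) (B k j)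

/-- A matrix of forms of even degree as a matrix over the commutative ring of such forms. -/
def lift (hΦ : IsEvenMatrix Φ) : Matrix n n (EvenCForm W) := Matrix.of fun i j => ⟨Φ i j, hΦ i j⟩

end IsEvenMatrix

/-- The inclusion of the forms of even degree, as an algebra homomorphism. -/
def evenVal : EvenCForm W →ₐ[ℂ] CForm W :=
  (CliffordAlgebra.even (0 : QuadraticForm ℂ (W →L[ℝ] ℂ))).val

theorem evenVal_injective : Function.Injective (evenVal : EvenCForm W →ₐ[ℂ] CForm W) :=
  Subtype.val_injective

theorem evenVal_trace (Φ : Matrix n n (EvenCForm W)) :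
    evenVal Φ.trace = (Φ.map evenVal).trace := by
  simp [Matrix.trace]

theorem evenVal_map_pow [DecidableEq n] (Φ : Matrix n n (EvenCForm W)) (k : ℕ) :
    (Φ ^ k).map evenVal = (Φ.map evenVal) ^ k :=
  map_pow (evenVal : EvenCForm W →ₐ[ℂ] CForm W).mapMatrix Φ k

theorem evenVal_map_mul [DecidableEq n] (Φ Ψ : Matrix n n (EvenCForm W)) :
    (Φ * Ψ).map evenVal = Φ.map evenVal * Ψ.map evenVal :=
  map_mul (evenVal : EvenCForm W →ₐ[ℂ] CForm W).mapMatrix Φ Ψ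

theorem evenVal_smul (c : ℂ) (a : EvenCForm W) : evenVal (c • a) = c • evenVal a := rfl

theorem evenVal_add (a b : EvenCForm W) : evenVal (a + b) = evenVal a + evenVal b := rfl

theorem evenVal_sum {κ : Type*} (s : Finset κ) (a : κ → EvenCForm W) :
    evenVal (∑ k ∈ s, a k) = ∑ k ∈ s, evenVal (a k) := map_sum _ _ _

/-- The quadrature formula for traces of powers, for matrices of forms of even degree. -/
theorem sum_quadrature_trace_pow_of_even [DecidableEq n] (k : ℕ) {w : ℕ → ℂ}
    (hw : ∀ j ≤ 2 * k + 1,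
      ∑ i ∈ Finset.range (2 * k + 1 + 1), w i * (i : ℂ) ^ j = 1 / (j + 1))
    {N B A : Matrix n n (CForm W)} (hN : IsEvenMatrix N) (hB : IsEvenMatrix B)
    (hA : IsEvenMatrix A) :
    ∑ i ∈ Finset.range (2 * k + 1 + 1), w i •
        (((k + 1 : ℕ) : ℂ) • ((B + (2 * (i : ℂ)) • A) *
          (N + (i : ℂ) • B + ((i : ℂ) ^ 2) • A) ^ k).trace)
      = ((N + B + A) ^ (k + 1)).trace - (N ^ (k + 1)).trace := by
  have h := congrArg evenVal (sum_quadrature_trace_pow k hw hN.lift hB.lift hA.lift)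
  simp only [map_sum, evenVal_smul, map_sub, evenVal_trace, evenVal_map_mul, evenVal_map_pow] at h
  exact h

end GradedTrace

/-! ### Curvature and transgression on a vector space -/

section FlatMatrices

open Topology

variable {E : Type*} [NormedAddCommGroup E] [NormedSpace ℝ E] [FiniteDimensional ℝ E]
  {n : Type*} [Fintype n]

/-- The exterior derivative of a matrix of forms. -/
def matExtDeriv (Φ : E → Matrix n n (CForm E)) (y : E) : Matrix n n (CForm E) :=
  Matrix.of fun i j => flatExtDeriv (fun z => Φ z i j) y

/-- The entries of a matrix of forms are smooth at a point. -/
def MatSmoothAt (Φ : E → Matrix n n (CForm E)) (y : E) : Prop :=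
  ∀ i j, FormContDiffAt ∞ (fun z => Φ z i j) y

/-- The differential of a matrix of functions. -/
def matDeriv (g : E → Matrix n n ℂ) (y : E) : Matrix n n (E →L[ℝ] ℂ) :=
  Matrix.of fun i j => fderiv ℝ (fun z => g z i j) y

/-- The curvature `dA + A ∧ A` of a matrix of one-forms. -/
def flatCurv (A : E → Matrix n n (E →L[ℝ] ℂ)) (y : E) : Matrix n n (CForm E) :=
  matExtDeriv (fun z => ιMatrix (A z)) y + ιMatrix (A y) * ιMatrix (A y)

variable {Φ Ψ : E → Matrix n n (CForm E)} {y : E}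

namespace MatSmoothAt

theorem add (hΦ : MatSmoothAt Φ y) (hΨ : MatSmoothAt Ψ y) :
    MatSmoothAt (fun z => Φ z + Ψ z) y := fun i j => (hΦ i j).add (hΨ i j)

theorem mul (hΦ : MatSmoothAt Φ y) (hΨ : MatSmoothAt Ψ y) :
    MatSmoothAt (fun z => Φ z * Ψ z) y := fun i j =>
  FormContDiffAt.sum fun k _ => (hΦ i k).mul (hΨ k j)

theorem pow [DecidableEq n] (hΦ : MatSmoothAt Φ y) (k : ℕ) :
    MatSmoothAt (fun z => Φ z ^ k) y := by
  induction k with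
  | zero => simp only [pow_zero]; exact fun i j => FormContDiffAt.const _
  | succ k ih => simpa only [pow_succ] using ih.mul hΦ

theorem matExtDeriv (hΦ : MatSmoothAt Φ y) : MatSmoothAt (matExtDeriv Φ) y :=
  fun i j => (hΦ i j).flatExtDeriv

theorem trace (hΦ : MatSmoothAt Φ y) : FormContDiffAt ∞ (fun z => (Φ z).trace) y :=
  FormContDiffAt.sum fun i _ => hΦ i i

theorem ιMatrix {A : E → Matrix n n (E →L[ℝ] ℂ)}
    (hA : ∀ i j, ContDiffAt ℝ ∞ (fun z => A z i j) y) : MatSmoothAt (fun z => ιMatrix (A z)) y :=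
  fun i j => FormContDiffAt.ι (hA i j)

theorem constMatrix {g : E → Matrix n n ℂ}
    (hg : ∀ i j, ContDiffAt ℝ ∞ (fun z => g z i j) y) :
    MatSmoothAt (fun z => constMatrix (W := E) (g z)) y :=
  fun i j => FormContDiffAt.algebraMap (hg i j)

theorem flatCurv {A : E → Matrix n n (E →L[ℝ] ℂ)}
    (hA : ∀ i j, ContDiffAt ℝ ∞ (fun z => A z i j) y) : MatSmoothAt (flatCurv A) y :=
  (ιMatrix hA).matExtDeriv.add ((ιMatrix hA).mul (ιMatrix hA))

end MatSmoothAt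

theorem matExtDeriv_congr (h : Φ =ᶠ[𝓝 y] Ψ) : matExtDeriv Φ y = matExtDeriv Ψ y :=
  Matrix.ext fun i j => flatExtDeriv_congr (h.mono fun z hz => by simp only [hz])

theorem matExtDeriv_add (hΦ : MatSmoothAt Φ y) (hΨ : MatSmoothAt Ψ y) :
    matExtDeriv (fun z => Φ z + Ψ z) y = matExtDeriv Φ y + matExtDeriv Ψ y :=
  Matrix.ext fun i j => flatExtDeriv_add _ _ _ (hΦ i j).differentiableAt (hΨ i j).differentiableAt

theorem matExtDeriv_mul (hΦ : MatSmoothAt Φ y) (hΨ : MatSmoothAt Ψ y) :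
    matExtDeriv (fun z => Φ z * Ψ z) y
      = matExtDeriv Φ y * Ψ y + (Φ y).map CliffordAlgebra.involute * matExtDeriv Ψ y := by
  ext i j
  simp only [matExtDeriv, Matrix.of_apply, Matrix.mul_apply, Matrix.add_apply, Matrix.map_apply]
  rw [flatExtDeriv_finsum _ fun k _ => (hΦ i k).mul (hΨ k j), ← Finset.sum_add_distrib]
  exact Finset.sum_congr rfl fun k _ =>
    flatExtDeriv_mul _ _ _ (hΦ i k).differentiableAt (hΨ k j).differentiableAt

theorem flatExtDeriv_trace (hΦ : MatSmoothAt Φ y) :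
    flatExtDeriv (fun z => (Φ z).trace) y = (matExtDeriv Φ y).trace :=
  flatExtDeriv_finsum _ fun i _ => hΦ i i

theorem matExtDeriv_matExtDeriv (hΦ : MatSmoothAt Φ y) : matExtDeriv (matExtDeriv Φ) y = 0 :=
  Matrix.ext fun i j => flatExtDeriv_flatExtDeriv (hΦ i j)

theorem matExtDeriv_constMatrix {g : E → Matrix n n ℂ}
    (hg : ∀ i j, ContDiffAt ℝ ∞ (fun z => g z i j) y) :
    matExtDeriv (fun z => constMatrix (g z)) y = ιMatrix (matDeriv g y) :=
  Matrix.ext fun i j => flatExtDeriv_algebraMap ((hg i j).differentiableAt (by simp))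

theorem matExtDeriv_ιMatrix_matDeriv {g : E → Matrix n n ℂ}
    (hg : ∀ i j, ContDiffAt ℝ ∞ (fun z => g z i j) y) :
    matExtDeriv (fun z => ιMatrix (matDeriv g z)) y = 0 :=
  Matrix.ext fun i j => flatExtDeriv_ι_fderiv (hg i j)

theorem isEvenMatrix_matExtDeriv_ιMatrix (A : E → Matrix n n (E →L[ℝ] ℂ)) (y : E) :
    IsEvenMatrix (matExtDeriv (fun z => ιMatrix (A z)) y) :=
  fun i j => flatExtDeriv_ι_mem_even (fun z => A z i j) y

theorem isEvenMatrix_flatCurv (A : E → Matrix n n (E →L[ℝ] ℂ)) (y : E) :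
    IsEvenMatrix (flatCurv A y) :=
  (isEvenMatrix_matExtDeriv_ιMatrix A y).add (IsEvenMatrix.ιMatrix_mul_ιMatrix _ _)

/-- Under a change of frame `g`, the curvature changes by conjugation. -/
theorem flatCurv_gauge {A B : E → Matrix n n (E →L[ℝ] ℂ)} {g : E → Matrix n n ℂ}
    (hA : ∀ i j, ContDiffAt ℝ ∞ (fun z => A z i j) y)
    (hB : ∀ i j, ContDiffAt ℝ ∞ (fun z => B z i j) y)
    (hg : ∀ i j, ContDiffAt ℝ ∞ (fun z => g z i j) y)
    (h : ∀ᶠ z in 𝓝 y, constMatrix (g z) * ιMatrix (B z)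
      = ιMatrix (A z) * constMatrix (g z) + ιMatrix (matDeriv g z)) :
    constMatrix (g y) * flatCurv B y = flatCurv A y * constMatrix (g y) := by
  have hA' := MatSmoothAt.ιMatrix hA
  have hB' := MatSmoothAt.ιMatrix hB
  have hg' := MatSmoothAt.constMatrix hg
  have hdg : MatSmoothAt (fun z => ιMatrix (matDeriv g z)) y :=
    MatSmoothAt.ιMatrix fun i j => (hg i j).fderiv_right (by simp)
  have h1 := matExtDeriv_congr h
  rw [matExtDeriv_mul hg' hB', matExtDeriv_add (hA'.mul hg') hdg, matExtDeriv_mul hA' hg',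
    matExtDeriv_constMatrix hg, matExtDeriv_ιMatrix_matDeriv hg, involute_constMatrix,
    involute_ιMatrix] at h1
  have h2 := h.self_of_nhds
  set c := constMatrix (W := E) (g y)
  set b := ιMatrix (B y)
  set a := ιMatrix (A y)
  set d := ιMatrix (matDeriv g y)
  have h3 : c * matExtDeriv (fun z => ιMatrix (B z)) y
      = matExtDeriv (fun z => ιMatrix (A z)) y * c - a * d - d * b := by
    rw [eq_sub_iff_add_eq, add_comm, h1]
    noncomm_ring
  rw [flatCurv, flatCurv, mul_add, add_mul, h3, ← mul_assoc, h2, add_mul, mul_assoc a c b, h2]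
  noncomm_ring

section Curvature

variable [DecidableEq n] {A α : E → Matrix n n (E →L[ℝ] ℂ)}

/-- The **Bianchi identity** for the powers of the curvature. -/
theorem matExtDeriv_flatCurv_pow (hA : ∀ i j, ContDiffAt ℝ ∞ (fun z => A z i j) y) (k : ℕ) :
    matExtDeriv (fun z => flatCurv A z ^ k) y
      = flatCurv A y ^ k * ιMatrix (A y) - ιMatrix (A y) * flatCurv A y ^ k := by
  have hA' := MatSmoothAt.ιMatrix hA
  have hΩ := MatSmoothAt.flatCurv hA
  have h1 : matExtDeriv (flatCurv A) y
      = flatCurv A y * ιMatrix (A y) - ιMatrix (A y) * flatCurv A y := by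
    refine (matExtDeriv_add hA'.matExtDeriv (hA'.mul hA')).trans ?_
    rw [matExtDeriv_matExtDeriv hA', matExtDeriv_mul hA' hA', involute_ιMatrix, flatCurv]
    noncomm_ring
  induction k with
  | zero =>
    simp only [pow_zero, one_mul, mul_one, sub_self]
    exact Matrix.ext fun i j => flatExtDeriv_const ((1 : Matrix n n (CForm E)) i j) y
  | succ k ih =>
    simp only [pow_succ]
    rw [matExtDeriv_mul (hΩ.pow k) hΩ, ih, h1, ((isEvenMatrix_flatCurv A y).pow k).involute]
    noncomm_ring

/-- The traces of the powers of the curvature are closed. -/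
theorem flatExtDeriv_trace_flatCurv_pow (hA : ∀ i j, ContDiffAt ℝ ∞ (fun z => A z i j) y)
    (k : ℕ) : flatExtDeriv (fun z => (flatCurv A z ^ k).trace) y = 0 := by
  rw [flatExtDeriv_trace ((MatSmoothAt.flatCurv hA).pow k), matExtDeriv_flatCurv_pow hA,
    Matrix.trace_sub, ((isEvenMatrix_flatCurv A y).pow k).trace_mul_comm, sub_self]

/-- The covariant derivative `dα + A ∧ α + α ∧ A` of a matrix `α` of one-forms. -/
def covExtDeriv (A α : E → Matrix n n (E →L[ℝ] ℂ)) (y : E) : Matrix n n (CForm E) :=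
  matExtDeriv (fun z => ιMatrix (α z)) y + ιMatrix (A y) * ιMatrix (α y)
    + ιMatrix (α y) * ιMatrix (A y)

theorem isEvenMatrix_covExtDeriv (A α : E → Matrix n n (E →L[ℝ] ℂ)) (y : E) :
    IsEvenMatrix (covExtDeriv A α y) :=
  ((isEvenMatrix_matExtDeriv_ιMatrix α y).add (IsEvenMatrix.ιMatrix_mul_ιMatrix _ _)).add
    (IsEvenMatrix.ιMatrix_mul_ιMatrix _ _)

/-- The terms in which `A` multiplies the power of the curvature, which come from the Bianchi
identity, turn `dα` into the covariant derivative of `α` under the trace. -/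
theorem flatExtDeriv_trace_mul_flatCurv_pow
    (hA : ∀ i j, ContDiffAt ℝ ∞ (fun z => A z i j) y)
    (hα : ∀ i j, ContDiffAt ℝ ∞ (fun z => α z i j) y) (k : ℕ) :
    flatExtDeriv (fun z => (ιMatrix (α z) * flatCurv A z ^ k).trace) y
      = (covExtDeriv A α y * flatCurv A y ^ k).trace := by
  have hα' := MatSmoothAt.ιMatrix hα
  have hΩ := (MatSmoothAt.flatCurv hA).pow k
  have hodd : (ιMatrix (α y) * flatCurv A y ^ k).map CliffordAlgebra.involute
      = -(ιMatrix (α y) * flatCurv A y ^ k) := by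
    rw [involute_mul, involute_ιMatrix, ((isEvenMatrix_flatCurv A y).pow k).involute, neg_mul]
  have h1 := trace_mul_ιMatrix hodd (A y)
  rw [flatExtDeriv_trace (hα'.mul hΩ), matExtDeriv_mul hα' hΩ, matExtDeriv_flatCurv_pow hA,
    involute_ιMatrix, covExtDeriv]
  simp only [mul_sub, neg_mul, add_mul, Matrix.trace_add, Matrix.trace_sub, Matrix.trace_neg,
    mul_assoc] at h1 ⊢
  rw [h1]
  abel

theorem ιMatrix_add_smul (A α : Matrix n n (E →L[ℝ] ℂ)) (t : ℂ) :
    ιMatrix (A + t • α) = ιMatrix A + t • ιMatrix α := by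
  ext i j
  simp [ιMatrix]

theorem matExtDeriv_smul (t : ℂ) (hΦ : MatSmoothAt Φ y) :
    matExtDeriv (fun z => t • Φ z) y = t • matExtDeriv Φ y :=
  Matrix.ext fun i j => flatExtDeriv_const_smul t (hΦ i j)

theorem flatCurv_add_smul (hA : ∀ i j, ContDiffAt ℝ ∞ (fun z => A z i j) y)
    (hα : ∀ i j, ContDiffAt ℝ ∞ (fun z => α z i j) y) (t : ℂ) :
    flatCurv (fun z => A z + t • α z) y
      = flatCurv A y + t • covExtDeriv A α y + t ^ 2 • (ιMatrix (α y) * ιMatrix (α y)) := by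
  have hA' := MatSmoothAt.ιMatrix hA
  have hα' := MatSmoothAt.ιMatrix hα
  have hα'' : MatSmoothAt (fun z => t • ιMatrix (α z)) y := fun i j => (hα' i j).const_smul t
  rw [flatCurv, flatCurv, covExtDeriv]
  simp only [ιMatrix_add_smul]
  rw [matExtDeriv_add hA' hα'', matExtDeriv_smul t hα']
  simp only [add_mul, mul_add, smul_add, smul_mul_assoc, mul_smul_comm, smul_smul, pow_two]
  abel

/-- The **transgression formula**: the difference of the traces of the powers of the curvatures of
`A + α` and `A` is exact. -/
theorem flatExtDeriv_transgression (hA : ∀ i j, ContDiffAt ℝ ∞ (fun z => A z i j) y)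
    (hα : ∀ i j, ContDiffAt ℝ ∞ (fun z => α z i j) y) (k : ℕ) {w : ℕ → ℂ}
    (hw : ∀ j ≤ 2 * k + 1,
      ∑ i ∈ Finset.range (2 * k + 1 + 1), w i * (i : ℂ) ^ j = 1 / (j + 1)) :
    flatExtDeriv (fun z => ∑ i ∈ Finset.range (2 * k + 1 + 1), (w i * ((k + 1 : ℕ) : ℂ)) •
        (ιMatrix (α z) * flatCurv (fun u => A u + (i : ℂ) • α u) z ^ k).trace) y
      = (flatCurv (fun u => A u + α u) y ^ (k + 1)).trace - (flatCurv A y ^ (k + 1)).trace := by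
  have hAt : ∀ t : ℂ, ∀ i j, ContDiffAt ℝ ∞ (fun z => (A z + t • α z) i j) y := fun t i j =>
    (hA i j).add ((hα i j).const_smul t)
  have hs : ∀ t : ℂ, FormContDiffAt ∞ (fun z =>
      (ιMatrix (α z) * flatCurv (fun u => A u + t • α u) z ^ k).trace) y := fun t =>
    ((MatSmoothAt.ιMatrix hα).mul ((MatSmoothAt.flatCurv (hAt t)).pow k)).trace
  have h1 : flatCurv (fun u => A u + α u) y = flatCurv A y + covExtDeriv A α y
      + ιMatrix (α y) * ιMatrix (α y) := by
    simpa using flatCurv_add_smul hA hα 1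
  rw [flatExtDeriv_finsum _ fun (i : ℕ) _ => (hs (i : ℂ)).const_smul (w i * ((k + 1 : ℕ) : ℂ)), h1,
    ← sum_quadrature_trace_pow_of_even k hw (isEvenMatrix_flatCurv A y)
      (isEvenMatrix_covExtDeriv A α y) (IsEvenMatrix.ιMatrix_mul_ιMatrix (α y) (α y))]
  refine Finset.sum_congr rfl fun i _ => ?_
  rw [flatExtDeriv_const_smul _ (hs i), flatExtDeriv_trace_mul_flatCurv_pow (hAt i) hα,
    flatCurv_add_smul hA hα, mul_smul]
  congr 4
  simp only [covExtDeriv, ιMatrix_add_smul, add_mul, mul_add, smul_mul_assoc, mul_smul_comm,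
    two_mul, add_smul]
  abel

theorem formContDiffAt_transgression (hA : ∀ i j, ContDiffAt ℝ ∞ (fun z => A z i j) y)
    (hα : ∀ i j, ContDiffAt ℝ ∞ (fun z => α z i j) y) (k : ℕ) (s : Finset ℕ) (w : ℕ → ℂ) :
    FormContDiffAt ∞ (fun z => ∑ i ∈ s, w i •
      (ιMatrix (α z) * flatCurv (fun u => A u + (i : ℂ) • α u) z ^ k).trace) y := by
  have hAt : ∀ t : ℂ, ∀ i j, ContDiffAt ℝ ∞ (fun z => (A z + t • α z) i j) y := fun t i j =>
    (hA i j).add ((hα i j).const_smul t)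
  exact FormContDiffAt.sum fun (i : ℕ) _ => FormContDiffAt.const_smul (w i)
    ((MatSmoothAt.ιMatrix hα).mul ((MatSmoothAt.flatCurv (hAt (i : ℂ))).pow k)).trace

end Curvature

end FlatMatrices

/-! ### Differential forms in charts -/

section Charts

open Topology

variable {E : Type*} [NormedAddCommGroup E] [NormedSpace ℝ E]
  {M : Type*} [TopologicalSpace M] [ChartedSpace E M]

/-- The expression of a complex one-form in the preferred chart at `c`. -/
def covectorInChart (c : M) (α : ∀ x : M, TangentSpace 𝓘(ℝ, E) x →L[ℝ] ℂ) (z : E) : E →L[ℝ] ℂ :=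
  α ((chartAt E c).symm z) ∘L chartSymmDeriv c z

theorem chartRep_ι (c : M) (α : ∀ x : M, TangentSpace 𝓘(ℝ, E) x →L[ℝ] ℂ) (z : E) :
    chartRep (fun x => ExteriorAlgebra.ι ℂ (α x)) c z
      = ExteriorAlgebra.ι ℂ (covectorInChart c α z) :=
  ExteriorAlgebra.map_apply_ι _ _

theorem CForm.pullback_pullback {W₁ W₂ W₃ : Type*} [AddCommGroup W₁] [Module ℝ W₁]
    [TopologicalSpace W₁] [AddCommGroup W₂] [Module ℝ W₂] [TopologicalSpace W₂] [AddCommGroup W₃]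
    [Module ℝ W₃] [TopologicalSpace W₃] (L : W₁ →L[ℝ] W₂) (K : W₂ →L[ℝ] W₃) (a : CForm W₃) :
    CForm.pullback L (CForm.pullback K a) = CForm.pullback (K ∘L L) a := by
  rw [CForm.pullback, CForm.pullback, ← AlgHom.comp_apply, ExteriorAlgebra.map_comp_map]
  rfl

variable [IsManifold 𝓘(ℝ, E) ∞ M]

theorem contMDiffAt_chartAt_symm {c : M} {z : E} (hz : z ∈ (chartAt E c).target) :
    ContMDiffAt 𝓘(ℝ, E) 𝓘(ℝ, E) ∞ (chartAt E c).symm z :=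
  (contMDiffOn_chart_symm (I := 𝓘(ℝ, E)) (x := c)).contMDiffAt
    ((chartAt E c).open_target.mem_nhds hz)

theorem contMDiffAt_chartAt {c x : M} (hx : x ∈ (chartAt E c).source) :
    ContMDiffAt 𝓘(ℝ, E) 𝓘(ℝ, E) ∞ (chartAt E c) x :=
  (contMDiffOn_chart (I := 𝓘(ℝ, E)) (x := c)).contMDiffAt
    ((chartAt E c).open_source.mem_nhds hx)

theorem contDiffAt_comp_chartAt_symm {G : Type*} [NormedAddCommGroup G] [NormedSpace ℝ G]
    {h : M → G} {c : M} {z : E} (hz : z ∈ (chartAt E c).target)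
    (hh : ContMDiffAt 𝓘(ℝ, E) 𝓘(ℝ, G) ∞ h ((chartAt E c).symm z)) :
    ContDiffAt ℝ ∞ (fun u => h ((chartAt E c).symm u)) z :=
  (hh.comp z (contMDiffAt_chartAt_symm hz)).contDiffAt

/-- In a chart, the differential of a function is the derivative of its coordinate expression. -/
theorem covectorInChart_mfderiv {h : M → ℂ} {c : M} {z : E} (hz : z ∈ (chartAt E c).target)
    (hh : MDifferentiableAt 𝓘(ℝ, E) 𝓘(ℝ, ℂ) h ((chartAt E c).symm z)) :
    covectorInChart c (fun x => mfderiv 𝓘(ℝ, E) 𝓘(ℝ, ℂ) h x) z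
      = fderiv ℝ (fun u => h ((chartAt E c).symm u)) z := by
  rw [← mfderiv_eq_fderiv]
  exact (mfderiv_comp z hh ((contMDiffAt_chartAt_symm hz).mdifferentiableAt (by simp))).symm

section Transition

variable {c : M} {z : E}

theorem eventually_mem_chartAt_target_and_source (hz : z ∈ (chartAt E c).target) :
    ∀ᶠ u in 𝓝 z, u ∈ (chartAt E c).target ∧
      (chartAt E c).symm u ∈ (chartAt E ((chartAt E c).symm z)).source := by
  refine ((chartAt E c).open_target.mem_nhds hz |> Filter.Eventually.and) ?_
  exact ((chartAt E c).continuousAt_symm hz).eventually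
    ((chartAt E _).open_source.mem_nhds (mem_chart_source E _))

/-- The coordinate change from the preferred chart at `c` to that at another point. -/
theorem contDiffAt_chartTransition (hz : z ∈ (chartAt E c).target) :
    ContDiffAt ℝ ∞ (fun u => chartAt E ((chartAt E c).symm z) ((chartAt E c).symm u)) z :=
  contDiffAt_comp_chartAt_symm hz (contMDiffAt_chartAt (mem_chart_source E _))

theorem fderiv_chartTransition (hz : z ∈ (chartAt E c).target) :
    fderiv ℝ (fun u => chartAt E ((chartAt E c).symm z) ((chartAt E c).symm u)) z
      = chartDeriv ((chartAt E c).symm z) ∘L chartSymmDeriv c z := by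
  rw [← mfderiv_eq_fderiv]
  exact mfderiv_comp z ((contMDiffAt_chartAt (mem_chart_source E _)).mdifferentiableAt (by simp))
    ((contMDiffAt_chartAt_symm hz).mdifferentiableAt (by simp))

/-- The expressions of a one-form in two charts are related by pullback along the coordinate
change. -/
theorem covectorInChart_chartTransition (hz : z ∈ (chartAt E c).target)
    (α : ∀ x : M, TangentSpace 𝓘(ℝ, E) x →L[ℝ] ℂ) :
    ∀ᶠ u in 𝓝 z, covectorInChart c α u
      = covectorInChart ((chartAt E c).symm z) α
          (chartAt E ((chartAt E c).symm z) ((chartAt E c).symm u)) ∘L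
        fderiv ℝ (fun u => chartAt E ((chartAt E c).symm z) ((chartAt E c).symm u)) u := by
  set x := (chartAt E c).symm z with hx
  filter_upwards [eventually_mem_chartAt_target_and_source hz,
    (eventually_mem_chartAt_target_and_source hz).eventually_nhds] with u hu hu'
  let α' : M → (E →L[ℝ] ℂ) := α
  let τ : E → E := fun u => chartAt E x ((chartAt E c).symm u)
  have hτu : τ u ∈ (chartAt E x).target := (chartAt E x).map_source hu.2
  have h1 : (chartAt E x).symm (τ u) = (chartAt E c).symm u := (chartAt E x).left_inv hu.2
  have hτ : ContDiffAt ℝ ∞ τ u :=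
    contDiffAt_comp_chartAt_symm hu.1 (contMDiffAt_chartAt hu.2)
  have h2 : (mfderiv 𝓘(ℝ, E) 𝓘(ℝ, E) (chartAt E c).symm u : E →L[ℝ] E)
      = (mfderiv 𝓘(ℝ, E) 𝓘(ℝ, E) (chartAt E x).symm (τ u) : E →L[ℝ] E) ∘L fderiv ℝ τ u := by
    have h3 : (chartAt E c).symm =ᶠ[𝓝 u] (chartAt E x).symm ∘ τ :=
      hu'.mono fun v hv => ((chartAt E x).left_inv hv.2).symm
    have h4 := mfderiv_comp (I := 𝓘(ℝ, E)) (I' := 𝓘(ℝ, E)) (I'' := 𝓘(ℝ, E)) u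
      ((contMDiffAt_chartAt_symm hτu).mdifferentiableAt (by simp))
      (hτ.contMDiffAt.mdifferentiableAt (by simp))
    rw [mfderiv_eq_fderiv] at h4
    exact (h3.mfderiv_eq (I := 𝓘(ℝ, E)) (I' := 𝓘(ℝ, E))).trans h4
  change α' ((chartAt E c).symm u) ∘L (mfderiv 𝓘(ℝ, E) 𝓘(ℝ, E) (chartAt E c).symm u : E →L[ℝ] E)
    = (α' ((chartAt E x).symm (τ u)) ∘L
        (mfderiv 𝓘(ℝ, E) 𝓘(ℝ, E) (chartAt E x).symm (τ u) : E →L[ℝ] E)) ∘L fderiv ℝ τ u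
  rw [h1, h2]
  rfl

variable [FiniteDimensional ℝ E]

/-- The exterior derivative of a one-form can be computed in any chart. -/
theorem pullback_extDerivForm_ι (hz : z ∈ (chartAt E c).target)
    {α : ∀ x : M, TangentSpace 𝓘(ℝ, E) x →L[ℝ] ℂ}
    (hα : ContDiffAt ℝ ∞ (covectorInChart ((chartAt E c).symm z) α)
      (chartAt E ((chartAt E c).symm z) ((chartAt E c).symm z))) :
    CForm.pullback (chartSymmDeriv c z)
        (extDerivForm (fun x => ExteriorAlgebra.ι ℂ (α x)) ((chartAt E c).symm z))
      = flatExtDeriv (fun u => ExteriorAlgebra.ι ℂ (covectorInChart c α u)) z := by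
  have h1 := flatExtDeriv_ι_comp (contDiffAt_chartTransition hz) hα
  have h2 : (fun u => (ExteriorAlgebra.ι ℂ (covectorInChart c α u) : CForm E)) =ᶠ[𝓝 z] _ :=
    (covectorInChart_chartTransition hz α).mono fun u hu =>
      congrArg (ExteriorAlgebra.ι ℂ) hu
  rw [flatExtDeriv_congr h2, h1, extDerivForm, CForm.pullback_pullback, fderiv_chartTransition hz]
  congr 2
  exact funext fun y => chartRep_ι _ _ _

end Transition

section Local

variable [FiniteDimensional ℝ E]

theorem isSmoothForm_of_chartRep {θ : MixedForm E M}
    (h : ∀ (c : M) (z : E), z ∈ (chartAt E c).target → FormContDiffAt ∞ (chartRep θ c) z) :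
    IsSmoothForm θ :=
  fun c I _ hz => (h c _ hz I).contDiffWithinAt

end Local

end Charts

/-! ### Curvature matrices in charts -/

section ChartMatrices

open Topology

variable {E : Type*} [NormedAddCommGroup E] [NormedSpace ℝ E] [FiniteDimensional ℝ E]
  {M : Type*} [TopologicalSpace M] [ChartedSpace E M] {n : Type*} [Fintype n]

/-- The expression of a matrix of one-forms in the preferred chart at `c`. -/
def matInChart (c : M) (θ : ∀ x : M, Matrix n n (TangentSpace 𝓘(ℝ, E) x →L[ℝ] ℂ)) (z : E) :
    Matrix n n (E →L[ℝ] ℂ) :=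
  Matrix.of fun i j => covectorInChart c (fun x => θ x i j) z

/-- The curvature `dθ + θ ∧ θ` of a matrix of one-forms on `M`. -/
def formCurv (θ : ∀ x : M, Matrix n n (TangentSpace 𝓘(ℝ, E) x →L[ℝ] ℂ)) (x : M) :
    Matrix n n (EvenCForm (TangentSpace 𝓘(ℝ, E) x)) :=
  Matrix.of fun j i =>
    ⟨extDerivForm (fun y => ExteriorAlgebra.ι ℂ (θ y j i)) x, extDerivForm_ι_mem_even _ x⟩
      + ∑ k, ⟨ExteriorAlgebra.ι ℂ (θ x j k) * ExteriorAlgebra.ι ℂ (θ x k i),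
          CForm.ι_mul_ι_mem_even _ _⟩

theorem formCurv_map_evenVal (θ : ∀ x : M, Matrix n n (TangentSpace 𝓘(ℝ, E) x →L[ℝ] ℂ)) (x : M) :
    (formCurv θ x).map evenVal
      = Matrix.of (fun j i => extDerivForm (fun y => ExteriorAlgebra.ι ℂ (θ y j i)) x)
        + ιMatrix (θ x) * ιMatrix (θ x) := by
  ext j i
  refine (evenVal_add _ _).trans (congrArg₂ _ rfl ?_)
  exact evenVal_sum _ _

theorem pullback_map_mul {W W' : Type*} [AddCommGroup W] [Module ℝ W] [TopologicalSpace W]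
    [AddCommGroup W'] [Module ℝ W'] [TopologicalSpace W'] (L : W →L[ℝ] W')
    (Φ Ψ : Matrix n n (CForm W')) :
    (Φ * Ψ).map (CForm.pullback L) = Φ.map (CForm.pullback L) * Ψ.map (CForm.pullback L) :=
  Matrix.map_mul (f := (CForm.pullback L).toRingHom)

theorem pullback_map_pow {W W' : Type*} [AddCommGroup W] [Module ℝ W] [TopologicalSpace W]
    [AddCommGroup W'] [Module ℝ W'] [TopologicalSpace W'] [DecidableEq n] (L : W →L[ℝ] W')
    (Φ : Matrix n n (CForm W')) (k : ℕ) :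
    (Φ ^ k).map (CForm.pullback L) = Φ.map (CForm.pullback L) ^ k :=
  map_pow (CForm.pullback L).mapMatrix Φ k

theorem pullback_trace {W W' : Type*} [AddCommGroup W] [Module ℝ W] [TopologicalSpace W]
    [AddCommGroup W'] [Module ℝ W'] [TopologicalSpace W'] (L : W →L[ℝ] W')
    (Φ : Matrix n n (CForm W')) :
    CForm.pullback L Φ.trace = (Φ.map (CForm.pullback L)).trace := by
  simp [Matrix.trace]

theorem pullback_ιMatrix {W W' : Type*} [AddCommGroup W] [Module ℝ W] [TopologicalSpace W]
    [AddCommGroup W'] [Module ℝ W'] [TopologicalSpace W'] (L : W →L[ℝ] W')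
    (A : Matrix n n (W' →L[ℝ] ℂ)) :
    (ιMatrix A).map (CForm.pullback L) = ιMatrix (A.map fun α => α ∘L L) :=
  Matrix.ext fun _ _ => ExteriorAlgebra.map_apply_ι _ _

variable [IsManifold 𝓘(ℝ, E) ∞ M]

/-- The curvature at `x` is computed in the preferred chart at `x`, by definition of the exterior
derivative. -/
theorem formCurv_eq_pullback (θ : ∀ x : M, Matrix n n (TangentSpace 𝓘(ℝ, E) x →L[ℝ] ℂ)) (x : M) :
    (formCurv θ x).map evenVal
      = (flatCurv (matInChart x θ) (chartAt E x x)).map (CForm.pullback (chartDeriv x)) := by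
  have h1 : ιMatrix (θ x)
      = (ιMatrix (matInChart x θ (chartAt E x x))).map (CForm.pullback (chartDeriv x)) := by
    ext i j
    have := pullback_chartRep (fun x => ExteriorAlgebra.ι ℂ (θ x i j)) x
    rw [chartRep_ι] at this
    exact this.symm
  rw [formCurv_map_evenVal, h1, ← pullback_map_mul, flatCurv,
    Matrix.map_add _ (fun a b => map_add (CForm.pullback (chartDeriv x)) a b)]
  congr 1
  ext i j
  simp only [Matrix.of_apply, Matrix.map_apply, matExtDeriv, extDerivForm]
  congr 2
  exact funext fun y => chartRep_ι _ _ _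

/-- The curvature on `M` has the expected expression in every chart, not only in the preferred chart
at the given point. -/
theorem pullback_formCurv {θ : ∀ x : M, Matrix n n (TangentSpace 𝓘(ℝ, E) x →L[ℝ] ℂ)} {c : M}
    {z : E} (hz : z ∈ (chartAt E c).target)
    (hθ : ∀ i j, ContDiffAt ℝ ∞ (fun u => matInChart ((chartAt E c).symm z) θ u i j)
      (chartAt E ((chartAt E c).symm z) ((chartAt E c).symm z))) :
    ((formCurv θ ((chartAt E c).symm z)).map evenVal).map (CForm.pullback (chartSymmDeriv c z))
      = flatCurv (matInChart c θ) z := by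
  rw [formCurv_map_evenVal,
    Matrix.map_add _ (fun a b => map_add (CForm.pullback (chartSymmDeriv c z)) a b),
    pullback_map_mul, pullback_ιMatrix, flatCurv]
  congr 1
  ext i j
  exact pullback_extDerivForm_ι hz (hθ i j)

end ChartMatrices

/-! ### Transition matrices of a vector bundle -/

section TransitionMatrix

open Topology

variable {E : Type*} [NormedAddCommGroup E] [NormedSpace ℝ E] [FiniteDimensional ℝ E]
  {M : Type*} [TopologicalSpace M] [ChartedSpace E M] [IsManifold 𝓘(ℝ, E) ∞ M]
  {F : Type*} [NormedAddCommGroup F] [NormedSpace ℝ F] [FiniteDimensional ℝ F]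
  {V : M → Type*} [TopologicalSpace (TotalSpace F V)]
  [∀ x, AddCommGroup (V x)] [∀ x, Module ℝ (V x)] [∀ x, TopologicalSpace (V x)]
  [∀ x, IsTopologicalAddGroup (V x)] [∀ x, ContinuousSMul ℝ (V x)]
  [FiberBundle F V] [VectorBundle ℝ F V]

variable (F V) in
/-- The real transition matrix from the frame of `V` given by the preferred trivialization at `q`
to the one at `p`: its `i`-th column contains the coordinates of the `i`-th vector of the frame at
`q`. -/
def transitionMatrix (p q x : M) :
    Matrix (Fin (Module.finrank ℝ F)) (Fin (Module.finrank ℝ F)) ℝ :=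
  Matrix.of fun j i => ComplexifiedConnection.frameCoord (F := F) (V := V) p j x
    ((trivializationAt F V q).symmL ℝ x (Module.finBasis ℝ F i))

theorem sum_frameCoord_smul {p x : M} (hp : x ∈ (trivializationAt F V p).baseSet) (v : V x) :
    ∑ j, ComplexifiedConnection.frameCoord (F := F) (V := V) p j x v •
      (trivializationAt F V p).symmL ℝ x (Module.finBasis ℝ F j) = v := by
  have h : ∀ j, ComplexifiedConnection.frameCoord (F := F) (V := V) p j x v
      = (Module.finBasis ℝ F).repr ((trivializationAt F V p).continuousLinearMapAt ℝ x v) j :=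
    fun j => rfl
  simp only [h, ← map_smul, ← map_sum]
  rw [(Module.finBasis ℝ F).sum_repr]
  exact (trivializationAt F V p).symmL_continuousLinearMapAt hp v

theorem symmL_eq_sum_transitionMatrix {p x : M} (hp : x ∈ (trivializationAt F V p).baseSet)
    (q : M) (i : Fin (Module.finrank ℝ F)) :
    (trivializationAt F V q).symmL ℝ x (Module.finBasis ℝ F i)
      = ∑ j, transitionMatrix F V p q x j i •
        (trivializationAt F V p).symmL ℝ x (Module.finBasis ℝ F j) :=
  (sum_frameCoord_smul hp _).symm

theorem transitionMatrix_mul {p x : M} (hp : x ∈ (trivializationAt F V p).baseSet) (a q : M) :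
    transitionMatrix F V a p x * transitionMatrix F V p q x = transitionMatrix F V a q x := by
  ext j i
  rw [Matrix.mul_apply]
  conv_rhs => rw [transitionMatrix, Matrix.of_apply, symmL_eq_sum_transitionMatrix hp q i, map_sum]
  refine Finset.sum_congr rfl fun k _ => ?_
  rw [map_smul, smul_eq_mul, mul_comm]
  rfl

theorem transitionMatrix_self {p x : M} (hp : x ∈ (trivializationAt F V p).baseSet) :
    transitionMatrix F V p p x = 1 := by
  ext j i
  simp only [transitionMatrix, ComplexifiedConnection.frameCoord, Matrix.of_apply,
    ContinuousLinearMap.comp_apply, (trivializationAt F V p).continuousLinearMapAt_symmL hp]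
  simp [Matrix.one_apply, Finsupp.single_apply, eq_comm]

theorem transitionMatrix_mul_transitionMatrix {p q x : M}
    (hp : x ∈ (trivializationAt F V p).baseSet) (hq : x ∈ (trivializationAt F V q).baseSet) :
    transitionMatrix F V q p x * transitionMatrix F V p q x = 1 := by
  rw [transitionMatrix_mul hp, transitionMatrix_self hq]

theorem contMDiffAt_transitionMatrix [ContMDiffVectorBundle ∞ F V 𝓘(ℝ, E)] {p q x : M}
    (hp : x ∈ (trivializationAt F V p).baseSet) (hq : x ∈ (trivializationAt F V q).baseSet)
    (i j : Fin (Module.finrank ℝ F)) :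
    ContMDiffAt 𝓘(ℝ, E) 𝓘(ℝ, ℝ) ∞ (fun y => transitionMatrix F V p q y i j) x := by
  have h1 := contMDiffAt_coordChangeL (IB := 𝓘(ℝ, E)) (n := ∞) (e := trivializationAt F V q)
    (e' := trivializationAt F V p) hq hp
  have h2 : ContMDiffAt 𝓘(ℝ, E) 𝓘(ℝ, ℝ) ∞ (fun y =>
      ((Module.finBasis ℝ F).coord i).toContinuousLinearMap
        (((trivializationAt F V q).coordChangeL ℝ (trivializationAt F V p) y : F →L[ℝ] F)
          (Module.finBasis ℝ F j))) x :=
    (ContinuousLinearMap.contMDiff _).contMDiffAt.comp x (h1.clm_apply contMDiffAt_const)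
  refine h2.congr_of_eventuallyEq ?_
  have ho : ∀ᶠ y in 𝓝 x, y ∈ (trivializationAt F V q).baseSet ∩ (trivializationAt F V p).baseSet :=
    (((trivializationAt F V q).open_baseSet.inter (trivializationAt F V p).open_baseSet).mem_nhds
      ⟨hq, hp⟩)
  filter_upwards [ho] with y hy
  simp only [transitionMatrix, ComplexifiedConnection.frameCoord, Matrix.of_apply,
    ContinuousLinearMap.comp_apply]
  rw [ContinuousLinearEquiv.coe_coe, Trivialization.coordChangeL_apply' _ _ hy,
    Trivialization.symmL_apply, Trivialization.continuousLinearMapAt_apply,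
    Trivialization.linearMapAt_apply, if_pos hy.2, Trivialization.mk_symm _ hy.1]
  exact hy.1

end TransitionMatrix

/-! ### Connection forms and transgression on a manifold -/

section ConnectionForms

open Topology

variable (E : Type*) [NormedAddCommGroup E] [NormedSpace ℝ E] [FiniteDimensional ℝ E]
  {M : Type*} [TopologicalSpace M] [ChartedSpace E M] [IsManifold 𝓘(ℝ, E) ∞ M]
  (F : Type*) [NormedAddCommGroup F] [NormedSpace ℝ F] [FiniteDimensional ℝ F]
  (V : M → Type*) [TopologicalSpace (TotalSpace F V)]
  [∀ x, AddCommGroup (V x)] [∀ x, Module ℝ (V x)] [∀ x, TopologicalSpace (V x)]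
  [∀ x, IsTopologicalAddGroup (V x)] [∀ x, ContinuousSMul ℝ (V x)]
  [FiberBundle F V] [VectorBundle ℝ F V]

/-- The family of the matrices of connection forms, in the local frames of `V`, of a connection on
`V ⊗ ℂ`: matrices of one-forms indexed by the preferred trivializations, smooth on the domains of
these, which transform by the gauge law `g ω_q = ω_p g + dg` under the change of frame `g`. Both
conditions are expressed in the preferred charts of `M`. -/
structure ConnectionForms where
  /-- The matrix of connection forms in the frame given by the preferred trivialization at `p`. -/
  toFun (p x : M) : Matrix (Fin (Module.finrank ℝ F)) (Fin (Module.finrank ℝ F))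
    (TangentSpace 𝓘(ℝ, E) x →L[ℝ] ℂ)
  smooth (p c : M) (z : E) (hz : z ∈ (chartAt E c).target)
    (hp : (chartAt E c).symm z ∈ (trivializationAt F V p).baseSet)
    (i j : Fin (Module.finrank ℝ F)) :
    ContDiffAt ℝ ∞ (fun u => matInChart c (toFun p) u i j) z
  gauge (p q c : M) (z : E) (hz : z ∈ (chartAt E c).target)
    (hp : (chartAt E c).symm z ∈ (trivializationAt F V p).baseSet)
    (hq : (chartAt E c).symm z ∈ (trivializationAt F V q).baseSet) :
    constMatrix ((transitionMatrix F V p q ((chartAt E c).symm z)).map Complex.ofReal)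
        * ιMatrix (matInChart c (toFun q) z)
      = ιMatrix (matInChart c (toFun p) z)
          * constMatrix ((transitionMatrix F V p q ((chartAt E c).symm z)).map Complex.ofReal)
        + ιMatrix (matDeriv
          (fun u => (transitionMatrix F V p q ((chartAt E c).symm u)).map Complex.ofReal) z)

variable {E F V}

theorem eventually_mem_baseSet {p c : M} {z : E} (hz : z ∈ (chartAt E c).target)
    (hp : (chartAt E c).symm z ∈ (trivializationAt F V p).baseSet) :
    ∀ᶠ u in 𝓝 z, u ∈ (chartAt E c).target ∧
      (chartAt E c).symm u ∈ (trivializationAt F V p).baseSet :=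
  ((chartAt E c).open_target.mem_nhds hz |> Filter.Eventually.and)
    (((chartAt E c).continuousAt_symm hz).eventually
      ((trivializationAt F V p).open_baseSet.mem_nhds hp))

theorem contDiffAt_transitionMatrix [ContMDiffVectorBundle ∞ F V 𝓘(ℝ, E)] {p q c : M} {z : E}
    (hz : z ∈ (chartAt E c).target)
    (hp : (chartAt E c).symm z ∈ (trivializationAt F V p).baseSet)
    (hq : (chartAt E c).symm z ∈ (trivializationAt F V q).baseSet)
    (i j : Fin (Module.finrank ℝ F)) :
    ContDiffAt ℝ ∞ (fun u =>
      (transitionMatrix F V p q ((chartAt E c).symm u)).map Complex.ofReal i j) z :=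
  Complex.ofRealCLM.contDiff.contDiffAt.comp z
    (contDiffAt_comp_chartAt_symm hz (contMDiffAt_transitionMatrix hp hq i j))

/-- Conjugate matrices of forms have the same trace. -/
theorem trace_eq_of_constMatrix_mul {W : Type*} [AddCommGroup W] [Module ℝ W] [TopologicalSpace W]
    {n : Type*} [Fintype n] [DecidableEq n] {g h : Matrix n n ℂ} (hg : h * g = 1)
    {Φ Ψ : Matrix n n (CForm W)} (hΦ : constMatrix g * Φ = Ψ * constMatrix g) :
    Φ.trace = Ψ.trace := by
  have h1 : ∀ a b : Matrix n n ℂ, a * b = 1 →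
      constMatrix (W := W) a * constMatrix b = 1 := by
    intro a b hab
    have := congrArg ((Algebra.ofId ℂ (CForm W)).mapMatrix) hab
    rw [map_mul, map_one] at this
    exact this
  calc Φ.trace = (constMatrix h * (constMatrix g * Φ)).trace := by
        rw [← mul_assoc, h1 _ _ hg, one_mul]
    _ = Ψ.trace := by
        rw [hΦ, trace_constMatrix_mul_comm, mul_assoc, h1 _ _ (mul_eq_one_comm.mp hg),
          mul_one]

namespace ConnectionForms

/-- The affine combination `(1 - t) D₀ + t D₁` of two connections. -/
def line (D₀ D₁ : ConnectionForms E F V) (t : ℂ) : ConnectionForms E F V where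
  toFun p x := D₀.toFun p x + t • (D₁.toFun p x - D₀.toFun p x)
  smooth p c z hz hp i j := (D₀.smooth p c z hz hp i j).add
    (((D₁.smooth p c z hz hp i j).sub (D₀.smooth p c z hz hp i j)).const_smul t)
  gauge p q c z hz hp hq := by
    have h0 := D₀.gauge p q c z hz hp hq
    have h1 := D₁.gauge p q c z hz hp hq
    have h2 : ∀ p, ιMatrix (matInChart c
        (fun x => D₀.toFun p x + t • (D₁.toFun p x - D₀.toFun p x)) z)
        = ιMatrix (matInChart c (D₀.toFun p) z)
          + t • (ιMatrix (matInChart c (D₁.toFun p) z)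
            - ιMatrix (matInChart c (D₀.toFun p) z)) := by
      intro p
      ext i j
      simp only [ιMatrix, Matrix.map_apply, Matrix.add_apply, Matrix.smul_apply, Matrix.sub_apply,
        ← map_sub, ← map_smul, ← map_add]
      rfl
    rw [h2, h2, mul_add, add_mul, mul_smul_comm, smul_mul_assoc, mul_sub, sub_mul, h0, h1]
    module

/-- The traces of the powers of the curvature. -/
def traceForm (D : ConnectionForms E F V) (k : ℕ) : EvenForm E M :=
  fun x => ((formCurv (D.toFun x) x) ^ k).trace

/-- The matrix of one-forms by which two connections differ. -/
def diff (D₀ D₁ : ConnectionForms E F V) (p x : M) :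
    Matrix (Fin (Module.finrank ℝ F)) (Fin (Module.finrank ℝ F))
      (TangentSpace 𝓘(ℝ, E) x →L[ℝ] ℂ) := D₁.toFun p x - D₀.toFun p x

/-- The trace of the product of the difference of two connections and a power of the curvature of
a third one. -/
def diffTraceForm (D₀ D₁ D : ConnectionForms E F V) (k : ℕ) : MixedForm E M :=
  fun x => (ιMatrix (diff D₀ D₁ x x) * (formCurv (D.toFun x) x).map evenVal ^ k).trace

variable [ContMDiffVectorBundle ∞ F V 𝓘(ℝ, E)] (D D₀ D₁ : ConnectionForms E F V)

theorem flatCurv_gauge {p q c : M} {z : E} (hz : z ∈ (chartAt E c).target)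
    (hp : (chartAt E c).symm z ∈ (trivializationAt F V p).baseSet)
    (hq : (chartAt E c).symm z ∈ (trivializationAt F V q).baseSet) :
    constMatrix ((transitionMatrix F V p q ((chartAt E c).symm z)).map Complex.ofReal)
        * flatCurv (matInChart c (D.toFun q)) z
      = flatCurv (matInChart c (D.toFun p)) z
        * constMatrix ((transitionMatrix F V p q ((chartAt E c).symm z)).map Complex.ofReal) := by
  refine _root_.flatCurv_gauge (D.smooth p c z hz hp) (D.smooth q c z hz hq)
    (g := fun u => (transitionMatrix F V p q ((chartAt E c).symm u)).map Complex.ofReal)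
    (contDiffAt_transitionMatrix hz hp hq) ?_
  filter_upwards [eventually_mem_baseSet hz hp, eventually_mem_baseSet hz hq] with u h1 h2
  exact D.gauge p q c u h1.1 h1.2 h2.2

theorem map_transitionMatrix_mul {p q x : M} (hp : x ∈ (trivializationAt F V p).baseSet)
    (hq : x ∈ (trivializationAt F V q).baseSet) :
    (transitionMatrix F V q p x).map Complex.ofReal
        * (transitionMatrix F V p q x).map Complex.ofReal
      = 1 := by
  have := congrArg Complex.ofRealHom.mapMatrix (transitionMatrix_mul_transitionMatrix hp hq)
  rw [map_mul, map_one] at this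
  exact this

theorem constMatrix_mul_flatCurv_pow {p q c : M} {z : E} (hz : z ∈ (chartAt E c).target)
    (hp : (chartAt E c).symm z ∈ (trivializationAt F V p).baseSet)
    (hq : (chartAt E c).symm z ∈ (trivializationAt F V q).baseSet) (k : ℕ) :
    constMatrix ((transitionMatrix F V p q ((chartAt E c).symm z)).map Complex.ofReal)
        * flatCurv (matInChart c (D.toFun q)) z ^ k
      = flatCurv (matInChart c (D.toFun p)) z ^ k
        * constMatrix ((transitionMatrix F V p q ((chartAt E c).symm z)).map Complex.ofReal) :=
  (SemiconjBy.pow_right (D.flatCurv_gauge hz hp hq) k)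

theorem pullback_formCurv {p c : M} {z : E} (hz : z ∈ (chartAt E c).target)
    (hp : (chartAt E c).symm z ∈ (trivializationAt F V p).baseSet) :
    ((formCurv (D.toFun p) ((chartAt E c).symm z)).map evenVal).map
        (CForm.pullback (chartSymmDeriv c z))
      = flatCurv (matInChart c (D.toFun p)) z := by
  refine _root_.pullback_formCurv hz fun i j => D.smooth p _ _ (mem_chart_target E _) ?_ i j
  rwa [(chartAt E _).left_inv (mem_chart_source E _)]

/-- In a chart and a local frame, the form `tr Ωᵏ` has the expected expression. -/
theorem chartRep_traceForm {p c : M} {z : E} (hz : z ∈ (chartAt E c).target)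
    (hp : (chartAt E c).symm z ∈ (trivializationAt F V p).baseSet) (k : ℕ) :
    chartRep (D.traceForm k).toMixed c z = (flatCurv (matInChart c (D.toFun p)) z ^ k).trace := by
  have hx := FiberBundle.mem_baseSet_trivializationAt' (F := F) (E := V) ((chartAt E c).symm z)
  have h1 : (D.traceForm k).toMixed ((chartAt E c).symm z)
      = ((formCurv (D.toFun ((chartAt E c).symm z)) ((chartAt E c).symm z)).map evenVal
          ^ k).trace :=
    (evenVal_trace _).trans (by rw [evenVal_map_pow])
  rw [chartRep, h1, pullback_trace, pullback_map_pow, D.pullback_formCurv hz hx]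
  exact (trace_eq_of_constMatrix_mul (map_transitionMatrix_mul hx hp)
    (D.constMatrix_mul_flatCurv_pow hz hx hp k)).symm

/-- The difference of two connections transforms by conjugation, so that this trace can be computed
in any frame. -/
theorem chartRep_diffTraceForm {p c : M} {z : E} (hz : z ∈ (chartAt E c).target)
    (hp : (chartAt E c).symm z ∈ (trivializationAt F V p).baseSet) (k : ℕ) :
    chartRep (diffTraceForm D₀ D₁ D k) c z
      = (ιMatrix (matInChart c (D₁.toFun p) z - matInChart c (D₀.toFun p) z)
          * flatCurv (matInChart c (D.toFun p)) z ^ k).trace := by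
  have hx := FiberBundle.mem_baseSet_trivializationAt' (F := F) (E := V) ((chartAt E c).symm z)
  set x := (chartAt E c).symm z with hxdef
  have hsub : ∀ A B : Matrix (Fin (Module.finrank ℝ F)) (Fin (Module.finrank ℝ F)) (E →L[ℝ] ℂ),
      ιMatrix (A - B) = ιMatrix A - ιMatrix B := fun A B =>
    Matrix.ext fun i j => map_sub (ExteriorAlgebra.ι ℂ) (A i j) (B i j)
  have h1 : (ιMatrix (diff D₀ D₁ x x)).map (CForm.pullback (chartSymmDeriv c z))
      = ιMatrix (matInChart c (D₁.toFun x) z - matInChart c (D₀.toFun x) z) :=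
    (pullback_ιMatrix _ _).trans rfl
  rw [chartRep, diffTraceForm, pullback_trace, pullback_map_mul, pullback_map_pow]
  rw [D.pullback_formCurv hz hx, h1]
  refine (trace_eq_of_constMatrix_mul (map_transitionMatrix_mul hx hp) ?_).symm
  have h2 := D₀.gauge x p c z hz hx hp
  have h3 := D₁.gauge x p c z hz hx hp
  rw [← mul_assoc, hsub, hsub, mul_sub, h2, h3, add_sub_add_right_eq_sub, ← sub_mul, mul_assoc,
    D.constMatrix_mul_flatCurv_pow hz hx hp k, mul_assoc]

theorem traceForm_mem_closedEvenForms (k : ℕ) : D.traceForm k ∈ closedEvenForms E M := by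
  have h : ∀ (c : M) (z : E), z ∈ (chartAt E c).target →
      chartRep (D.traceForm k).toMixed c =ᶠ[𝓝 z]
        fun u => (flatCurv (matInChart c (D.toFun ((chartAt E c).symm z))) u ^ k).trace := by
    intro c z hz
    filter_upwards [eventually_mem_baseSet hz
      (FiberBundle.mem_baseSet_trivializationAt' (F := F) (E := V) ((chartAt E c).symm z))]
      with u hu
    exact D.chartRep_traceForm hu.1 hu.2 k
  have hs : ∀ (c : M) (z : E), z ∈ (chartAt E c).target → ∀ i j, ContDiffAt ℝ ∞
      (fun u => matInChart c (D.toFun ((chartAt E c).symm z)) u i j) z := fun c z hz =>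
    D.smooth _ c z hz (FiberBundle.mem_baseSet_trivializationAt' (F := F) (E := V) _)
  refine ⟨isSmoothForm_of_chartRep fun c z hz =>
    FormContDiffAt.congr ((MatSmoothAt.flatCurv (hs c z hz)).pow k).trace (h c z hz), ?_⟩
  funext x
  have hx := mem_chart_target E x
  rw [extDerivForm, flatExtDeriv_congr (h x _ hx), flatExtDeriv_trace_flatCurv_pow (hs x _ hx),
    map_zero]
  rfl

/-- A form whose exterior derivative is `tr Ω₁ᵏ⁺¹ - tr Ω₀ᵏ⁺¹`. -/
def transgressionForm (w : ℕ → ℂ) (k : ℕ) : MixedForm E M := fun x =>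
  ∑ i ∈ Finset.range (2 * k + 1 + 1),
    (w i * ((k + 1 : ℕ) : ℂ)) • diffTraceForm D₀ D₁ (line D₀ D₁ (i : ℂ)) k x

theorem chartRep_transgressionForm (w : ℕ → ℂ) (k : ℕ) {p c : M} {z : E}
    (hz : z ∈ (chartAt E c).target)
    (hp : (chartAt E c).symm z ∈ (trivializationAt F V p).baseSet) :
    chartRep (transgressionForm D₀ D₁ w k) c z = ∑ i ∈ Finset.range (2 * k + 1 + 1),
      (w i * ((k + 1 : ℕ) : ℂ)) • (ιMatrix (matInChart c (diff D₀ D₁ p) z)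
        * flatCurv (fun v => matInChart c (D₀.toFun p) v
          + (i : ℂ) • matInChart c (diff D₀ D₁ p) v) z ^ k).trace := by
  have h1 : chartRep (transgressionForm D₀ D₁ w k) c z = ∑ i ∈ Finset.range (2 * k + 1 + 1),
      (w i * ((k + 1 : ℕ) : ℂ)) •
        chartRep (diffTraceForm D₀ D₁ (line D₀ D₁ (i : ℂ)) k) c z := by
    simp only [chartRep, transgressionForm, map_sum, map_smul]
  rw [h1]
  refine Finset.sum_congr rfl fun i _ => ?_
  rw [chartRep_diffTraceForm _ _ _ hz hp]
  rfl

theorem eventually_chartRep_transgressionForm (w : ℕ → ℂ) (k : ℕ) {p c : M} {z : E}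
    (hz : z ∈ (chartAt E c).target)
    (hp : (chartAt E c).symm z ∈ (trivializationAt F V p).baseSet) :
    chartRep (transgressionForm D₀ D₁ w k) c =ᶠ[𝓝 z] fun u =>
      ∑ i ∈ Finset.range (2 * k + 1 + 1),
      (w i * ((k + 1 : ℕ) : ℂ)) • (ιMatrix (matInChart c (diff D₀ D₁ p) u)
        * flatCurv (fun v => matInChart c (D₀.toFun p) v
          + (i : ℂ) • matInChart c (diff D₀ D₁ p) v) u ^ k).trace :=
  (eventually_mem_baseSet hz hp).mono fun _ hu =>
    chartRep_transgressionForm D₀ D₁ w k hu.1 hu.2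

theorem smooth_diff {p c : M} {z : E} (hz : z ∈ (chartAt E c).target)
    (hp : (chartAt E c).symm z ∈ (trivializationAt F V p).baseSet)
    (i j : Fin (Module.finrank ℝ F)) :
    ContDiffAt ℝ ∞ (fun u => matInChart c (diff D₀ D₁ p) u i j) z :=
  (D₁.smooth p c z hz hp i j).sub (D₀.smooth p c z hz hp i j)

theorem isSmoothForm_transgressionForm (w : ℕ → ℂ) (k : ℕ) :
    IsSmoothForm (transgressionForm D₀ D₁ w k) := by
  refine isSmoothForm_of_chartRep fun c z hz => ?_
  have hp := FiberBundle.mem_baseSet_trivializationAt' (F := F) (E := V) ((chartAt E c).symm z)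
  have h := formContDiffAt_transgression (D₀.smooth _ c z hz hp) (smooth_diff D₀ D₁ hz hp) k
    (Finset.range (2 * k + 1 + 1)) fun i => w i * ((k + 1 : ℕ) : ℂ)
  exact h.congr (eventually_chartRep_transgressionForm D₀ D₁ w k hz hp)

theorem extDerivForm_transgressionForm {w : ℕ → ℂ} (k : ℕ)
    (hw : ∀ j ≤ 2 * k + 1,
      ∑ i ∈ Finset.range (2 * k + 1 + 1), w i * (i : ℂ) ^ j = 1 / (j + 1)) :
    extDerivForm (transgressionForm D₀ D₁ w k)
      = (D₁.traceForm (k + 1) - D₀.traceForm (k + 1)).toMixed := by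
  funext x
  have hz := mem_chart_target E x
  have hp := FiberBundle.mem_baseSet_trivializationAt' (F := F) (E := V)
    ((chartAt E x).symm (chartAt E x x))
  set p := (chartAt E x).symm (chartAt E x x)
  have h2 : (fun u => matInChart x (D₀.toFun p) u + matInChart x (diff D₀ D₁ p) u)
      = matInChart x (D₁.toFun p) := by
    funext u
    ext i j v
    exact add_sub_cancel (matInChart x (D₀.toFun p) u i j v) (matInChart x (D₁.toFun p) u i j v)
  have h3 := flatExtDeriv_transgression (D₀.smooth p x _ hz hp) (smooth_diff D₀ D₁ hz hp) k hw
  rw [h2, ← D₁.chartRep_traceForm hz hp, ← D₀.chartRep_traceForm hz hp] at h3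
  rw [extDerivForm, flatExtDeriv_congr (eventually_chartRep_transgressionForm D₀ D₁ w k hz hp), h3,
    map_sub]
  exact congrArg₂ (· - ·) (pullback_chartRep _ x) (pullback_chartRep _ x)

/-- The class of `tr Ωᵏ` does not depend on the connection. -/
theorem exists_extDerivForm_eq_traceForm_sub (k : ℕ) :
    ∃ η : MixedForm E M, IsSmoothForm η ∧
      extDerivForm η = (D₁.traceForm k - D₀.traceForm k).toMixed := by
  cases k with
  | zero =>
    refine ⟨algebraMap ℂ (MixedForm E M) 0, isSmoothForm_algebraMap 0, ?_⟩
    rw [extDerivForm_algebraMap]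
    funext x
    simp [EvenForm.toMixed, traceForm]
  | succ k =>
    obtain ⟨w, hw⟩ := exists_quadrature_weights (2 * k + 1)
    exact ⟨_, isSmoothForm_transgressionForm D₀ D₁ w k, extDerivForm_transgressionForm D₀ D₁ k hw⟩

end ConnectionForms

end ConnectionForms

/-! ### Matrices of functions and the negative transpose of a connection -/

section MatrixFunctions

variable {E : Type*} [NormedAddCommGroup E] [NormedSpace ℝ E] {n : Type*} [Fintype n]
  [DecidableEq n] {g : E → Matrix n n ℂ} {y : E}

theorem contDiffAt_det (hg : ∀ i j, ContDiffAt ℝ ∞ (fun z => g z i j) y) :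
    ContDiffAt ℝ ∞ (fun z => (g z).det) y := by
  simp only [Matrix.det_apply']
  exact ContDiffAt.sum fun σ _ => contDiffAt_const.mul (contDiffAt_prod fun i _ => hg _ _)

theorem contDiffAt_matrix_inv (hg : ∀ i j, ContDiffAt ℝ ∞ (fun z => g z i j) y)
    (hdet : (g y).det ≠ 0) (i j : n) : ContDiffAt ℝ ∞ (fun z => (g z)⁻¹ i j) y := by
  simp only [Matrix.inv_def, Ring.inverse_eq_inv', Matrix.smul_apply, smul_eq_mul,
    Matrix.adjugate_apply]
  refine ((contDiffAt_det hg).inv hdet).mul (contDiffAt_det fun k l => ?_)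
  by_cases h : k = j
  · subst h
    simp only [Matrix.updateRow_self]
    exact contDiffAt_const
  · simp only [Matrix.updateRow_ne h]
    exact hg k l

theorem constMatrix_mul {W : Type*} [AddCommGroup W] [Module ℝ W] [TopologicalSpace W]
    (a b : Matrix n n ℂ) :
    constMatrix (W := W) (a * b) = constMatrix a * constMatrix b :=
  map_mul (Algebra.ofId ℂ (CForm W)).mapMatrix a b

theorem constMatrix_one {W : Type*} [AddCommGroup W] [Module ℝ W] [TopologicalSpace W] :
    constMatrix (W := W) (1 : Matrix n n ℂ) = 1 :=
  map_one (Algebra.ofId ℂ (CForm W)).mapMatrix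

variable [FiniteDimensional ℝ E]

/-- The product rule for matrices of functions. -/
theorem ιMatrix_matDeriv_mul {h : E → Matrix n n ℂ}
    (hg : ∀ i j, ContDiffAt ℝ ∞ (fun z => g z i j) y)
    (hh : ∀ i j, ContDiffAt ℝ ∞ (fun z => h z i j) y) :
    ιMatrix (matDeriv (fun z => g z * h z) y)
      = ιMatrix (matDeriv g y) * constMatrix (h y)
        + constMatrix (g y) * ιMatrix (matDeriv h y) := by
  have hgh : ∀ i j, ContDiffAt ℝ ∞ (fun z => (g z * h z) i j) y := fun i j => by
    simp only [Matrix.mul_apply]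
    exact ContDiffAt.sum fun k _ => (hg i k).mul (hh k j)
  rw [← matExtDeriv_constMatrix hgh, ← matExtDeriv_constMatrix hg, ← matExtDeriv_constMatrix hh]
  simp only [constMatrix_mul]
  rw [matExtDeriv_mul (MatSmoothAt.constMatrix hg) (MatSmoothAt.constMatrix hh),
    involute_constMatrix]

/-- The curvature of the dual connection is minus the transpose of the curvature. -/
theorem flatCurv_neg_transpose (A : E → Matrix n n (E →L[ℝ] ℂ))
    (hA : ∀ i j, ContDiffAt ℝ ∞ (fun z => A z i j) y) :
    flatCurv (fun z => -(A z).transpose) y = -(flatCurv A y).transpose := by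
  ext i j
  simp only [flatCurv, matExtDeriv, ιMatrix, Matrix.add_apply, Matrix.of_apply, Matrix.map_apply,
    Matrix.neg_apply, Matrix.transpose_apply, Matrix.mul_apply, map_neg]
  rw [flatExtDeriv_neg (FormContDiffAt.ι (hA j i)), neg_add, ← Finset.sum_neg_distrib]
  congr 1
  refine Finset.sum_congr rfl fun k _ => ?_
  rw [neg_mul_neg]
  exact eq_neg_of_add_eq_zero_left (ExteriorAlgebra.ι_add_mul_swap _ _)

/-- Transposition reverses products only for matrices over a commutative ring, whence the
restriction to even degree. -/
theorem trace_neg_transpose_pow {W : Type*} [AddCommGroup W] [Module ℝ W] [TopologicalSpace W]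
    {Φ : Matrix n n (CForm W)} (hΦ : IsEvenMatrix Φ) (k : ℕ) :
    ((-Φ.transpose) ^ k).trace = (-1) ^ k * (Φ ^ k).trace := by
  have h1 : ((-hΦ.lift.transpose) ^ k).trace = (-1) ^ k * (hΦ.lift ^ k).trace := by
    rw [neg_pow, ← Matrix.transpose_pow]
    rcases Nat.even_or_odd k with h | h
    · rw [h.neg_one_pow, h.neg_one_pow, one_mul, one_mul, Matrix.trace_transpose]
    · rw [h.neg_one_pow, h.neg_one_pow, neg_one_mul, neg_one_mul, Matrix.trace_neg,
        Matrix.trace_transpose]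
  have h2 := congrArg evenVal h1
  rw [evenVal_trace, evenVal_map_pow, map_mul, evenVal_trace, evenVal_map_pow, map_pow, map_neg,
    map_one] at h2
  exact h2

end MatrixFunctions

/-! ### A metric on a vector bundle -/

section Metric

open Topology

variable {E : Type*} [NormedAddCommGroup E] [NormedSpace ℝ E] [FiniteDimensional ℝ E]
  {M : Type*} [TopologicalSpace M] [ChartedSpace E M] [IsManifold 𝓘(ℝ, E) ∞ M]
  {F : Type*} [NormedAddCommGroup F] [NormedSpace ℝ F] [FiniteDimensional ℝ F]
  {V : M → Type*} [TopologicalSpace (TotalSpace F V)]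
  [∀ x, AddCommGroup (V x)] [∀ x, Module ℝ (V x)] [∀ x, TopologicalSpace (V x)]
  [∀ x, IsTopologicalAddGroup (V x)] [∀ x, ContinuousSMul ℝ (V x)]
  [FiberBundle F V] [VectorBundle ℝ F V]
  (ρ : SmoothPartitionOfUnity M 𝓘(ℝ, E) M)

variable (F V) in
/-- The Gram matrix, in the frame of `V` given by the preferred trivialization at `p`, of the metric
on `V` obtained from the metrics that make the frames orthonormal by means of a partition of
unity. -/
def gramMatrix (p x : M) : Matrix (Fin (Module.finrank ℝ F)) (Fin (Module.finrank ℝ F)) ℝ :=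
  ∑ a ∈ ρ.finsupport x,
    ρ a x • ((transitionMatrix F V a p x).transpose * transitionMatrix F V a p x)

/-- The Gram matrix transforms as that of a bilinear form. -/
theorem gramMatrix_change {p x : M} (hp : x ∈ (trivializationAt F V p).baseSet) (q : M) :
    gramMatrix F V ρ q x = (transitionMatrix F V p q x).transpose * gramMatrix F V ρ p x
      * transitionMatrix F V p q x := by
  simp only [gramMatrix, Finset.mul_sum, Finset.sum_mul]
  refine Finset.sum_congr rfl fun a _ => ?_
  rw [← transitionMatrix_mul hp a q, Matrix.transpose_mul, mul_smul_comm, smul_mul_assoc]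
  simp only [mul_assoc]

/-- A vector in the kernel of the Gram matrix has length zero in one of the metrics with positive
weight at `x`. -/
theorem gramMatrix_det_ne_zero
    (hρ : ρ.IsSubordinate fun a => (trivializationAt F V a).baseSet) {p x : M}
    (hp : x ∈ (trivializationAt F V p).baseSet) : (gramMatrix F V ρ p x).det ≠ 0 := by
  intro hdet
  obtain ⟨v, hv, hGv⟩ := Matrix.exists_mulVec_eq_zero_iff.mpr hdet
  have h1 : ∑ a ∈ ρ.finsupport x, ρ a x *
      ((transitionMatrix F V a p x).mulVec v ⬝ᵥ (transitionMatrix F V a p x).mulVec v) = 0 := by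
    have h2 := congrArg (fun u => v ⬝ᵥ u) hGv
    simp only [gramMatrix, Matrix.sum_mulVec, dotProduct_sum, dotProduct_zero, Matrix.smul_mulVec,
      dotProduct_smul, ← Matrix.mulVec_mulVec, smul_eq_mul] at h2
    rw [← h2]
    refine Finset.sum_congr rfl fun a _ => ?_
    rw [Matrix.dotProduct_mulVec v, Matrix.vecMul_transpose]
  obtain ⟨a, ha⟩ := ρ.exists_pos_of_mem (Set.mem_univ x)
  have h3 := (Finset.sum_eq_zero_iff_of_nonneg fun a _ =>
    mul_nonneg (ρ.nonneg a x) (Finset.sum_nonneg fun i _ => mul_self_nonneg _)).mp h1 a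
    (ρ.mem_finsupport x |>.mpr ha.ne')
  have h4 : (transitionMatrix F V a p x).mulVec v = 0 :=
    dotProduct_self_eq_zero.mp ((mul_eq_zero.mp h3).resolve_left ha.ne')
  have hxa : x ∈ (trivializationAt F V a).baseSet :=
    hρ a (subset_tsupport _ ha.ne')
  have h5 := congrArg (fun u => (transitionMatrix F V p a x).mulVec u) h4
  simp only [Matrix.mulVec_mulVec, transitionMatrix_mul_transitionMatrix hxa hp, Matrix.one_mulVec,
    Matrix.mulVec_zero] at h5
  exact hv h5

theorem contMDiffAt_gramMatrix [ContMDiffVectorBundle ∞ F V 𝓘(ℝ, E)]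
    (hρ : ρ.IsSubordinate fun a => (trivializationAt F V a).baseSet) {p x : M}
    (hp : x ∈ (trivializationAt F V p).baseSet) (i j : Fin (Module.finrank ℝ F)) :
    ContMDiffAt 𝓘(ℝ, E) 𝓘(ℝ, ℝ) ∞ (fun y => gramMatrix F V ρ p y i j) x := by
  have h1 : (fun y => gramMatrix F V ρ p y i j) = fun y => ∑ᶠ a, ρ a y •
      ((transitionMatrix F V a p y).transpose * transitionMatrix F V a p y) i j := by
    funext y
    rw [← ρ.sum_finsupport_smul_eq_finsum y fun a y =>
      ((transitionMatrix F V a p y).transpose * transitionMatrix F V a p y) i j]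
    simp [gramMatrix, Matrix.sum_apply]
  rw [h1]
  refine ρ.contMDiffAt_finsum fun a ha => ?_
  simp only [Matrix.mul_apply, Matrix.transpose_apply]
  exact ContMDiffAt.sum fun k _ => (contMDiffAt_transitionMatrix (hρ a ha) hp k i).mul
    (contMDiffAt_transitionMatrix (hρ a ha) hp k j)

end Metric

/-! ### The dual connection -/

section Dual

open Topology

variable {E : Type*} [NormedAddCommGroup E] [NormedSpace ℝ E] [FiniteDimensional ℝ E]
  {M : Type*} [TopologicalSpace M] [ChartedSpace E M] [IsManifold 𝓘(ℝ, E) ∞ M]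
  {F : Type*} [NormedAddCommGroup F] [NormedSpace ℝ F] [FiniteDimensional ℝ F]
  {V : M → Type*} [TopologicalSpace (TotalSpace F V)]
  [∀ x, AddCommGroup (V x)] [∀ x, Module ℝ (V x)] [∀ x, TopologicalSpace (V x)]
  [∀ x, IsTopologicalAddGroup (V x)] [∀ x, ContinuousSMul ℝ (V x)]
  [FiberBundle F V] [VectorBundle ℝ F V] [ContMDiffVectorBundle ∞ F V 𝓘(ℝ, E)]
  {ρ : SmoothPartitionOfUnity M 𝓘(ℝ, E) M}

variable (F V ρ) in
/-- The Gram matrix with complex entries. -/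
def complexGram (p x : M) : Matrix (Fin (Module.finrank ℝ F)) (Fin (Module.finrank ℝ F)) ℂ :=
  (gramMatrix F V ρ p x).map Complex.ofReal

variable (ρ) in
/-- The matrices `G⁻¹ (dG - ωᵀ G)` of the connection on `V ⊗ ℂ` that corresponds to the dual of a
given connection under the isomorphism of `V` with its dual given by the metric with Gram matrices
`G`. -/
def dualMatrix (D : ConnectionForms E F V) (p x : M) :
    Matrix (Fin (Module.finrank ℝ F)) (Fin (Module.finrank ℝ F))
      (TangentSpace 𝓘(ℝ, E) x →L[ℝ] ℂ) :=
  Matrix.of fun i j => ∑ k, (complexGram F V ρ p x)⁻¹ i k •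
    (mvfderiv 𝓘(ℝ, E) (fun y => complexGram F V ρ p y k j) x
      - ∑ l, complexGram F V ρ p x l j • D.toFun p x l k)

theorem contMDiffAt_complexGram (hρ : ρ.IsSubordinate fun a => (trivializationAt F V a).baseSet)
    {p x : M} (hp : x ∈ (trivializationAt F V p).baseSet) (i j : Fin (Module.finrank ℝ F)) :
    ContMDiffAt 𝓘(ℝ, E) 𝓘(ℝ, ℂ) ∞ (fun y => complexGram F V ρ p y i j) x :=
  Complex.ofRealCLM.contDiff.contMDiff.contMDiffAt.comp x (contMDiffAt_gramMatrix ρ hρ hp i j)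

theorem complexGram_det_ne_zero (hρ : ρ.IsSubordinate fun a => (trivializationAt F V a).baseSet)
    {p x : M} (hp : x ∈ (trivializationAt F V p).baseSet) :
    (complexGram F V ρ p x).det ≠ 0 := by
  have h : (complexGram F V ρ p x).det = ((gramMatrix F V ρ p x).det : ℂ) :=
    (RingHom.map_det Complex.ofRealHom _).symm
  rw [h]
  exact_mod_cast gramMatrix_det_ne_zero ρ hρ hp

theorem complexGram_change {p x : M} (hp : x ∈ (trivializationAt F V p).baseSet) (q : M) :
    complexGram F V ρ q x = ((transitionMatrix F V p q x).map Complex.ofReal).transpose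
      * complexGram F V ρ p x * (transitionMatrix F V p q x).map Complex.ofReal := by
  rw [complexGram, gramMatrix_change ρ hp q]
  exact (map_mul Complex.ofRealHom.mapMatrix _ _).trans
    (congrArg (· * _) (map_mul Complex.ofRealHom.mapMatrix _ _))

theorem matInChart_dualMatrix (hρ : ρ.IsSubordinate fun a => (trivializationAt F V a).baseSet)
    (D : ConnectionForms E F V) {p c : M} {z : E} (hz : z ∈ (chartAt E c).target)
    (hp : (chartAt E c).symm z ∈ (trivializationAt F V p).baseSet)
    (i j : Fin (Module.finrank ℝ F)) :
    matInChart c (dualMatrix ρ D p) z i j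
      = ∑ k, (complexGram F V ρ p ((chartAt E c).symm z))⁻¹ i k •
        (matDeriv (fun u => complexGram F V ρ p ((chartAt E c).symm u)) z k j
          - ∑ l, complexGram F V ρ p ((chartAt E c).symm z) l j •
            matInChart c (D.toFun p) z l k) := by
  have h1 : matInChart c (dualMatrix ρ D p) z i j
      = covectorPullback (chartSymmDeriv c z) (dualMatrix ρ D p ((chartAt E c).symm z) i j) := rfl
  rw [h1]
  simp only [dualMatrix, Matrix.of_apply, map_sum, map_smul, map_sub]
  refine Finset.sum_congr rfl fun k _ => ?_
  congr 2
  exact covectorInChart_mfderiv hz ((contMDiffAt_complexGram hρ hp k j).mdifferentiableAt (by simp))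

theorem contDiffAt_complexGram (hρ : ρ.IsSubordinate fun a => (trivializationAt F V a).baseSet)
    {p c : M} {z : E} (hz : z ∈ (chartAt E c).target)
    (hp : (chartAt E c).symm z ∈ (trivializationAt F V p).baseSet)
    (i j : Fin (Module.finrank ℝ F)) :
    ContDiffAt ℝ ∞ (fun u => complexGram F V ρ p ((chartAt E c).symm u) i j) z :=
  contDiffAt_comp_chartAt_symm hz (contMDiffAt_complexGram hρ hp i j)

/-- The gauge law relating a connection and its dual: the Gram matrix plays the role of the change
of frame. -/
theorem dualMatrix_gauge (hρ : ρ.IsSubordinate fun a => (trivializationAt F V a).baseSet)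
    (D : ConnectionForms E F V) {p c : M} {z : E} (hz : z ∈ (chartAt E c).target)
    (hp : (chartAt E c).symm z ∈ (trivializationAt F V p).baseSet) :
    constMatrix (complexGram F V ρ p ((chartAt E c).symm z))
        * ιMatrix (matInChart c (dualMatrix ρ D p) z)
      = ιMatrix (-(matInChart c (D.toFun p) z).transpose)
          * constMatrix (complexGram F V ρ p ((chartAt E c).symm z))
        + ιMatrix (matDeriv (fun u => complexGram F V ρ p ((chartAt E c).symm u)) z) := by
  set G := complexGram F V ρ p ((chartAt E c).symm z)
  set A := matInChart c (D.toFun p) z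
  set dG := matDeriv (fun u => complexGram F V ρ p ((chartAt E c).symm u)) z
  have hG : G * G⁻¹ = 1 :=
    Matrix.mul_nonsing_inv _ (isUnit_iff_ne_zero.mpr (complexGram_det_ne_zero hρ hp))
  have h1 : ιMatrix (matInChart c (dualMatrix ρ D p) z)
      = constMatrix G⁻¹ * (ιMatrix (-A.transpose) * constMatrix G + ιMatrix dG) := by
    ext i j
    simp only [ιMatrix, constMatrix, Matrix.map_apply, Matrix.mul_apply, Matrix.add_apply,
      Matrix.neg_apply, Matrix.transpose_apply]
    rw [matInChart_dualMatrix hρ D hz hp, map_sum]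
    refine Finset.sum_congr rfl fun k _ => ?_
    rw [map_smul, ← Algebra.smul_def, map_sub, map_sum, sub_eq_neg_add, ← Finset.sum_neg_distrib]
    congr 2
    refine Finset.sum_congr rfl fun l _ => ?_
    rw [map_smul, map_neg, ← Algebra.commutes, ← Algebra.smul_def, smul_neg]
  rw [h1, ← mul_assoc, ← constMatrix_mul, hG, constMatrix_one, one_mul]

theorem smooth_dualMatrix (hρ : ρ.IsSubordinate fun a => (trivializationAt F V a).baseSet)
    (D : ConnectionForms E F V) {p c : M} {z : E} (hz : z ∈ (chartAt E c).target)
    (hp : (chartAt E c).symm z ∈ (trivializationAt F V p).baseSet)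
    (i j : Fin (Module.finrank ℝ F)) :
    ContDiffAt ℝ ∞ (fun u => matInChart c (dualMatrix ρ D p) u i j) z := by
  have hG := contDiffAt_complexGram hρ hz hp
  have h : ContDiffAt ℝ ∞ (fun u => ∑ k, (complexGram F V ρ p ((chartAt E c).symm u))⁻¹ i k •
        (matDeriv (fun u => complexGram F V ρ p ((chartAt E c).symm u)) u k j
          - ∑ l, complexGram F V ρ p ((chartAt E c).symm u) l j •
            matInChart c (D.toFun p) u l k)) z := by
    refine ContDiffAt.sum fun k _ => ContDiffAt.smul
      (contDiffAt_matrix_inv hG (complexGram_det_ne_zero hρ hp) i k) (ContDiffAt.sub ?_ ?_)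
    · exact (hG k j).fderiv_right (by simp)
    · exact ContDiffAt.sum fun l _ => (hG l j).smul (D.smooth p c z hz hp l k)
  refine h.congr_of_eventuallyEq ?_
  filter_upwards [eventually_mem_baseSet hz hp] with u hu
  exact matInChart_dualMatrix hρ D hu.1 hu.2 i j

theorem ιMatrix_transpose_mul {W : Type*} [AddCommGroup W] [Module ℝ W] [TopologicalSpace W]
    {n : Type*} [Fintype n] (A : Matrix n n (W →L[ℝ] ℂ)) (g : Matrix n n ℂ) :
    (constMatrix g * ιMatrix A).transpose = ιMatrix A.transpose * constMatrix g.transpose := by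
  ext i j
  simp only [ιMatrix, constMatrix, Matrix.transpose_apply, Matrix.mul_apply, Matrix.map_apply]
  exact Finset.sum_congr rfl fun k _ => Algebra.commutes _ _

theorem transpose_ιMatrix_mul {W : Type*} [AddCommGroup W] [Module ℝ W] [TopologicalSpace W]
    {n : Type*} [Fintype n] (A : Matrix n n (W →L[ℝ] ℂ)) (g : Matrix n n ℂ) :
    (ιMatrix A * constMatrix g).transpose = constMatrix g.transpose * ιMatrix A.transpose := by
  ext i j
  simp only [ιMatrix, constMatrix, Matrix.transpose_apply, Matrix.mul_apply, Matrix.map_apply]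
  exact Finset.sum_congr rfl fun k _ => (Algebra.commutes _ _).symm

theorem ιMatrix_neg {W : Type*} [AddCommGroup W] [Module ℝ W] [TopologicalSpace W]
    {n : Type*} (A : Matrix n n (W →L[ℝ] ℂ)) : ιMatrix (-A) = -ιMatrix A :=
  Matrix.ext fun i j => map_neg (ExteriorAlgebra.ι ℂ) (A i j)

/-- The dual of a connection, transported by a metric to a connection on `V ⊗ ℂ`. -/
def ConnectionForms.dual (hρ : ρ.IsSubordinate fun a => (trivializationAt F V a).baseSet)
    (D : ConnectionForms E F V) : ConnectionForms E F V where
  toFun := dualMatrix ρ D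
  smooth p c z hz hp i j := smooth_dualMatrix hρ D hz hp i j
  gauge p q c z hz hp hq := by
    set x := (chartAt E c).symm z
    set g := (transitionMatrix F V p q x).map Complex.ofReal
    have hRp := dualMatrix_gauge hρ D hz hp
    have hRq := dualMatrix_gauge hρ D hz hq
    have hgauge := congrArg Matrix.transpose (D.gauge p q c z hz hp hq)
    rw [ιMatrix_transpose_mul, Matrix.transpose_add, transpose_ιMatrix_mul] at hgauge
    rw [ιMatrix_neg] at hRp hRq
    have hg := contDiffAt_transitionMatrix (E := E) hz hp hq
    have hG := contDiffAt_complexGram hρ hz hp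
    -- the product rule for the Gram matrix in the new frame
    have hdQ : ιMatrix (matDeriv (fun u => complexGram F V ρ q ((chartAt E c).symm u)) z)
        = ((ιMatrix (matDeriv (fun u =>
              (transitionMatrix F V p q ((chartAt E c).symm u)).map Complex.ofReal) z)).transpose
            * constMatrix (complexGram F V ρ p x)
          + constMatrix g.transpose
            * ιMatrix (matDeriv (fun u => complexGram F V ρ p ((chartAt E c).symm u)) z))
              * constMatrix g
          + constMatrix (g.transpose * complexGram F V ρ p x)
            * ιMatrix (matDeriv (fun u =>
              (transitionMatrix F V p q ((chartAt E c).symm u)).map Complex.ofReal) z) := by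
      have hgT : ∀ i j, ContDiffAt ℝ ∞ (fun u => ((transitionMatrix F V p q
          ((chartAt E c).symm u)).map Complex.ofReal).transpose i j) z := fun i j => hg j i
      have hgG : ∀ i j, ContDiffAt ℝ ∞ (fun u => (((transitionMatrix F V p q
          ((chartAt E c).symm u)).map Complex.ofReal).transpose
            * complexGram F V ρ p ((chartAt E c).symm u)) i j) z := fun i j => by
        simp only [Matrix.mul_apply]
        exact ContDiffAt.sum fun k _ => (hgT i k).mul (hG k j)
      have h1 := ιMatrix_matDeriv_mul hgG hg
      rw [ιMatrix_matDeriv_mul hgT hG] at h1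
      refine Eq.trans ?_ h1
      have h2 : matDeriv (fun u => complexGram F V ρ q ((chartAt E c).symm u)) z = matDeriv
          (fun u => ((transitionMatrix F V p q ((chartAt E c).symm u)).map
            Complex.ofReal).transpose * complexGram F V ρ p ((chartAt E c).symm u)
            * (transitionMatrix F V p q ((chartAt E c).symm u)).map Complex.ofReal) z := by
        ext1 i j
        refine Filter.EventuallyEq.fderiv_eq ?_
        filter_upwards [eventually_mem_baseSet hz hp] with u hu
        rw [complexGram_change hu.2 q]
      rw [h2]
    rw [hdQ, complexGram_change hp q, constMatrix_mul, constMatrix_mul] at hRq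
    -- the matrix `gᵀ G` is invertible
    have hunit : IsUnit (g.transpose * complexGram F V ρ p x).det := by
      rw [Matrix.det_mul, Matrix.det_transpose]
      refine IsUnit.mul ?_ (isUnit_iff_ne_zero.mpr (complexGram_det_ne_zero hρ hp))
      exact Matrix.isUnit_det_of_left_inverse (map_transitionMatrix_mul hp hq)
    have hinv : constMatrix (W := E) (g.transpose * complexGram F V ρ p x)⁻¹
        * (constMatrix g.transpose * constMatrix (complexGram F V ρ p x)) = 1 := by
      rw [← constMatrix_mul, ← constMatrix_mul, Matrix.nonsing_inv_mul _ hunit, constMatrix_one]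
    have hcancel : ∀ X Y : Matrix (Fin (Module.finrank ℝ F)) (Fin (Module.finrank ℝ F)) (CForm E),
        constMatrix g.transpose * constMatrix (complexGram F V ρ p x) * X
          = constMatrix g.transpose * constMatrix (complexGram F V ρ p x) * Y → X = Y := by
      intro X Y h
      have h' := congrArg (constMatrix (g.transpose * complexGram F V ρ p x)⁻¹ * ·) h
      simpa only [← mul_assoc _ _ X, ← mul_assoc _ _ Y, hinv, one_mul] using h'
    refine hcancel _ _ ?_
    set P := constMatrix (W := E) (complexGram F V ρ p x)
    set c₁ := constMatrix (W := E) g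
    set c₂ := constMatrix (W := E) g.transpose
    set d := ιMatrix (matDeriv (fun u =>
      (transitionMatrix F V p q ((chartAt E c).symm u)).map Complex.ofReal) z)
    set R := ιMatrix (matInChart c (dualMatrix ρ D p) z)
    set B := ιMatrix (matInChart c (D.toFun q) z).transpose
    have h3 : B * c₂ = c₂ * ιMatrix (matInChart c (D.toFun p) z).transpose + d.transpose := hgauge
    have h4 : -B * (c₂ * P * c₁)
        = -(c₂ * ιMatrix (matInChart c (D.toFun p) z).transpose + d.transpose) * P * c₁ := by
      rw [← h3]
      noncomm_ring
    have h5 : c₂ * P * (R * c₁ + d) = c₂ * (P * R) * c₁ + c₂ * P * d := by noncomm_ring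
    refine (mul_assoc _ _ _).symm.trans (hRq.trans (Eq.trans ?_ h5.symm))
    rw [h4, hRp]
    noncomm_ring

/-- The curvature of the dual connection is conjugate to `-Ωᵀ` by the Gram matrix. -/
theorem ConnectionForms.traceForm_dual
    (hρ : ρ.IsSubordinate fun a => (trivializationAt F V a).baseSet)
    (D : ConnectionForms E F V) (k : ℕ) : (D.dual hρ).traceForm k = (-1) ^ k * D.traceForm k := by
  have h : ∀ x, ((D.dual hρ).traceForm k).toMixed x = (-1) ^ k * (D.traceForm k).toMixed x := by
    intro x
    have hz := mem_chart_target E x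
    have hp := FiberBundle.mem_baseSet_trivializationAt' (F := F) (E := V)
      ((chartAt E x).symm (chartAt E x x))
    set p := (chartAt E x).symm (chartAt E x x)
    have h1 := _root_.flatCurv_gauge (y := chartAt E x x)
      (A := fun u => -(matInChart x (D.toFun p) u).transpose)
      (B := matInChart x (dualMatrix ρ D p))
      (g := fun u => complexGram F V ρ p ((chartAt E x).symm u))
      (fun i j => (D.smooth p x _ hz hp j i).neg) (smooth_dualMatrix hρ D hz hp)
      (contDiffAt_complexGram hρ hz hp) (by
        filter_upwards [eventually_mem_baseSet hz hp] with u hu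
        exact dualMatrix_gauge hρ D hu.1 hu.2)
    rw [flatCurv_neg_transpose _ (D.smooth p x _ hz hp)] at h1
    have h2 : (flatCurv (matInChart x (dualMatrix ρ D p)) (chartAt E x x) ^ k).trace
        = (-1) ^ k * (flatCurv (matInChart x (D.toFun p)) (chartAt E x x) ^ k).trace := by
      rw [← trace_neg_transpose_pow (isEvenMatrix_flatCurv _ _)]
      exact trace_eq_of_constMatrix_mul (Matrix.nonsing_inv_mul _
        (isUnit_iff_ne_zero.mpr (complexGram_det_ne_zero hρ hp))) (SemiconjBy.pow_right h1 k)
    have h3 := (D.dual hρ).chartRep_traceForm hz hp k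
    rw [← pullback_chartRep ((D.dual hρ).traceForm k).toMixed x, h3]
    refine (congrArg _ h2).trans ?_
    rw [map_mul, map_pow, map_neg, map_one, ← D.chartRep_traceForm hz hp k, pullback_chartRep]
  funext x
  refine evenVal_injective ((h x).trans ?_)
  simp only [Pi.mul_apply, Pi.pow_apply, Pi.neg_apply, Pi.one_apply]
  exact (((map_mul (evenVal (W := TangentSpace 𝓘(ℝ, E) x)) _ _).trans
    (by rw [map_pow, map_neg, map_one]; rfl))).symm

end Dual

/-! ### Flat connections given by trivializations -/

section FlatConnection

open Topology

variable {E : Type*} [NormedAddCommGroup E] [NormedSpace ℝ E] [FiniteDimensional ℝ E]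
  {M : Type*} [TopologicalSpace M] [ChartedSpace E M] [IsManifold 𝓘(ℝ, E) ∞ M]
  {G : Type*} [NormedAddCommGroup G] [NormedSpace ℝ G]
  {W : M → Type*} [TopologicalSpace (TotalSpace G W)]
  [∀ x, AddCommGroup (W x)] [∀ x, Module ℝ (W x)] [∀ x, TopologicalSpace (W x)]
  [∀ x, IsTopologicalAddGroup (W x)] [∀ x, ContinuousSMul ℝ (W x)]
  [FiberBundle G W] [VectorBundle ℝ G W]
  (e : Trivialization G (π G W)) [MemTrivializationAtlas e]

/-- The flat connection over the domain of a trivialization, which differentiates the components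
of a section. -/
def flatConnection (σ : ∀ x, W x) (x : M) : TangentSpace 𝓘(ℝ, E) x →L[ℝ] W x :=
  e.symmL ℝ x ∘L mvfderiv 𝓘(ℝ, E) (fun y => (e ⟨y, σ y⟩).2) x

theorem mvfderiv_congr {h h' : M → G} {x : M} (hh : h =ᶠ[𝓝 x] h') :
    mvfderiv 𝓘(ℝ, E) h x = mvfderiv 𝓘(ℝ, E) h' x := by
  have h1 : (mfderiv 𝓘(ℝ, E) 𝓘(ℝ, G) h x : E →L[ℝ] G)
      = (mfderiv 𝓘(ℝ, E) 𝓘(ℝ, G) h' x : E →L[ℝ] G) := hh.mfderiv_eq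
  exact h1

variable [ContMDiffVectorBundle ∞ G W 𝓘(ℝ, E)]

theorem isCovariantDerivativeOn_flatConnection :
    IsCovariantDerivativeOn (I := 𝓘(ℝ, E)) G (flatConnection (E := E) e) e.baseSet where
  add {σ σ' x} hσ hσ' hx := by
    have : ContMDiffVectorBundle 1 G W 𝓘(ℝ, E) := .of_le (n := ∞) (by simp)
    have h1 := (e.mdifferentiableAt_section_iff 𝓘(ℝ, E) σ hx).mp hσ
    have h2 := (e.mdifferentiableAt_section_iff 𝓘(ℝ, E) σ' hx).mp hσ'
    have h3 : (fun y => (e ⟨y, (σ + σ') y⟩).2) =ᶠ[𝓝 x]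
        fun y => (e ⟨y, σ y⟩).2 + (e ⟨y, σ' y⟩).2 := by
      filter_upwards [e.open_baseSet.mem_nhds hx] with y hy
      exact (e.linear ℝ hy).map_add _ _
    rw [flatConnection, mvfderiv_congr h3, mvfderiv_fun_add h1 h2, ContinuousLinearMap.comp_add]
    rfl
  leibniz {σ g x} hσ hg hx := by
    have : ContMDiffVectorBundle 1 G W 𝓘(ℝ, E) := .of_le (n := ∞) (by simp)
    have h1 := (e.mdifferentiableAt_section_iff 𝓘(ℝ, E) σ hx).mp hσ
    have h3 : (fun y => (e ⟨y, (g • σ) y⟩).2) =ᶠ[𝓝 x] fun y => g y • (e ⟨y, σ y⟩).2 := by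
      filter_upwards [e.open_baseSet.mem_nhds hx] with y hy
      exact (e.linear ℝ hy).map_smul _ _
    have h4 : e.symmL ℝ x (e ⟨x, σ x⟩).2 = σ x := by
      rw [Trivialization.symmL_apply _ hx]
      exact e.symm_proj_apply ⟨x, σ x⟩ hx
    rw [flatConnection, mvfderiv_congr h3, mvfderiv_fun_smul hg h1]
    ext v
    simp only [ContinuousLinearMap.comp_apply, add_apply,
      smul_apply, ContinuousLinearMap.smulRight_apply, map_add, map_smul, h4]
    rfl

theorem contMDiffAt_flatConnection {σ : ∀ x, W x} {x : M} (hx : x ∈ e.baseSet)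
    (hσ : ContMDiffAt 𝓘(ℝ, E) (𝓘(ℝ, E).prod 𝓘(ℝ, G)) ∞ (fun y => TotalSpace.mk' G y (σ y)) x) :
    ContMDiffAt 𝓘(ℝ, E) (𝓘(ℝ, E).prod 𝓘(ℝ, E →L[ℝ] G)) ∞ (fun y => (TotalSpace.mk' (E →L[ℝ] G) y
      (flatConnection (E := E) e σ y) :
        TotalSpace (E →L[ℝ] G) (fun y => TangentSpace 𝓘(ℝ, E) y →L[ℝ] W y))) x := by
  have h1 := (e.contMDiffAt_section_iff hx).mp hσ
  have h2 := h1.mfderiv_const (m := ∞) (by simp)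
  have h3 := ((contMDiffAt_hom_bundle _).mp
    (e.contMDiffAt_symmL (IB := 𝓘(ℝ, E)) (n := ∞) hx)).2
  refine (contMDiffAt_hom_bundle _).mpr ⟨contMDiffAt_id, (h3.clm_comp h2).congr_of_eventuallyEq ?_⟩
  filter_upwards with y
  ext v
  simp [inTangentCoordinates, ContinuousLinearMap.inCoordinates, flatConnection, mvfderiv]
  rfl

end FlatConnection

/-! ### Existence of connections -/

section Existence

open Topology

variable {E : Type*} [NormedAddCommGroup E] [NormedSpace ℝ E] [FiniteDimensional ℝ E]
  {M : Type*} [TopologicalSpace M] [ChartedSpace E M] [IsManifold 𝓘(ℝ, E) ∞ M]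
  {F : Type*} [NormedAddCommGroup F] [NormedSpace ℝ F] [FiniteDimensional ℝ F]
  {V : M → Type*} [TopologicalSpace (TotalSpace F V)]
  [∀ x, AddCommGroup (V x)] [∀ x, Module ℝ (V x)] [∀ x, TopologicalSpace (V x)]
  [∀ x, IsTopologicalAddGroup (V x)] [∀ x, ContinuousSMul ℝ (V x)]
  [FiberBundle F V] [VectorBundle ℝ F V]

variable (F V) in
/-- The trivialization of `V ⊕ V` given by the preferred trivialization of `V` at `p`. -/
abbrev prodTrivialization (p : M) : Trivialization (F × F) (π (F × F) (V ×ᵇ V)) :=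
  (trivializationAt F V p).prod (trivializationAt F V p)

variable [ContMDiffVectorBundle ∞ F V 𝓘(ℝ, E)]

theorem mem_prodTrivialization_baseSet {p x : M} :
    x ∈ (prodTrivialization F V p).baseSet ↔ x ∈ (trivializationAt F V p).baseSet :=
  and_self_iff

/-- The flat connection given by a trivialization of `V` is complex linear. -/
theorem flatConnection_prodTrivialization_I {p x : M}
    (hx : x ∈ (trivializationAt F V p).baseSet) {σ : ∀ x, (V ×ᵇ V) x}
    (hσ : MDifferentiableAt 𝓘(ℝ, E) (𝓘(ℝ, E).prod 𝓘(ℝ, F × F))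
      (fun y => (⟨y, σ y⟩ : TotalSpace (F × F) (V ×ᵇ V))) x) (v : TangentSpace 𝓘(ℝ, E) x) :
    flatConnection (E := E) (prodTrivialization F V p) (fun y => (-(σ y).2, (σ y).1)) x v
      = (-(flatConnection (E := E) (prodTrivialization F V p) σ x v).2,
          (flatConnection (E := E) (prodTrivialization F V p) σ x v).1) := by
  have : ContMDiffVectorBundle 1 F V 𝓘(ℝ, E) := .of_le (n := ∞) (by simp)
  have hx' := mem_prodTrivialization_baseSet.mpr hx
  have h1 := ((prodTrivialization F V p).mdifferentiableAt_section_iff 𝓘(ℝ, E) σ hx').mp hσ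
  let J : F × F →L[ℝ] F × F :=
    (-ContinuousLinearMap.snd ℝ F F).prod (ContinuousLinearMap.fst ℝ F F)
  have h3 : (fun y => (prodTrivialization F V p ⟨y, (-(σ y).2, (σ y).1)⟩).2) =ᶠ[𝓝 x]
      fun y => J (prodTrivialization F V p ⟨y, σ y⟩).2 := by
    filter_upwards [(trivializationAt F V p).open_baseSet.mem_nhds hx] with y hy
    refine Prod.ext ?_ rfl
    exact ((trivializationAt F V p).linear ℝ hy).map_neg _
  have h4 : mvfderiv 𝓘(ℝ, E) (fun y => J (prodTrivialization F V p ⟨y, σ y⟩).2) x v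
      = J (mvfderiv 𝓘(ℝ, E) (fun y => (prodTrivialization F V p ⟨y, σ y⟩).2) x v) := by
    have h5 := mfderiv_comp x (J.mdifferentiableAt) h1
    rw [ContinuousLinearMap.mfderiv_eq] at h5
    exact DFunLike.congr_fun h5 v
  have hs : ∀ w : F × F, (prodTrivialization F V p).symmL ℝ x w
      = ((trivializationAt F V p).symmL ℝ x w.1, (trivializationAt F V p).symmL ℝ x w.2) := by
    intro w
    rw [Trivialization.symmL_apply _ hx', Trivialization.symmL_apply _ hx,
      Trivialization.symmL_apply _ hx]
    have h6 : (prodTrivialization F V p ⟨x, ((trivializationAt F V p).symm x w.1,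
        (trivializationAt F V p).symm x w.2)⟩).2 = w := by
      have h7 := fun u => congrArg Prod.snd ((trivializationAt F V p).apply_mk_symm hx u)
      exact Prod.ext (h7 w.1) (h7 w.2)
    exact (congrArg ((prodTrivialization F V p).symm x) h6.symm).trans
      ((prodTrivialization F V p).symm_proj_apply ⟨x, _⟩ hx')
  simp only [flatConnection, ContinuousLinearMap.comp_apply, mvfderiv_congr h3]
  rw [h4, hs, hs]
  refine Prod.ext ?_ rfl
  exact map_neg _ _

variable (ρ : SmoothPartitionOfUnity M 𝓘(ℝ, E) M)

variable (F V) in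
/-- The flat connections given by the trivializations of `V`, glued by a partition of unity. -/
def gluedConnection (σ : ∀ x, (V ×ᵇ V) x) (x : M) : TangentSpace 𝓘(ℝ, E) x →L[ℝ] (V ×ᵇ V) x :=
  ∑ᶠ a, ρ a x • flatConnection (E := E) (prodTrivialization F V a) σ x

theorem gluedConnection_eq_sum (σ : ∀ x, (V ×ᵇ V) x) (x : M) :
    gluedConnection F V ρ σ x
      = ∑ a ∈ ρ.finsupport x, ρ a x • flatConnection (E := E) (prodTrivialization F V a) σ x := by
  refine finsum_eq_sum_of_support_subset _ fun a ha => ?_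
  rw [ρ.coe_finsupport]
  exact fun h => ha (by simp [h])

variable {ρ}

theorem mem_baseSet_of_mem_finsupport
    (hρ : ρ.IsSubordinate fun a => (trivializationAt F V a).baseSet) {a x : M}
    (ha : a ∈ ρ.finsupport x) : x ∈ (trivializationAt F V a).baseSet :=
  hρ a (subset_tsupport _ ((ρ.mem_finsupport x).mp ha))

theorem isCovariantDerivativeOn_gluedConnection
    (hρ : ρ.IsSubordinate fun a => (trivializationAt F V a).baseSet) :
    IsCovariantDerivativeOn (I := 𝓘(ℝ, E)) (F × F) (gluedConnection F V ρ) where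
  add {σ σ' x} hσ hσ' _ := by
    simp only [gluedConnection_eq_sum, ← Finset.sum_add_distrib]
    refine Finset.sum_congr rfl fun a ha => ?_
    rw [(isCovariantDerivativeOn_flatConnection _).add hσ hσ'
      (mem_prodTrivialization_baseSet.mpr (mem_baseSet_of_mem_finsupport hρ ha)), smul_add]
  leibniz {σ g x} hσ hg _ := by
    have h1 : ∀ a ∈ ρ.finsupport x,
        ρ a x • flatConnection (E := E) (prodTrivialization F V a) (g • σ) x
          = g x • ρ a x • flatConnection (E := E) (prodTrivialization F V a) σ x
            + ρ a x • (mvfderiv 𝓘(ℝ, E) g x).smulRight (σ x) := by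
      intro a ha
      rw [(isCovariantDerivativeOn_flatConnection _).leibniz hσ hg
        (mem_prodTrivialization_baseSet.mpr (mem_baseSet_of_mem_finsupport hρ ha)), smul_add,
        smul_comm]
    simp only [gluedConnection_eq_sum]
    rw [Finset.sum_congr rfl h1, Finset.sum_add_distrib, ← Finset.smul_sum, ← Finset.sum_smul,
      ρ.sum_finsupport x (Set.mem_univ x), one_smul]

theorem contMDiff_gluedConnection
    (hρ : ρ.IsSubordinate fun a => (trivializationAt F V a).baseSet) {σ : ∀ x, (V ×ᵇ V) x}
    (hσ : ContMDiff 𝓘(ℝ, E) (𝓘(ℝ, E).prod 𝓘(ℝ, F × F)) ∞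
      (fun y => TotalSpace.mk' (F × F) y (σ y))) :
    ContMDiff 𝓘(ℝ, E) (𝓘(ℝ, E).prod 𝓘(ℝ, E →L[ℝ] F × F)) ∞
      (fun y => (TotalSpace.mk' (E →L[ℝ] F × F) y (gluedConnection F V ρ σ y) :
        TotalSpace (E →L[ℝ] F × F) (fun y => TangentSpace 𝓘(ℝ, E) y →L[ℝ] (V ×ᵇ V) y))) := by
  refine ContMDiff.finsum_section_of_locallyFinite (V := fun y =>
    TangentSpace 𝓘(ℝ, E) y →L[ℝ] (V ×ᵇ V) y) (t := fun a y =>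
      ρ a y • flatConnection (E := E) (prodTrivialization F V a) σ y) ?_ fun a => ?_
  · refine ρ.locallyFinite.subset fun a y hy h => hy ?_
    simp [h]
  · refine ContMDiffOn.smul_section_of_tsupport (V := fun y =>
      TangentSpace 𝓘(ℝ, E) y →L[ℝ] (V ×ᵇ V) y) (ρ a).contMDiff.contMDiffOn
      (trivializationAt F V a).open_baseSet (hρ a) fun y hy => ?_
    exact (contMDiffAt_flatConnection _ (mem_prodTrivialization_baseSet.mpr hy)
      (hσ y)).contMDiffWithinAt

/-- A partition of unity gives a connection on `V ⊗ ℂ`. -/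
theorem nonempty_complexifiedConnection
    (hρ : ρ.IsSubordinate fun a => (trivializationAt F V a).baseSet) :
    Nonempty (ComplexifiedConnection E F V) := by
  refine ⟨{ toFun := gluedConnection F V ρ
            isCovariantDerivativeOnUniv := isCovariantDerivativeOn_gluedConnection hρ
            smooth := ⟨⟨fun {σ} hσ => ?_⟩⟩
            map_I := fun σ x hσ v => ?_ }⟩
  · refine (contMDiff_gluedConnection hρ ?_).contMDiffOn
    exact (contMDiffOn_univ.mp hσ).of_le (by simp)
  · have h1 : gluedConnection F V ρ (fun y => (-(σ y).2, (σ y).1)) x v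
        = ∑ a ∈ ρ.finsupport x, (-(ρ a x • flatConnection (E := E) (prodTrivialization F V a)
            σ x v).2, (ρ a x • flatConnection (E := E) (prodTrivialization F V a) σ x v).1) := by
      rw [gluedConnection_eq_sum, sum_apply]
      refine Finset.sum_congr rfl fun a ha => ?_
      refine (congrArg (ρ a x • ·) (flatConnection_prodTrivialization_I
        (mem_baseSet_of_mem_finsupport hρ ha) hσ v)).trans (Prod.ext ?_ rfl)
      exact smul_neg _ _
    refine h1.trans ?_
    rw [gluedConnection_eq_sum, sum_apply]
    refine Prod.ext ?_ ?_
    · rw [Prod.fst_sum, Prod.snd_sum, ← Finset.sum_neg_distrib]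
      rfl
    · rw [Prod.fst_sum, Prod.snd_sum]
      rfl

variable (E F V) in
theorem exists_isSubordinate_baseSet [T2Space M] [SecondCountableTopology M] :
    ∃ ρ : SmoothPartitionOfUnity M 𝓘(ℝ, E) M,
      ρ.IsSubordinate fun a => (trivializationAt F V a).baseSet := by
  have := Manifold.locallyCompact_of_finiteDimensional (M := M) 𝓘(ℝ, E)
  exact SmoothPartitionOfUnity.exists_isSubordinate 𝓘(ℝ, E) isClosed_univ _
    (fun a => (trivializationAt F V a).open_baseSet) fun x _ =>
      Set.mem_iUnion.mpr ⟨x, FiberBundle.mem_baseSet_trivializationAt' x⟩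

end Existence

/-! ### The connection forms of a connection on `V ⊗ ℂ` -/

section ConnectionMatrix

open Topology

variable {E : Type*} [NormedAddCommGroup E] [NormedSpace ℝ E] [FiniteDimensional ℝ E]
  {M : Type*} [TopologicalSpace M] [ChartedSpace E M] [IsManifold 𝓘(ℝ, E) ∞ M]
  {F : Type*} [NormedAddCommGroup F] [NormedSpace ℝ F] [FiniteDimensional ℝ F]
  {V : M → Type*} [TopologicalSpace (TotalSpace F V)]
  [∀ x, AddCommGroup (V x)] [∀ x, Module ℝ (V x)] [∀ x, TopologicalSpace (V x)]
  [∀ x, IsTopologicalAddGroup (V x)] [∀ x, ContinuousSMul ℝ (V x)]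
  [FiberBundle F V] [VectorBundle ℝ F V]

open ComplexifiedConnection

variable (F V) in
/-- The `j`-th complex coordinate, in the frame given by the preferred trivialization at `p`, of a
vector `u + i v` of `V ⊗ ℂ`. -/
def complexCoord (p : M) (j : Fin (Module.finrank ℝ F)) (x : M) : (V ×ᵇ V) x →L[ℝ] ℂ :=
  Complex.ofRealCLM ∘L frameCoord (F := F) p j x ∘L ContinuousLinearMap.fst ℝ (V x) (V x)
    + Complex.I • (Complex.ofRealCLM ∘L frameCoord (F := F) p j x ∘L
        ContinuousLinearMap.snd ℝ (V x) (V x))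

theorem complexCoord_apply (p : M) (j : Fin (Module.finrank ℝ F)) (x : M) (w : (V ×ᵇ V) x) :
    complexCoord F V p j x w = (frameCoord (F := F) p j x w.1 : ℂ)
      + Complex.I * (frameCoord (F := F) p j x w.2 : ℂ) := rfl

theorem complexCoord_eq_sum {p q x : M} (hq : x ∈ (trivializationAt F V q).baseSet)
    (j : Fin (Module.finrank ℝ F)) (w : (V ×ᵇ V) x) :
    complexCoord F V p j x w
      = ∑ k, (transitionMatrix F V p q x j k : ℂ) * complexCoord F V q k x w := by
  have h : ∀ v : V x, frameCoord (F := F) p j x v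
      = ∑ k, transitionMatrix F V p q x j k * frameCoord (F := F) q k x v := by
    intro v
    conv_lhs => rw [← sum_frameCoord_smul hq v, map_sum]
    refine Finset.sum_congr rfl fun k _ => ?_
    rw [map_smul, smul_eq_mul, mul_comm]
    rfl
  simp only [complexCoord_apply, h, Complex.ofReal_sum, Complex.ofReal_mul, Finset.mul_sum,
    ← Finset.sum_add_distrib]
  refine Finset.sum_congr rfl fun k _ => ?_
  ring

theorem complexCoord_frame {p x : M} (hp : x ∈ (trivializationAt F V p).baseSet)
    (j i : Fin (Module.finrank ℝ F)) :
    complexCoord F V p j x (frame p i x) = (1 : Matrix _ _ ℂ) j i := by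
  have h : frameCoord (F := F) (V := V) p j x ((trivializationAt F V p).symmL ℝ x
      (Module.finBasis ℝ F i)) = (1 : Matrix _ _ ℝ) j i :=
    congrFun (congrFun (transitionMatrix_self hp) j) i
  rw [complexCoord_apply]
  simp only [frame, map_zero, Complex.ofReal_zero, mul_zero, add_zero, h]
  simp only [Matrix.one_apply]
  split_ifs <;> simp

variable [ContMDiffVectorBundle ∞ F V 𝓘(ℝ, E)]

theorem contMDiffAt_frame {p x : M} (hp : x ∈ (trivializationAt F V p).baseSet)
    (i : Fin (Module.finrank ℝ F)) :
    ContMDiffAt 𝓘(ℝ, E) (𝓘(ℝ, E).prod 𝓘(ℝ, F × F)) ∞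
      (fun y => TotalSpace.mk' (F × F) (E := V ×ᵇ V) y (frame p i y)) x := by
  refine ((prodTrivialization F V p).contMDiffAt_section_iff
    (mem_prodTrivialization_baseSet.mpr hp)).mpr ?_
  refine (contMDiffAt_const (c := (Module.finBasis ℝ F i, (0 : F)))).congr_of_eventuallyEq ?_
  filter_upwards [(trivializationAt F V p).open_baseSet.mem_nhds hp] with y hy
  refine Prod.ext ?_ ?_
  · have := congrArg Prod.snd
      ((trivializationAt F V p).apply_mk_symm hy (Module.finBasis ℝ F i))
    rw [← Trivialization.symmL_apply (R := ℝ) _ hy] at this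
    exact this
  · exact ((trivializationAt F V p).linear ℝ hy).map_zero

/-- A frame agrees near each point of its domain with globally defined smooth sections. -/
theorem exists_contMDiff_eventuallyEq_frame [T2Space M] {p x : M}
    (hp : x ∈ (trivializationAt F V p).baseSet) (i : Fin (Module.finrank ℝ F)) :
    ∃ σ : ∀ x, (V ×ᵇ V) x, ContMDiff 𝓘(ℝ, E) (𝓘(ℝ, E).prod 𝓘(ℝ, F × F)) ∞
      (fun y => TotalSpace.mk' (F × F) (E := V ×ᵇ V) y (σ y)) ∧ ∀ᶠ y in 𝓝 x, σ y = frame p i y := by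
  obtain ⟨ψ, -, hψ⟩ := (SmoothBumpFunction.nhds_basis_tsupport (I := 𝓘(ℝ, E)) x).mem_iff.mp
    ((trivializationAt F V p).open_baseSet.mem_nhds hp)
  refine ⟨(ψ : M → ℝ) • frame (F := F) (V := V) p i, ?_, ?_⟩
  · exact ContMDiffOn.smul_section_of_tsupport (V := V ×ᵇ V) ψ.contMDiff.contMDiffOn
      (trivializationAt F V p).open_baseSet hψ
      fun y hy => (contMDiffAt_frame (F := F) (V := V) hy i).contMDiffWithinAt
  · filter_upwards [ψ.eventuallyEq_one] with y hy
    exact (congrArg (· • frame (F := F) (V := V) p i y) hy).trans (one_smul ℝ _)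

/-- The covariant derivatives of a frame are smooth. -/
theorem contMDiffAt_cov_frame [T2Space M] (cov : ComplexifiedConnection E F V) {p x : M}
    (hp : x ∈ (trivializationAt F V p).baseSet) (i : Fin (Module.finrank ℝ F)) :
    ContMDiffAt 𝓘(ℝ, E) (𝓘(ℝ, E).prod 𝓘(ℝ, E →L[ℝ] F × F)) ∞
      (fun y => (TotalSpace.mk' (E →L[ℝ] F × F) y (cov.toFun (frame p i) y) :
        TotalSpace (E →L[ℝ] F × F) (fun y => TangentSpace 𝓘(ℝ, E) y →L[ℝ] (V ×ᵇ V) y))) x := by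
  obtain ⟨σ, hσ, h⟩ := exists_contMDiff_eventuallyEq_frame (E := E) hp i
  have h1 := cov.smooth.contMDiff.contMDiff (σ := σ)
    ((contMDiffOn_univ.mpr hσ).of_le (by simp))
  refine ((contMDiffOn_univ.mp h1) x).congr_of_eventuallyEq ?_
  filter_upwards [h.eventually_nhds,
    (trivializationAt F V p).open_baseSet.mem_nhds hp] with y hy hp'
  have h2 := cov.isCovariantDerivativeOnUniv.congr_of_eventuallyEq
    ((hσ y).mdifferentiableAt (by simp)) ((contMDiffAt_frame hp' i).mdifferentiableAt (by simp))
    Filter.univ_mem hy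
  exact congrArg _ h2.symm

/-- Coordinates of smooth sections, over a smooth map to `M`, are smooth. -/
theorem contDiffAt_complexCoord {b : E → M} {s : ∀ u, (V ×ᵇ V) (b u)} {z : E} {p : M}
    (hp : b z ∈ (trivializationAt F V p).baseSet)
    (hs : ContMDiffAt 𝓘(ℝ, E) (𝓘(ℝ, E).prod 𝓘(ℝ, F × F)) ∞
      (fun u => TotalSpace.mk' (F × F) (E := V ×ᵇ V) (b u) (s u)) z)
    (j : Fin (Module.finrank ℝ F)) :
    ContDiffAt ℝ ∞ (fun u => complexCoord F V p j (b u) (s u)) z := by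
  have hmem : TotalSpace.mk' (F × F) (E := V ×ᵇ V) (b z) (s z)
      ∈ (prodTrivialization F V p).source :=
    (prodTrivialization F V p).mem_source.mpr (mem_prodTrivialization_baseSet.mpr hp)
  obtain ⟨h1, h2⟩ := ((prodTrivialization F V p).contMDiffAt_iff
    (f := fun u => TotalSpace.mk' (F × F) (E := V ×ᵇ V) (b u) (s u)) hmem).mp hs
  let c : F →L[ℝ] ℂ :=
    Complex.ofRealCLM ∘L ((Module.finBasis ℝ F).coord j).toContinuousLinearMap
  have h3 : ContDiffAt ℝ ∞ (fun u =>
      (c ∘L ContinuousLinearMap.fst ℝ F F + Complex.I • (c ∘L ContinuousLinearMap.snd ℝ F F))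
        (prodTrivialization F V p ⟨b u, s u⟩).2) z :=
    (ContinuousLinearMap.contDiff _).contDiffAt.comp z h2.contDiffAt
  refine h3.congr_of_eventuallyEq ?_
  filter_upwards [h1.continuousAt.eventually
    ((trivializationAt F V p).open_baseSet.mem_nhds hp)] with u hu
  have h4 : ∀ v : V (b u), (trivializationAt F V p).continuousLinearMapAt ℝ (b u) v
      = (trivializationAt F V p ⟨b u, v⟩).2 := by
    intro v
    rw [Trivialization.continuousLinearMapAt_apply, Trivialization.linearMapAt_apply]
    exact if_pos hu
  have h5 : ∀ v : V (b u), (frameCoord (F := F) p j (b u) v : ℂ)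
      = c (trivializationAt F V p ⟨b u, v⟩).2 := fun v => congrArg c (h4 v)
  rw [complexCoord_apply, h5, h5]
  rfl

/-- The derivative of the inverse of a chart, applied to a fixed vector, is a smooth vector field
along this inverse. -/
theorem contMDiffAt_chartSymmDeriv {c : M} {z : E} (hz : z ∈ (chartAt E c).target) (w : E) :
    ContMDiffAt 𝓘(ℝ, E) (𝓘(ℝ, E).prod 𝓘(ℝ, E)) ∞ (fun u =>
      TotalSpace.mk' E (E := fun y : M => TangentSpace 𝓘(ℝ, E) y) ((chartAt E c).symm u)
        (chartSymmDeriv c u w)) z := by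
  have h1 := contMDiffAt_chartAt_symm (E := E) hz
  have h2 := h1.mfderiv_const (m := ∞) (by simp)
  have h3 : ContMDiffAt 𝓘(ℝ, E) (𝓘(ℝ, E).prod 𝓘(ℝ, E)) ∞ (fun u =>
      TotalSpace.mk' E (E := fun y : E => TangentSpace 𝓘(ℝ, E) y) u w) z := by
    refine contMDiffAt_totalSpace.mpr ⟨contMDiffAt_id, ?_⟩
    refine (contMDiffAt_const (c := w)).congr_of_eventuallyEq ?_
    filter_upwards with u
    simp
  exact ContMDiffAt.clm_apply_of_inCoordinates (b₁ := id) h2 h3 h1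

theorem contDiffAt_connectionMatrix [T2Space M] (cov : ComplexifiedConnection E F V) {p c : M}
    {z : E} (hz : z ∈ (chartAt E c).target)
    (hp : (chartAt E c).symm z ∈ (trivializationAt F V p).baseSet)
    (j i : Fin (Module.finrank ℝ F)) :
    ContDiffAt ℝ ∞ (fun u => matInChart c (cov.connectionMatrix p) u j i) z := by
  have h1 : ∀ w : E, ContDiffAt ℝ ∞
      (fun u => matInChart c (cov.connectionMatrix p) u j i w) z := by
    intro w
    have h2 := (contMDiffAt_cov_frame cov hp i).comp z (contMDiffAt_chartAt_symm hz)
    have h3 := ContMDiffAt.clm_bundle_apply (F₂ := F × F) (E₂ := V ×ᵇ V)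
      (b := (chartAt E c).symm)
      (ϕ := fun u => cov.toFun (frame p i) ((chartAt E c).symm u)) h2
      (contMDiffAt_chartSymmDeriv hz w)
    exact contDiffAt_complexCoord hp h3 j
  let b := Module.finBasis ℝ E
  have h2 : (fun u => matInChart c (cov.connectionMatrix p) u j i) = fun u =>
      ∑ k, (b.coord k).toContinuousLinearMap.smulRight
        (matInChart c (cov.connectionMatrix p) u j i (b k)) := by
    funext u
    ext w
    conv_lhs => rw [← b.sum_repr w, map_sum]
    simp [sum_apply]
  rw [h2]
  exact ContDiffAt.sum fun k _ => contDiffAt_const.smulRight (h1 (b k))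

/-- The gauge law `g ω_q = ω_p g + dg`, obtained by expanding a vector of the frame at `q` in the
frame at `p` and applying the Leibniz rule. -/
theorem connectionMatrix_gauge (cov : ComplexifiedConnection E F V) {p q x : M}
    (hp : x ∈ (trivializationAt F V p).baseSet) (hq : x ∈ (trivializationAt F V q).baseSet)
    (j i : Fin (Module.finrank ℝ F)) :
    ∑ k, (transitionMatrix F V p q x j k : ℂ) • cov.connectionMatrix q x k i
      = ∑ k, (transitionMatrix F V p q x k i : ℂ) • cov.connectionMatrix p x j k
        + mvfderiv 𝓘(ℝ, E) (fun y => (transitionMatrix F V p q y j i : ℂ)) x := by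
  have hfr : ∀ k, MDifferentiableAt 𝓘(ℝ, E) (𝓘(ℝ, E).prod 𝓘(ℝ, F × F))
      (fun y => TotalSpace.mk' (F × F) (E := V ×ᵇ V) y (frame p k y)) x := fun k =>
    (contMDiffAt_frame hp k).mdifferentiableAt (by simp)
  have hg : ∀ k, MDifferentiableAt 𝓘(ℝ, E) 𝓘(ℝ, ℝ) (fun y => transitionMatrix F V p q y k i) x :=
    fun k => (contMDiffAt_transitionMatrix hp hq k i).mdifferentiableAt (by simp)
  have hcov := cov.isCovariantDerivativeOnUniv
  have h0 : ∀ s : Finset (Fin (Module.finrank ℝ F)),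
      MDifferentiableAt 𝓘(ℝ, E) (𝓘(ℝ, E).prod 𝓘(ℝ, F × F))
        (fun y => TotalSpace.mk' (F × F) (E := V ×ᵇ V) y
          ((∑ k ∈ s, (fun y => transitionMatrix F V p q y k i) • frame p k) y)) x ∧
      cov.toFun (∑ k ∈ s, (fun y => transitionMatrix F V p q y k i) • frame p k) x
        = ∑ k ∈ s, (transitionMatrix F V p q x k i • cov.toFun (frame p k) x
          + (mvfderiv 𝓘(ℝ, E) (fun y => transitionMatrix F V p q y k i) x).smulRight
              (frame p k x)) := by
    intro s
    induction s using Finset.induction_on with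
    | empty =>
      simp only [Finset.sum_empty]
      exact ⟨mdifferentiableAt_zeroSection .., hcov.zero⟩
    | insert a s ha ih =>
      have h := (hg a).smul_section (hfr a)
      rw [Finset.sum_insert ha, Finset.sum_insert ha]
      exact ⟨mdifferentiableAt_add_section h ih.1,
        (hcov.add h ih.1).trans (congrArg₂ _ (hcov.leibniz (hfr a) (hg a)) ih.2)⟩
  obtain ⟨hd, h1⟩ := h0 Finset.univ
  have h2 : cov.toFun (frame q i) x = _ := (hcov.congr_of_eventuallyEq
    ((contMDiffAt_frame hq i).mdifferentiableAt (by simp)) hd Filter.univ_mem (by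
      filter_upwards [(trivializationAt F V p).open_baseSet.mem_nhds hp] with y hy
      rw [Finset.sum_apply]
      refine Prod.ext ?_ ?_
      · rw [Prod.fst_sum]
        exact symmL_eq_sum_transitionMatrix hy q i
      · rw [Prod.snd_sum]
        refine (Finset.sum_eq_zero fun k _ => ?_).symm
        exact smul_zero _)).trans h1
  have h3 : mvfderiv 𝓘(ℝ, E) (fun y => (transitionMatrix F V p q y j i : ℂ)) x
      = Complex.ofRealCLM ∘L mvfderiv 𝓘(ℝ, E) (fun y => transitionMatrix F V p q y j i) x := by
    have h5 := mfderiv_comp x Complex.ofRealCLM.mdifferentiableAt (hg j)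
    rw [ContinuousLinearMap.mfderiv_eq] at h5
    exact h5
  ext v
  have h4 : (∑ k, (transitionMatrix F V p q x j k : ℂ) • cov.connectionMatrix q x k i) v
      = complexCoord F V p j x (cov.toFun (frame q i) x v) := by
    rw [complexCoord_eq_sum hq, sum_apply]
    rfl
  rw [h4, h2, h3, sum_apply, map_sum]
  have h5 : ∀ k, complexCoord F V p j x ((transitionMatrix F V p q x k i • cov.toFun (frame p k) x
          + (mvfderiv 𝓘(ℝ, E) (fun y => transitionMatrix F V p q y k i) x).smulRight
              (frame p k x) : TangentSpace 𝓘(ℝ, E) x →L[ℝ] (V ×ᵇ V) x) v)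
      = (transitionMatrix F V p q x k i : ℂ) * cov.connectionMatrix p x j k v
        + (mvfderiv 𝓘(ℝ, E) (fun y => transitionMatrix F V p q y k i) x v : ℂ)
          * (1 : Matrix _ _ ℂ) j k := by
    intro k
    rw [← complexCoord_frame hp j k, add_apply, map_add, smul_apply, map_smul,
      ContinuousLinearMap.smulRight_apply, map_smul, Complex.real_smul, Complex.real_smul]
    rfl
  rw [Finset.sum_congr rfl fun k _ => h5 k, Finset.sum_add_distrib]
  simp [Matrix.one_apply]

/-- The connection forms of a connection on `V ⊗ ℂ`. -/
def ComplexifiedConnection.connectionForms [T2Space M] (cov : ComplexifiedConnection E F V) :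
    ConnectionForms E F V where
  toFun := cov.connectionMatrix
  smooth _ _ _ hz hp i j := contDiffAt_connectionMatrix cov hz hp i j
  gauge p q c z hz hp hq := by
    have h1 : ∀ j i, ∑ k, (transitionMatrix F V p q ((chartAt E c).symm z) j k : ℂ) •
          matInChart c (cov.connectionMatrix q) z k i
        = ∑ k, (transitionMatrix F V p q ((chartAt E c).symm z) k i : ℂ) •
            matInChart c (cov.connectionMatrix p) z j k
          + matDeriv (fun u => (transitionMatrix F V p q ((chartAt E c).symm u)).map
              Complex.ofReal) z j i := by
      intro j i
      have h2 := congrArg (covectorPullback (chartSymmDeriv c z))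
        (connectionMatrix_gauge cov hp hq j i)
      rw [map_add, map_sum, map_sum] at h2
      simp only [map_smul] at h2
      refine h2.trans (congrArg _ ?_)
      exact covectorInChart_mfderiv hz (Complex.ofRealCLM.mdifferentiableAt.comp _
        ((contMDiffAt_transitionMatrix hp hq j i).mdifferentiableAt (by simp)))
    ext j i
    have h3 := congrArg (ExteriorAlgebra.ι ℂ) (h1 j i)
    rw [map_add, map_sum, map_sum] at h3
    simp only [ιMatrix, constMatrix, Matrix.map_apply, Matrix.mul_apply, Matrix.add_apply]
    simpa only [map_smul, Algebra.smul_def, Algebra.commutes] using h3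

end ConnectionMatrix

/-! ### Nilpotency of the curvature -/

section Nilpotency

open Finset

variable {E : Type*} [NormedAddCommGroup E] [NormedSpace ℝ E] [FiniteDimensional ℝ E]

theorem finrank_complexDual_le : Module.finrank ℂ (E →L[ℝ] ℂ) ≤ Module.finrank ℝ E := by
  have h : Submodule.span ℂ (Set.range (coordCovector (E := E))) = ⊤ := by
    refine Submodule.eq_top_iff'.mpr fun α => ?_
    rw [covector_eq_sum' α]
    exact Submodule.sum_mem _ fun k _ =>
      Submodule.smul_mem _ _ (Submodule.subset_span ⟨k, rfl⟩)
  have h1 := finrank_range_le_card (R := ℂ) (coordCovector (E := E))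
  rwa [Set.finrank, h, finrank_top, Fintype.card_fin] at h1

theorem exteriorPower_eq_bot {k : ℕ} (hk : Module.finrank ℝ E < k) :
    ⋀[ℂ]^k (E →L[ℝ] ℂ) = ⊥ := by
  rw [← Submodule.finrank_eq_zero (R := ℂ), exteriorPower.finrank_eq]
  exact Nat.choose_eq_zero_of_lt (finrank_complexDual_le.trans_lt hk)

theorem ι_mul_ι_mem_exteriorPower (α β : E →L[ℝ] ℂ) :
    (ExteriorAlgebra.ι ℂ α * ExteriorAlgebra.ι ℂ β : CForm E) ∈ ⋀[ℂ]^2 (E →L[ℝ] ℂ) := by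
  rw [ExteriorAlgebra.exteriorPower, pow_two]
  exact Submodule.mul_mem_mul ⟨α, rfl⟩ ⟨β, rfl⟩

theorem flatExtDeriv_ι_mem_exteriorPower {α : E → (E →L[ℝ] ℂ)} {y : E}
    (hα : DifferentiableAt ℝ α y) :
    flatExtDeriv (fun z => ExteriorAlgebra.ι ℂ (α z)) y ∈ ⋀[ℂ]^2 (E →L[ℝ] ℂ) := by
  have h : ∀ z, (ExteriorAlgebra.ι ℂ (α z) : CForm E)
      = ∑ k, α z (Module.finBasis ℝ E k) • ExteriorAlgebra.ι ℂ (coordCovector k) := by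
    intro z
    conv_lhs => rw [covector_eq_sum' (α z)]
    simp only [map_sum, map_smul]
  rw [flatExtDeriv_congr_fun h, flatExtDeriv_sum _ _ _ fun k =>
    hα.clm_apply (differentiableAt_const _)]
  exact Submodule.sum_mem _ fun k _ => ι_mul_ι_mem_exteriorPower _ _

variable {n : Type*} [Fintype n] [DecidableEq n]

theorem flatCurv_pow_mem_exteriorPower {A : E → Matrix n n (E →L[ℝ] ℂ)} {y : E}
    (hA : ∀ i j, ContDiffAt ℝ ∞ (fun z => A z i j) y) (k : ℕ) (i j : n) :
    (flatCurv A y ^ k) i j ∈ ⋀[ℂ]^(2 * k) (E →L[ℝ] ℂ) := by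
  induction k generalizing i j with
  | zero =>
    rw [pow_zero, mul_zero, ExteriorAlgebra.exteriorPower, pow_zero, Matrix.one_apply]
    split_ifs
    · exact Submodule.one_le.mp le_rfl
    · exact Submodule.zero_mem _
  | succ k ih =>
    rw [pow_succ, Matrix.mul_apply]
    refine Submodule.sum_mem _ fun l _ => ?_
    rw [mul_add, mul_one, ExteriorAlgebra.exteriorPower, pow_add]
    refine Submodule.mul_mem_mul (ih i l) (Submodule.add_mem _ ?_ ?_)
    · exact flatExtDeriv_ι_mem_exteriorPower ((hA l j).differentiableAt (by simp))
    · exact Submodule.sum_mem _ fun m _ => ι_mul_ι_mem_exteriorPower _ _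

/-- The entries of the `k`-th power of the curvature are forms of degree `2k`, which vanish when
`2k` exceeds the dimension. -/
theorem flatCurv_pow_eq_zero {A : E → Matrix n n (E →L[ℝ] ℂ)} {y : E}
    (hA : ∀ i j, ContDiffAt ℝ ∞ (fun z => A z i j) y) {k : ℕ}
    (hk : Module.finrank ℝ E < 2 * k) : flatCurv A y ^ k = 0 := by
  ext i j
  have h := flatCurv_pow_mem_exteriorPower hA k i j
  rw [exteriorPower_eq_bot hk] at h
  exact (Submodule.mem_bot ℂ).mp h

theorem nilpotentEval_eq_sum {A : Type*} [Ring A] [Algebra ℂ A] (f : ℂ → ℂ) {X : A} {m : ℕ}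
    (hX : X ^ m = 0) : nilpotentEval f X = ∑ k ∈ range m, taylorCoeff f k • X ^ k := by
  refine sum_subset (range_subset_range.mpr (Nat.sInf_le hX)) fun k _ hk => ?_
  rw [pow_eq_zero_of_le (not_lt.mp fun h => hk (mem_range.mpr h)) (pow_nilpotencyClass ⟨m, hX⟩),
    smul_zero]

end Nilpotency

/-! ### Newton's identities in subalgebras and quotients -/

section NewtonQuotient

open Finset

variable {A : Type*} [CommRing A] [Algebra ℂ A]

/-- Positive integers are invertible in a complex algebra. -/
theorem natCast_succ_mul_injective (k : ℕ) {a b : A}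
    (h : ((k + 1 : ℕ) : A) * a = ((k + 1 : ℕ) : A) * b) : a = b := by
  have h1 := congrArg ((((k + 1 : ℕ) : ℂ)⁻¹) • ·) h
  have h2 : ∀ a : A, (((k + 1 : ℕ) : ℂ)⁻¹) • (((k + 1 : ℕ) : A) * a) = a := fun a => by
    rw [← nsmul_eq_mul, ← Nat.cast_smul_eq_nsmul ℂ, smul_smul,
      inv_mul_cancel₀ (Nat.cast_ne_zero.mpr k.succ_ne_zero), one_smul]
  exact (h2 a).symm.trans (h1.trans (h2 b))

theorem eq_zero_of_eq_neg {a : A} (h : a = -a) : a = 0 := by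
  refine natCast_succ_mul_injective 1 ?_
  rw [mul_zero, Nat.cast_add, Nat.cast_one, add_mul, one_mul]
  nth_rewrite 1 [h]
  exact neg_add_cancel a

/-- Newton's identities determine `c` from `c 0` and `T`. -/
theorem eq_of_newton {c c' T : ℕ → A} (h0 : c 0 = c' 0)
    (hN : ∀ k, ((k + 1 : ℕ) : A) * c (k + 1)
      = ∑ i ∈ range (k + 1), (-1) ^ i * c (k - i) * T (i + 1))
    (hN' : ∀ k, ((k + 1 : ℕ) : A) * c' (k + 1)
      = ∑ i ∈ range (k + 1), (-1) ^ i * c' (k - i) * T (i + 1)) (k : ℕ) : c k = c' k := by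
  induction k using Nat.strong_induction_on with
  | _ k ih =>
    rcases k with _ | k
    · exact h0
    · refine natCast_succ_mul_injective k ?_
      rw [hN, hN']
      exact sum_congr rfl fun i _ => by rw [ih (k - i) (by omega)]

theorem eq_zero_of_neg_one_pow_mul {a : A} {k : ℕ} (hk : Odd k) (h : (-1) ^ k * a = a) : a = 0 := by
  rw [hk.neg_one_pow, neg_one_mul] at h
  exact eq_zero_of_eq_neg h.symm

variable (S : Subalgebra ℂ A)

/-- By Newton's identities, `c` lies in every subalgebra that contains `T`. -/
theorem mem_of_newton {c T : ℕ → A} (h0 : c 0 = 1)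
    (hN : ∀ k, ((k + 1 : ℕ) : A) * c (k + 1)
      = ∑ i ∈ range (k + 1), (-1) ^ i * c (k - i) * T (i + 1))
    (hT : ∀ k, T k ∈ S) (k : ℕ) : c k ∈ S := by
  induction k using Nat.strong_induction_on with
  | _ k ih =>
    rcases k with _ | k
    · rw [h0]
      exact S.one_mem
    · have h1 : (((k + 1 : ℕ) : ℂ)⁻¹) • (((k + 1 : ℕ) : A) * c (k + 1)) = c (k + 1) := by
        rw [← nsmul_eq_mul, ← Nat.cast_smul_eq_nsmul ℂ, smul_smul,
          inv_mul_cancel₀ (Nat.cast_ne_zero.mpr k.succ_ne_zero), one_smul]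
      rw [← h1, hN]
      exact S.smul_mem (S.sum_mem fun i _ => S.mul_mem (S.mul_mem
        (S.pow_mem (S.neg_mem S.one_mem) _) (ih (k - i) (by omega))) (hT _)) _

variable {S} (I : Ideal S)

theorem quotient_mk_newton {c T : ℕ → A} (hc : ∀ k, c k ∈ S) (hT : ∀ k, T k ∈ S)
    (hN : ∀ k, ((k + 1 : ℕ) : A) * c (k + 1)
      = ∑ i ∈ range (k + 1), (-1) ^ i * c (k - i) * T (i + 1)) (k : ℕ) :
    ((k + 1 : ℕ) : S ⧸ I) * Ideal.Quotient.mk I ⟨c (k + 1), hc (k + 1)⟩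
      = ∑ i ∈ range (k + 1), (-1) ^ i * Ideal.Quotient.mk I ⟨c (k - i), hc (k - i)⟩
          * Ideal.Quotient.mk I ⟨T (i + 1), hT (i + 1)⟩ := by
  have h : ((k + 1 : ℕ) : S) * ⟨c (k + 1), hc (k + 1)⟩
      = ∑ i ∈ range (k + 1), (-1) ^ i * ⟨c (k - i), hc (k - i)⟩ * ⟨T (i + 1), hT (i + 1)⟩ := by
    refine Subtype.ext ?_
    rw [AddSubmonoidClass.coe_finsetSum]
    simpa using hN k
  simpa only [map_mul, map_natCast, map_sum, map_pow, map_neg, map_one] using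
    congrArg (Ideal.Quotient.mk I) h

theorem quotient_mk_smul {a : A} (ha : a ∈ S) (r : ℂ) :
    Ideal.Quotient.mk I ⟨r • a, S.smul_mem ha r⟩ = r • Ideal.Quotient.mk I ⟨a, ha⟩ := rfl

theorem quotient_mk_neg_one_pow_mul {a : A} (ha : a ∈ S) (k : ℕ) (h : (-1) ^ k * a ∈ S) :
    Ideal.Quotient.mk I ⟨(-1) ^ k * a, h⟩ = (-1) ^ k * Ideal.Quotient.mk I ⟨a, ha⟩ := by
  have h1 : (⟨(-1) ^ k * a, h⟩ : S) = (-1) ^ k * ⟨a, ha⟩ := Subtype.ext (by simp)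
  rw [h1, map_mul, map_pow, map_neg, map_one]

/-- A class that is represented both by `a` and, for odd `k`, by `(-1)ᵏ a` vanishes. -/
theorem quotient_mk_eq_zero_of_odd {a b : A} (ha : a ∈ S) (hb : b ∈ S) {k : ℕ} (hk : Odd k)
    (hab : b = (-1) ^ k * a)
    (h : Ideal.Quotient.mk I ⟨b, hb⟩ = Ideal.Quotient.mk I ⟨a, ha⟩) :
    Ideal.Quotient.mk I ⟨a, ha⟩ = 0 := by
  subst hab
  rw [quotient_mk_neg_one_pow_mul I ha] at h
  exact eq_zero_of_neg_one_pow_mul hk h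

theorem quotient_mk_sum_smul {T : ℕ → A} (hT : ∀ k, T k ∈ S) (r : ℕ → ℂ) (s : Finset ℕ)
    (h : ∑ k ∈ s, r k • T k ∈ S) :
    Ideal.Quotient.mk I ⟨∑ k ∈ s, r k • T k, h⟩
      = ∑ k ∈ s, r k • Ideal.Quotient.mk I ⟨T k, hT k⟩ := by
  have h1 : (⟨∑ k ∈ s, r k • T k, h⟩ : S) = ∑ k ∈ s, r k • ⟨T k, hT k⟩ := by
    refine Subtype.ext ?_
    rw [AddSubmonoidClass.coe_finsetSum]
    rfl
  rw [h1, map_sum]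
  rfl

end NewtonQuotient

theorem sum_range_two_mul {A : Type*} [AddCommMonoid A] (N : ℕ) (a : ℕ → A)
    (ha : ∀ k, Odd k → a k = 0) :
    ∑ k ∈ Finset.range (2 * N), a k = ∑ d ∈ Finset.range N, a (2 * d) := by
  induction N with
  | zero => simp
  | succ N ih =>
    rw [mul_add, mul_one, Finset.sum_range_succ, Finset.sum_range_succ, Finset.sum_range_succ, ih,
      ha (2 * N + 1) (odd_two_mul_add_one N), add_zero]

/-- The algebra behind the comparison of the additive class with the Pontryagin classes: if `c` and
`T` satisfy Newton's identities and the odd `T k` vanish, then `∑ f_k T_k` is the value of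
`∑ g(y_j)` when the elementary symmetric functions of the `y_j` are `(-1)ᵏ c_{2k}`. -/
theorem sum_taylorCoeff_smul_eq_symmetricEval {A : Type*} [CommRing A] [Algebra ℂ A] (n : ℕ)
    {c T : ℕ → A} (hc0 : c 0 = 1) (hcn : ∀ k, n < k → c k = 0)
    (hN : ∀ k, ((k + 1 : ℕ) : A) * c (k + 1)
      = ∑ i ∈ Finset.range (k + 1), (-1) ^ i * c (k - i) * T (i + 1))
    (hT : ∀ k, Odd k → T k = 0) {g f : ℂ → ℂ} (hg : AnalyticAt ℂ g 0) (hg0 : g 0 = 0)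
    (hf : ∀ z, f z = g (z ^ 2) / 2) (N : ℕ) :
    ∑ k ∈ Finset.range (2 * N), taylorCoeff f k • T k
      = symmetricEval (fun k : Fin (n / 2) => (-1) ^ ((k : ℕ) + 1) * c (2 * ((k : ℕ) + 1)))
          (truncatedSum g (n / 2) N) := by
  rw [sum_range_two_mul N _ fun k hk => by rw [hT k hk, smul_zero], truncatedSum_eq, map_sum]
  refine Finset.sum_congr rfl fun d _ => ?_
  rw [taylorCoeff_comp_sq hg hf, map_smul]
  rcases d with _ | d
  · simp [taylorCoeff, hg0]
  · rw [← two_mul_symmetricEval_psum n hc0 hcn hN hT d, two_mul, ← two_smul ℂ, smul_smul,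
      div_mul_cancel₀ _ two_ne_zero]

/-- `sum_taylorCoeff_smul_eq_symmetricEval` in a quotient `S ⧸ I`, phrased with the scalar
multiplication and the algebra structure that instance search finds for de Rham cohomology. -/
theorem sum_taylorCoeff_smul_eq_symmetricEval_quotient {A : Type*} [CommRing A] [Algebra ℂ A]
    {S : Subalgebra ℂ A} {I : Ideal S} (n : ℕ) {c T : ℕ → S ⧸ I} (hc0 : c 0 = 1)
    (hcn : ∀ k, n < k → c k = 0)
    (hN : ∀ k, ((k + 1 : ℕ) : S ⧸ I) * c (k + 1)
      = ∑ i ∈ Finset.range (k + 1), (-1) ^ i * c (k - i) * T (i + 1))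
    (hT : ∀ k, Odd k → T k = 0) {g f : ℂ → ℂ} (hg : AnalyticAt ℂ g 0) (hg0 : g 0 = 0)
    (hf : ∀ z, f z = g (z ^ 2) / 2) (N : ℕ) :
    ∑ k ∈ Finset.range (2 * N), taylorCoeff f k • T k
      = symmetricEval (fun k : Fin (n / 2) => (-1) ^ ((k : ℕ) + 1) * c (2 * ((k : ℕ) + 1)))
          (truncatedSum g (n / 2) N) :=
  sum_taylorCoeff_smul_eq_symmetricEval n hc0 hcn hN hT hg hg0 hf N

/-! ### Characteristic classes -/

section Classes

open Finset

variable {E : Type*} [NormedAddCommGroup E] [NormedSpace ℝ E] [FiniteDimensional ℝ E]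
  {M : Type*} [TopologicalSpace M] [ChartedSpace E M] [IsManifold 𝓘(ℝ, E) ∞ M]
  {F : Type*} [NormedAddCommGroup F] [NormedSpace ℝ F] [FiniteDimensional ℝ F]
  {V : M → Type*} [TopologicalSpace (TotalSpace F V)]
  [∀ x, AddCommGroup (V x)] [∀ x, Module ℝ (V x)] [∀ x, TopologicalSpace (V x)]
  [∀ x, IsTopologicalAddGroup (V x)] [∀ x, ContinuousSMul ℝ (V x)]
  [FiberBundle F V] [VectorBundle ℝ F V] [ContMDiffVectorBundle ∞ F V 𝓘(ℝ, E)]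

/-- The de Rham class of the form `tr Ωᵏ`. -/
def ConnectionForms.traceClass (D : ConnectionForms E F V) (k : ℕ) : EvenDeRham E M :=
  Ideal.Quotient.mk (exactEvenForms E M) ⟨D.traceForm k, D.traceForm_mem_closedEvenForms k⟩

theorem ConnectionForms.traceClass_eq (D₀ D₁ : ConnectionForms E F V) (k : ℕ) :
    D₁.traceClass k = D₀.traceClass k :=
  Ideal.Quotient.eq.mpr (D₀.exists_extDerivForm_eq_traceForm_sub D₁ k)

/-- As `V ⊗ ℂ` is isomorphic to its dual, the odd trace classes vanish. -/
theorem ConnectionForms.traceClass_odd [T2Space M] [SecondCountableTopology M]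
    (D : ConnectionForms E F V) {k : ℕ} (hk : Odd k) : D.traceClass k = 0 := by
  obtain ⟨ρ, hρ⟩ := exists_isSubordinate_baseSet E F V
  exact quotient_mk_eq_zero_of_odd (exactEvenForms E M) (D.traceForm_mem_closedEvenForms k)
    ((D.dual hρ).traceForm_mem_closedEvenForms k) hk (D.traceForm_dual hρ k)
    (ConnectionForms.traceClass_eq _ _ k)

namespace ComplexifiedConnection

/-- The form `tr (Ω / 2πi)ᵏ`. -/
def powerForm (cov : ComplexifiedConnection E F V) (k : ℕ) : EvenForm E M :=
  fun x => (cov.normalizedCurvature x ^ k).trace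

variable [T2Space M] (cov : ComplexifiedConnection E F V)

theorem powerForm_eq (k : ℕ) : cov.powerForm k
    = ((2 * (Real.pi : ℂ) * Complex.I)⁻¹) ^ k • cov.connectionForms.traceForm k := by
  funext x
  exact (congrArg Matrix.trace (smul_pow _ (cov.curvatureMatrix x x) k)).trans
    (Matrix.trace_smul _ _)

theorem powerForm_mem (k : ℕ) : cov.powerForm k ∈ closedEvenForms E M := by
  rw [powerForm_eq]
  exact (closedEvenForms E M).smul_mem (cov.connectionForms.traceForm_mem_closedEvenForms k) _

/-- The de Rham class of the form `tr (Ω / 2πi)ᵏ`. -/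
def powerClass (k : ℕ) : EvenDeRham E M :=
  Ideal.Quotient.mk (exactEvenForms E M) ⟨cov.powerForm k, cov.powerForm_mem k⟩

theorem powerClass_eq_smul (k : ℕ) : cov.powerClass k
    = ((2 * (Real.pi : ℂ) * Complex.I)⁻¹) ^ k • cov.connectionForms.traceClass k :=
  (congrArg (Ideal.Quotient.mk (exactEvenForms E M)) (Subtype.ext (cov.powerForm_eq k))).trans
    (quotient_mk_smul _ (cov.connectionForms.traceForm_mem_closedEvenForms k) _)

theorem powerClass_eq (cov cov' : ComplexifiedConnection E F V) (k : ℕ) :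
    cov.powerClass k = cov'.powerClass k := by
  rw [powerClass_eq_smul, powerClass_eq_smul, ConnectionForms.traceClass_eq]

theorem powerClass_odd [SecondCountableTopology M] {k : ℕ} (hk : Odd k) :
    cov.powerClass k = 0 := by
  rw [powerClass_eq_smul, ConnectionForms.traceClass_odd _ hk, smul_zero]

/-- The unit is written as the constant function `1`, which spares a lengthy instance search. -/
theorem chernForm_zero : chernForm 0 cov = fun _ => 1 :=
  funext fun x => detCoeff_zero (cov.normalizedCurvature x)

theorem chernForm_eq_zero {k : ℕ} (hk : Module.finrank ℝ F < k) : chernForm k cov = 0 :=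
  funext fun x => detCoeff_eq_zero (cov.normalizedCurvature x) (by rwa [Fintype.card_fin])

/-- Newton's identities for the Chern forms. -/
theorem succ_mul_chernForm (k : ℕ) : ((k + 1 : ℕ) : EvenForm E M) * chernForm (k + 1) cov
    = ∑ i ∈ range (k + 1), (-1) ^ i * chernForm (k - i) cov * cov.powerForm (i + 1) := by
  funext x
  rw [Finset.sum_apply]
  exact succ_mul_detCoeff (cov.normalizedCurvature x) k

theorem chernForm_mem (k : ℕ) : chernForm k cov ∈ closedEvenForms E M :=
  mem_of_newton (closedEvenForms E M) (c := fun k => chernForm k cov) cov.chernForm_zero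
    cov.succ_mul_chernForm cov.powerForm_mem k

/-- The de Rham class of the Chern form. -/
def chernClass (k : ℕ) : EvenDeRham E M :=
  Ideal.Quotient.mk (exactEvenForms E M) ⟨chernForm k cov, cov.chernForm_mem k⟩

theorem chernClass_zero : cov.chernClass 0 = 1 :=
  congrArg (Ideal.Quotient.mk (exactEvenForms E M)) (Subtype.ext cov.chernForm_zero)

theorem chernClass_eq_zero {k : ℕ} (hk : Module.finrank ℝ F < k) : cov.chernClass k = 0 :=
  congrArg (Ideal.Quotient.mk (exactEvenForms E M)) (Subtype.ext (cov.chernForm_eq_zero hk))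

theorem succ_mul_chernClass (k : ℕ) : ((k + 1 : ℕ) : EvenDeRham E M) * cov.chernClass (k + 1)
    = ∑ i ∈ range (k + 1), (-1) ^ i * cov.chernClass (k - i) * cov.powerClass (i + 1) :=
  quotient_mk_newton (exactEvenForms E M) (c := fun k => chernForm k cov) cov.chernForm_mem
    cov.powerForm_mem cov.succ_mul_chernForm k

theorem chernClass_eq (cov cov' : ComplexifiedConnection E F V) (k : ℕ) :
    cov.chernClass k = cov'.chernClass k := by
  refine eq_of_newton (cov.chernClass_zero.trans cov'.chernClass_zero.symm)
    cov.succ_mul_chernClass (fun k => ?_) k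
  rw [cov'.succ_mul_chernClass]
  exact sum_congr rfl fun i _ => by rw [powerClass_eq cov cov']

theorem pontryaginForm_mem (k : ℕ) : pontryaginForm k cov ∈ closedEvenForms E M :=
  (closedEvenForms E M).mul_mem ((closedEvenForms E M).pow_mem
    ((closedEvenForms E M).neg_mem (closedEvenForms E M).one_mem) _) (cov.chernForm_mem _)

theorem deRhamClass_pontryaginForm (k : ℕ) :
    deRhamClass (pontryaginForm k cov) = (-1) ^ k * cov.chernClass (2 * k) := by
  rw [deRhamClass, dif_pos (cov.pontryaginForm_mem k)]
  exact quotient_mk_neg_one_pow_mul _ (cov.chernForm_mem _) k (cov.pontryaginForm_mem k)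

/-- The entries of `Ωᵏ` have degree `2k`. -/
theorem normalizedCurvature_pow_eq_zero (x : M) {k : ℕ} (hk : Module.finrank ℝ E < 2 * k) :
    cov.normalizedCurvature x ^ k = 0 := by
  have hx : (chartAt E x).symm (chartAt E x x) = x := (chartAt E x).left_inv (mem_chart_source E x)
  have h1 : flatCurv (matInChart x (cov.connectionMatrix x)) (chartAt E x x) ^ k = 0 := by
    refine flatCurv_pow_eq_zero (fun i j => ?_) hk
    refine cov.connectionForms.smooth x x _ (mem_chart_target E x) ?_ i j
    rw [hx]
    exact FiberBundle.mem_baseSet_trivializationAt' x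
  have h2 : (formCurv (cov.connectionMatrix x) x ^ k).map evenVal = 0 := by
    rw [evenVal_map_pow, formCurv_eq_pullback, ← pullback_map_pow, h1]
    exact Matrix.map_zero _ (map_zero _)
  have h3 : formCurv (cov.connectionMatrix x) x ^ k = 0 := by
    ext1 i j
    exact evenVal_injective ((congrFun (congrFun h2 i) j).trans (map_zero evenVal).symm)
  refine (smul_pow _ (cov.curvatureMatrix x x) k).trans ?_
  exact (congrArg _ h3).trans (smul_zero _)

theorem additiveForm_eq_sum (f : ℂ → ℂ) {m : ℕ} (hm : Module.finrank ℝ E < 2 * m) :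
    additiveForm f cov = ∑ k ∈ range m, taylorCoeff f k • cov.powerForm k := by
  funext x
  rw [additiveForm, nilpotentEval_eq_sum f (cov.normalizedCurvature_pow_eq_zero x hm),
    Matrix.trace_sum, Finset.sum_apply]
  exact sum_congr rfl fun k _ => Matrix.trace_smul _ _

theorem additiveForm_mem (f : ℂ → ℂ) : additiveForm f cov ∈ closedEvenForms E M := by
  rw [cov.additiveForm_eq_sum f (m := Module.finrank ℝ E + 1) (by omega)]
  exact (closedEvenForms E M).sum_mem fun k _ =>
    (closedEvenForms E M).smul_mem (cov.powerForm_mem k) _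

theorem deRhamClass_additiveForm (f : ℂ → ℂ) {m : ℕ} (hm : Module.finrank ℝ E < 2 * m) :
    deRhamClass (additiveForm f cov) = ∑ k ∈ range m, taylorCoeff f k • cov.powerClass k := by
  have h := cov.additiveForm_mem f
  rw [cov.additiveForm_eq_sum f hm] at h ⊢
  rw [deRhamClass, dif_pos h]
  exact quotient_mk_sum_smul _ cov.powerForm_mem _ _ h

theorem deRhamClass_additiveForm_eq (cov cov' : ComplexifiedConnection E F V) (f : ℂ → ℂ) :
    deRhamClass (additiveForm f cov) = deRhamClass (additiveForm f cov') := by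
  have hm : Module.finrank ℝ E < 2 * (Module.finrank ℝ E + 1) := by omega
  rw [cov.deRhamClass_additiveForm f hm, cov'.deRhamClass_additiveForm f hm]
  exact sum_congr rfl fun k _ => by rw [cov.powerClass_eq cov']

theorem deRhamClass_pontryaginForm_eq (cov cov' : ComplexifiedConnection E F V) (k : ℕ) :
    deRhamClass (pontryaginForm k cov) = deRhamClass (pontryaginForm k cov') := by
  rw [cov.deRhamClass_pontryaginForm, cov'.deRhamClass_pontryaginForm, cov.chernClass_eq cov']

theorem deRhamClass_additiveForm_eq_symmetricEval [SecondCountableTopology M] {g f : ℂ → ℂ}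
    (hg : AnalyticAt ℂ g 0) (hg0 : g 0 = 0) (hf : ∀ z, f z = g (z ^ 2) / 2) {N : ℕ}
    (hN : Module.finrank ℝ E < 4 * N) :
    deRhamClass (additiveForm f cov) =
      symmetricEval
        (fun k : Fin (Module.finrank ℝ F / 2) => deRhamClass (pontryaginForm ((k : ℕ) + 1) cov))
        (truncatedSum g (Module.finrank ℝ F / 2) N) := by
  have hp : (fun k : Fin (Module.finrank ℝ F / 2) => deRhamClass (pontryaginForm ((k : ℕ) + 1) cov))
      = fun k : Fin (Module.finrank ℝ F / 2) =>
          (-1) ^ ((k : ℕ) + 1) * cov.chernClass (2 * ((k : ℕ) + 1)) :=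
    funext fun k => cov.deRhamClass_pontryaginForm _
  rw [hp]
  refine (cov.deRhamClass_additiveForm f (m := 2 * N) (by omega)).trans ?_
  exact sum_taylorCoeff_smul_eq_symmetricEval_quotient (Module.finrank ℝ F) cov.chernClass_zero
    (fun k hk => cov.chernClass_eq_zero hk) cov.succ_mul_chernClass
    (fun k hk => cov.powerClass_odd hk) hg hg0 hf N

end ComplexifiedConnection

end Classes

theorem mainTheorem2
    {E : Type*} [NormedAddCommGroup E] [NormedSpace ℝ E] [FiniteDimensional ℝ E]
    {M : Type*} [TopologicalSpace M] [T2Space M] [SecondCountableTopology M]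
    [ChartedSpace E M] [IsManifold 𝓘(ℝ, E) ∞ M]
    {F : Type*} [NormedAddCommGroup F] [NormedSpace ℝ F] [FiniteDimensional ℝ F]
    {V : M → Type*} [TopologicalSpace (TotalSpace F V)]
    [∀ x, AddCommGroup (V x)] [∀ x, Module ℝ (V x)] [∀ x, TopologicalSpace (V x)]
    [∀ x, IsTopologicalAddGroup (V x)] [∀ x, ContinuousSMul ℝ (V x)]
    [FiberBundle F V] [VectorBundle ℝ F V] [ContMDiffVectorBundle ∞ F V 𝓘(ℝ, E)]
    (g : ℂ → ℂ) (hg : AnalyticAt ℂ g 0) (hg0 : g 0 = 0)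
    (f : ℂ → ℂ) (hf : ∀ z, f z = g (z ^ 2) / 2) :
    Nonempty (ComplexifiedConnection E F V) ∧
    (∀ cov : ComplexifiedConnection E F V,
      additiveForm f cov ∈ closedEvenForms E M ∧
      deRhamClass (additiveForm f cov) = additiveClass E F V f) ∧
    (∀ (cov : ComplexifiedConnection E F V) (k : ℕ),
      pontryaginForm k cov ∈ closedEvenForms E M ∧
      deRhamClass (pontryaginForm k cov) = pontryaginClass E F V k) ∧
    ∀ N : ℕ, Module.finrank ℝ E < 4 * N →
      additiveClass E F V f =
        symmetricEval
          (fun k : Fin (Module.finrank ℝ F / 2) => pontryaginClass E F V (k + 1))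
          (truncatedSum g (Module.finrank ℝ F / 2) N) := by
  obtain ⟨ρ, hρ⟩ := exists_isSubordinate_baseSet E F V
  have hne := nonempty_complexifiedConnection hρ
  have hadd : ∀ cov : ComplexifiedConnection E F V,
      deRhamClass (additiveForm f cov) = additiveClass E F V f := by
    intro cov
    rw [cov.deRhamClass_additiveForm_eq hne.some f, additiveClass, dif_pos hne]
  have hpont : ∀ (cov : ComplexifiedConnection E F V) (k : ℕ),
      deRhamClass (pontryaginForm k cov) = pontryaginClass E F V k := by
    intro cov k
    rw [cov.deRhamClass_pontryaginForm_eq hne.some k, pontryaginClass, dif_pos hne]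
  refine ⟨hne, fun cov => ⟨cov.additiveForm_mem f, hadd cov⟩,
    fun cov k => ⟨cov.pontryaginForm_mem k, hpont cov k⟩, fun N hN => ?_⟩
  have h := hne.some.deRhamClass_additiveForm_eq_symmetricEval hg hg0 hf hN
  simp only [hadd, hpont] at h
  exact h

end
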